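/- Let $X=\{(x,y,z)\in\mathbb{C}^3 : xz=y^3\}$ be the affine model of the $A_2$ surface singularity, let $\sigma:\tilde X\to X$ be its minimal resolution, obtained as the strict transform of $X$ under the blow-up of $\mathbb{C}^3$ at the origin, and let $E=\sigma^{-1}(0)$ be the exceptional locus. For a complex surface $U$ and $m\ge 0$ let $H^0(U,S^m\Omega^1_U)$ be the space of holomorphic symmetric differentials of degree $m$ on $U$. (1) For every open neighbourhood $W$ of $E$ in $\tilde X$ (so, for every representative of the germ $(\tilde X,E)$) and every $m$, the vector space $H^0(W\setminus E,S^m\Omega^1_W)/H^0(W,S^m\Omega^1_W)$ is finite-dimensional, and $$h^0(x):=\lim_{m\to\infty}\frac{\dim\big[H^0(W\setminus E,S^m\Omega^1_W)/H^0(W,S^m\Omega^1_W)\big]}{m^3}=\frac{29}{216}.$$ (2) For every $m$ the vector space $H^1(\tilde X,S^m\Omega^1_{\tilde X})$ is finite-dimensional, and $$h^1(x):=\lim_{m\to\infty}\frac{\dim H^1(\tilde X,S^m\Omega^1_{\tilde X})}{m^3}=\frac{67}{216}.$$ Here $H^1(\tilde X,S^m\Omega^1_{\tilde X})$ is computed as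 the first Čech cohomology of the sheaf of holomorphic sections of $S^m\Omega^1_{\tilde X}$ for the cover of $\tilde X$ by the three standard charts of the blow-up (where the first, second or third homogeneous coordinate of the line is non-zero), each of which is biholomorphic to $\mathbb{C}^2$, with Stein intersections. -/

import Mathlib

open Set Filter Topology Manifold ContDiff TopologicalSpace
open scoped LinearAlgebra.Projectivization

noncomputable section

/-! ### Holomorphic symmetric differentials on a complex manifold -/

namespace SymmetricDifferential

variable (E : Type*) [NormedAddCommGroup E] [NormedSpace ℂ E]
  {M : Type*} [TopologicalSpace M] [ChartedSpace E M] [IsManifold 𝓘(ℂ, E) ω M]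

/-- The total space of the holomorphic tangent bundle of the open subset `U` of `M`, as an open
subset of the total space of the tangent bundle of `M`. -/
def tangentOver (U : Opens M) : Opens (TangentBundle 𝓘(ℂ, E) M) :=
  ⟨{v | v.proj ∈ U}, U.isOpen.preimage (FiberBundle.continuous_proj E (TangentSpace 𝓘(ℂ, E)))⟩

/-- The point `(p, v)` of the tangent bundle of `U`, for `p ∈ U` and `v` a tangent vector at `p`. -/
def tangentPt {U : Opens M} (p : U) (v : TangentSpace 𝓘(ℂ, E) (p : M)) : tangentOver E U :=
  ⟨⟨p, v⟩, p.2⟩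

/-- `H⁰(U, SᵐΩ¹)`: the holomorphic symmetric differentials of degree `m` on the open set `U`.
The fibre of `SᵐΩ¹` at `p` is the space of homogeneous polynomials of degree `m` on the tangent
space at `p`, that is, of the maps `v ↦ A(v, …, v)` with `A` an `m`-linear form. A section of
`SᵐΩ¹` over `U` is therefore a function on the tangent bundle of `U` that is such a polynomial on
each tangent space, and it is a holomorphic section if and only if the function is holomorphic. -/
def sections (m : ℕ) (U : Opens M) : Submodule ℂ (tangentOver E U → ℂ) where
  carrier := {f | MDifferentiable 𝓘(ℂ, E).tangent 𝓘(ℂ, ℂ) f ∧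
    ∀ p : U, ∃ A : MultilinearMap ℂ (fun _ : Fin m => TangentSpace 𝓘(ℂ, E) (p : M)) ℂ,
      ∀ v, f (tangentPt E p v) = A fun _ => v}
  add_mem' := by
    rintro f g ⟨hf, hf'⟩ ⟨hg, hg'⟩
    refine ⟨hf.add hg, fun p => ?_⟩
    obtain ⟨A, hA⟩ := hf' p
    obtain ⟨B, hB⟩ := hg' p
    exact ⟨A + B, fun v => by simp [hA, hB]⟩
  zero_mem' := ⟨mdifferentiable_const, fun _ => ⟨0, fun _ => rfl⟩⟩
  smul_mem' := by
    rintro c f ⟨hf, hf'⟩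
    refine ⟨hf.const_smul c, fun p => ?_⟩
    obtain ⟨A, hA⟩ := hf' p
    exact ⟨c • A, fun v => by simp [hA]⟩

/-- The restriction map `H⁰(V, SᵐΩ¹) → H⁰(U, SᵐΩ¹)` for `U ⊆ V`. -/
def restrict (m : ℕ) {U V : Opens M} (h : U ≤ V) :
    sections E m V →ₗ[ℂ] sections E m U where
  toFun f := ⟨fun v => f.1 ⟨v.1, h v.2⟩, by
    have hUV : tangentOver E U ≤ tangentOver E V := fun v hv => h hv
    refine ⟨f.2.1.comp ((contMDiff_inclusion (n := 1) hUV).mdifferentiable one_ne_zero),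
      fun p => ?_⟩
    exact f.2.2 ⟨p.1, h p.2⟩⟩
  map_add' _ _ := rfl
  map_smul' _ _ := rfl

/-- For a closed set `Z` (given by the open set `Zc`, its complement) and an open set `W`, the
quotient `H⁰(W ∖ Z, SᵐΩ¹) / H⁰(W, SᵐΩ¹)`. -/
abbrev ExtensionQuotient (m : ℕ) (W Zc : Opens M) : Type _ :=
  sections E m (W ⊓ Zc) ⧸
    LinearMap.range (restrict E m (inf_le_left : W ⊓ Zc ≤ W))

section Cech

variable {ι : Type*}

/-- The Čech 0-cochains of `SᵐΩ¹` for a family of open sets. -/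
def Cochain0 (m : ℕ) (𝒰 : ι → Opens M) : Type _ := ∀ i, sections E m (𝒰 i)

/-- The Čech 1-cochains of `SᵐΩ¹` for a family of open sets. -/
def Cochain1 (m : ℕ) (𝒰 : ι → Opens M) : Type _ := ∀ i j, sections E m (𝒰 i ⊓ 𝒰 j)

/-- The Čech 2-cochains of `SᵐΩ¹` for a family of open sets. -/
def Cochain2 (m : ℕ) (𝒰 : ι → Opens M) : Type _ := ∀ i j k, sections E m (𝒰 i ⊓ 𝒰 j ⊓ 𝒰 k)

instance (m : ℕ) (𝒰 : ι → Opens M) : AddCommGroup (Cochain0 E m 𝒰) :=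
  inferInstanceAs (AddCommGroup (∀ i, sections E m (𝒰 i)))

instance (m : ℕ) (𝒰 : ι → Opens M) : Module ℂ (Cochain0 E m 𝒰) :=
  inferInstanceAs (Module ℂ (∀ i, sections E m (𝒰 i)))

instance (m : ℕ) (𝒰 : ι → Opens M) : AddCommGroup (Cochain1 E m 𝒰) :=
  inferInstanceAs (AddCommGroup (∀ i j, sections E m (𝒰 i ⊓ 𝒰 j)))

instance (m : ℕ) (𝒰 : ι → Opens M) : Module ℂ (Cochain1 E m 𝒰) :=
  inferInstanceAs (Module ℂ (∀ i j, sections E m (𝒰 i ⊓ 𝒰 j)))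

instance (m : ℕ) (𝒰 : ι → Opens M) : AddCommGroup (Cochain2 E m 𝒰) :=
  inferInstanceAs (AddCommGroup (∀ i j k, sections E m (𝒰 i ⊓ 𝒰 j ⊓ 𝒰 k)))

instance (m : ℕ) (𝒰 : ι → Opens M) : Module ℂ (Cochain2 E m 𝒰) :=
  inferInstanceAs (Module ℂ (∀ i j k, sections E m (𝒰 i ⊓ 𝒰 j ⊓ 𝒰 k)))

/-- The Čech coboundary `(sᵢ) ↦ (sⱼ - sᵢ)`, from 0-cochains to 1-cochains. -/
def cechD0 (m : ℕ) (𝒰 : ι → Opens M) : Cochain0 E m 𝒰 →ₗ[ℂ] Cochain1 E m 𝒰 where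
  toFun s i j := restrict E m inf_le_right (s j) - restrict E m inf_le_left (s i)
  map_add' s t := by
    funext i j
    change restrict E m _ (s j + t j) - restrict E m _ (s i + t i) = (_ - _) + (_ - _)
    simp only [map_add]
    abel
  map_smul' c s := by
    funext i j
    change restrict E m _ (c • s j) - restrict E m _ (c • s i) = c • (_ - _)
    simp only [map_smul, smul_sub]

/-- The Čech coboundary `(sᵢⱼ) ↦ (sⱼₖ - sᵢₖ + sᵢⱼ)`, from 1-cochains to 2-cochains. -/
def cechD1 (m : ℕ) (𝒰 : ι → Opens M) : Cochain1 E m 𝒰 →ₗ[ℂ] Cochain2 E m 𝒰 where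
  toFun s i j k :=
    restrict E m (le_inf (inf_le_left.trans inf_le_right) inf_le_right) (s j k) -
      restrict E m (le_inf (inf_le_left.trans inf_le_left) inf_le_right) (s i k) +
      restrict E m inf_le_left (s i j)
  map_add' s t := by
    funext i j k
    change restrict E m _ (s j k + t j k) - restrict E m _ (s i k + t i k) +
      restrict E m _ (s i j + t i j) = (_ - _ + _) + (_ - _ + _)
    simp only [map_add]
    abel
  map_smul' c s := by
    funext i j k
    change restrict E m _ (c • s j k) - restrict E m _ (c • s i k) +
      restrict E m _ (c • s i j) = c • (_ - _ + _)
    simp only [map_smul, smul_add, smul_sub]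

/-- The first Čech cohomology group of `SᵐΩ¹` for a family of open sets: 1-cocycles modulo
1-coboundaries. If the open sets form a locally finite cover of `M` and are Stein, this is
`H¹(M, SᵐΩ¹)`. -/
abbrev CechH1 (m : ℕ) (𝒰 : ι → Opens M) : Type _ :=
  LinearMap.ker (cechD1 E m 𝒰) ⧸
    (LinearMap.range (cechD0 E m 𝒰)).submoduleOf (LinearMap.ker (cechD1 E m 𝒰))

end Cech

end SymmetricDifferential

/-! ### The minimal resolution of the `A₂` singularity -/

/-- The affine model of the `A₂` singularity: the surface `xz = y³` in `ℂ³`, singular at `0`. -/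
def A2Surface : Set (Fin 3 → ℂ) := {p | p 0 * p 2 = p 1 ^ 3}

/-- The minimal resolution of the `A₂` singularity: the strict transform of the surface `xz = y³`
under the blow-up of `ℂ³` at the origin. The blow-up consists of the pairs of a point `pt` and a
line `line` through `0` that contains it; on it the strict transform is given by `v₀ v₂ = y v₁²`
for `v` in the line (where `v` is a multiple of the point, this is the equation `xz = y³`, with
the equation of the exceptional plane divided out). -/
@[ext]
structure A2Resolution where
  /-- the point of `ℂ³` -/
  pt : Fin 3 → ℂ
  /-- the line through the origin -/
  line : ℙ ℂ (Fin 3 → ℂ)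
  pt_mem : pt ∈ line.submodule
  eqn : ∀ v ∈ line.submodule, v 0 * v 2 = pt 1 * v 1 ^ 2

namespace A2Resolution

/-- The resolution map `σ`. -/
def sigma (q : A2Resolution) : A2Surface :=
  ⟨q.pt, by have := q.eqn q.pt q.pt_mem; simp only [A2Surface, mem_ofPred_eq, this]; ring⟩

/-- The direction vector of the line with `j`-th coordinate `1`, in the `j`-th chart. -/
def vec : Fin 3 → ℂ × ℂ → Fin 3 → ℂ
  | 0, c => ![1, c.2, c.1 * c.2 ^ 3]
  | 1, c => ![c.1, 1, c.2]
  | 2, c => ![c.1 ^ 3 * c.2, c.1, 1]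

/-- The point is `scale j c • vec j c` in the `j`-th chart. -/
def scale : Fin 3 → ℂ × ℂ → ℂ
  | 0, c => c.1
  | 1, c => c.1 * c.2
  | 2, c => c.2

lemma vec_self (j : Fin 3) (c : ℂ × ℂ) : vec j c j = 1 := by
  fin_cases j <;> simp [vec]

lemma vec_ne_zero (j : Fin 3) (c : ℂ × ℂ) : vec j c ≠ 0 := fun h => by
  have := vec_self j c
  simp [h] at this

/-- The inverse of the `j`-th chart. -/
def param (j : Fin 3) (c : ℂ × ℂ) : A2Resolution where
  pt := scale j c • vec j c
  line := Projectivization.mk ℂ (vec j c) (vec_ne_zero j c)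
  pt_mem := Submodule.smul_mem _ _ (Submodule.mem_span_singleton_self _)
  eqn := by
    intro v hv
    rw [Projectivization.submodule_mk, Submodule.mem_span_singleton] at hv
    obtain ⟨t, rfl⟩ := hv
    fin_cases j <;> simp [vec, scale] <;> ring

/-- The coordinates in the `j`-th chart: `(x, y/x)`, `(x/y, z/y)` and `(y/z, z)`, where the
quotients are those of the homogeneous coordinates of the line. -/
def coord : Fin 3 → A2Resolution → ℂ × ℂ
  | 0, q => (q.pt 0, q.line.rep 1 / q.line.rep 0)
  | 1, q => (q.line.rep 0 / q.line.rep 1, q.line.rep 2 / q.line.rep 1)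
  | 2, q => (q.line.rep 1 / q.line.rep 2, q.pt 2)

lemma rep_param (j : Fin 3) (c : ℂ × ℂ) :
    ∃ t : ℂ, t ≠ 0 ∧ (param j c).line.rep = t • vec j c := by
  obtain ⟨t, ht⟩ := Projectivization.exists_smul_eq_mk_rep ℂ (vec j c) (vec_ne_zero j c)
  exact ⟨t, t.ne_zero, ht.symm⟩

lemma rep_param_ne_zero_iff (i j : Fin 3) (c : ℂ × ℂ) :
    (param i c).line.rep j ≠ 0 ↔ vec i c j ≠ 0 := by
  obtain ⟨t, ht, h⟩ := rep_param i c
  simp [h, ht]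

lemma ratio_param (i j k : Fin 3) (c : ℂ × ℂ) :
    (param i c).line.rep k / (param i c).line.rep j = vec i c k / vec i c j := by
  obtain ⟨t, ht, h⟩ := rep_param i c
  simp [h, mul_div_mul_left _ _ ht]

lemma param_coord (j : Fin 3) (q : A2Resolution) (hq : q.line.rep j ≠ 0) :
    param j (coord j q) = q := by
  have hm := q.pt_mem
  rw [Projectivization.submodule_eq, Submodule.mem_span_singleton] at hm
  obtain ⟨t, ht⟩ := hm
  have he := q.eqn q.line.rep
    (by rw [Projectivization.submodule_eq]; exact Submodule.mem_span_singleton_self _)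
  have hp : ∀ i, q.pt i = t * q.line.rep i := fun i => by rw [← ht]; simp
  rw [hp] at he
  have hs : scale j (coord j q) = t * q.line.rep j := by
    fin_cases j
    · simp [scale, coord, hp]
    · simp only [scale, coord, Fin.mk_one] at hq ⊢
      field_simp
      linear_combination he
    · simp [scale, coord, hp]
  have hv : vec j (coord j q) = (q.line.rep j)⁻¹ • q.line.rep := by
    fin_cases j
    · ext k
      fin_cases k <;> simp [vec, coord, hp] at hq ⊢ <;> field_simp
      linear_combination -he
    · ext k
      fin_cases k <;> simp [vec, coord] at hq ⊢ <;> field_simp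
    · ext k
      fin_cases k <;> simp [vec, coord, hp] at hq ⊢ <;> field_simp
      linear_combination -he
  ext1
  · simp only [param, hs, hv, smul_smul]
    rw [mul_assoc, mul_inv_cancel₀ hq, mul_one, ht]
  · simp only [param]
    conv_rhs => rw [← Projectivization.mk_rep q.line]
    rw [Projectivization.mk_eq_mk_iff']
    exact ⟨_, hv.symm⟩

lemma coord_param (j : Fin 3) (c : ℂ × ℂ) : coord j (param j c) = c := by
  fin_cases j <;> simp [coord, ratio_param] <;> simp [param, vec, scale]

/-- The `j`-th chart: the points whose line has non-zero `j`-th homogeneous coordinate are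
parametrized by `ℂ²`. -/
def chart (j : Fin 3) : PartialEquiv A2Resolution (ℂ × ℂ) where
  toFun := coord j
  invFun := param j
  source := {q | q.line.rep j ≠ 0}
  target := univ
  map_source' _ _ := mem_univ _
  map_target' c _ := by
    simp only [mem_ofPred_eq, rep_param_ne_zero_iff, vec_self]
    exact one_ne_zero
  left_inv' q hq := param_coord j q hq
  right_inv' c _ := coord_param j c

lemma contDiff_vec (i k : Fin 3) : ContDiff ℂ ω (fun c => vec i c k) := by
  fin_cases i <;> fin_cases k <;> simp [vec] <;> fun_prop

lemma contDiff_scale (i : Fin 3) : ContDiff ℂ ω (scale i) := by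
  fin_cases i
  · exact contDiff_fst
  · exact contDiff_fst.mul contDiff_snd
  · exact contDiff_snd

lemma transition_source (i j : Fin 3) :
    ((chart i).symm.trans (chart j)).source = {c | vec i c j ≠ 0} := by
  ext c
  simp only [PartialEquiv.trans_source, PartialEquiv.symm_source, chart, mem_inter_iff, mem_univ,
    true_and, mem_preimage, mem_ofPred_eq]
  exact rep_param_ne_zero_iff i j c

lemma contDiffOn_transition (i j : Fin 3) :
    ContDiffOn ℂ ω ((chart i).symm.trans (chart j)) ((chart i).symm.trans (chart j)).source := by
  rw [transition_source]
  have hr : ∀ k, ContDiffOn ℂ ω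
      (fun c => (param i c).line.rep k / (param i c).line.rep j) {c | vec i c j ≠ 0} := fun k => by
    simp only [ratio_param]
    exact (contDiff_vec i k).contDiffOn.div (contDiff_vec i j).contDiffOn fun c hc => hc
  have hp : ∀ k, ContDiffOn ℂ ω (fun c => (param i c).pt k) {c | vec i c j ≠ 0} := fun k =>
    ((contDiff_scale i).mul (contDiff_vec i k)).contDiffOn
  fin_cases j
  · exact (hp 0).prodMk (hr 1)
  · exact (hr 0).prodMk (hr 2)
  · exact (hr 1).prodMk (hp 2)

lemma exists_rep_ne_zero (q : A2Resolution) : ∃ j, q.line.rep j ≠ 0 := by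
  by_contra! h
  exact q.line.rep_nonzero (funext h)

/-- The three charts define the complex manifold structure. -/
def core : ChartedSpaceCore (ℂ × ℂ) A2Resolution where
  atlas := range chart
  chartAt q := chart (exists_rep_ne_zero q).choose
  mem_chart_source q := (exists_rep_ne_zero q).choose_spec
  chart_mem_atlas q := mem_range_self _
  open_source := by
    rintro _ _ ⟨i, rfl⟩ ⟨j, rfl⟩
    rw [transition_source]
    exact isOpen_ne_fun (contDiff_vec i j).continuous continuous_const
  continuousOn_toFun := by
    rintro _ _ ⟨i, rfl⟩ ⟨j, rfl⟩
    exact (contDiffOn_transition i j).continuousOn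

instance : TopologicalSpace A2Resolution := core.toTopologicalSpace

instance : ChartedSpace (ℂ × ℂ) A2Resolution := core.toChartedSpace

instance : IsManifold 𝓘(ℂ, ℂ × ℂ) ω A2Resolution := by
  refine isManifold_of_contDiffOn _ _ _ ?_
  intro e e' he he'
  obtain ⟨_, ⟨_, rfl⟩, he⟩ := he
  obtain ⟨_, ⟨⟨i, rfl⟩, rfl⟩, rfl⟩ := he
  obtain ⟨_, ⟨_, rfl⟩, he'⟩ := he'
  obtain ⟨_, ⟨⟨j, rfl⟩, rfl⟩, rfl⟩ := he'
  have := contDiffOn_transition i j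
  simp only [modelWithCornersSelf_coe, modelWithCornersSelf_coe_symm, Function.id_comp,
    Function.comp_id, preimage_id, range_id, inter_univ]
  exact this

/-- The domain of the `j`-th chart, an open subset biholomorphic to `ℂ²`. -/
def chartDomain (j : Fin 3) : Opens A2Resolution :=
  ⟨{q | q.line.rep j ≠ 0}, core.open_source' (mem_range_self j)⟩

/-- The exceptional locus `E`, the fibre of `σ` over the singular point. -/
def exceptional : Set A2Resolution := {q | (q.sigma : Fin 3 → ℂ) = 0}

lemma isOpen_compl_exceptional : IsOpen exceptionalᶜ := by
  have key : ∀ j, IsOpen {c | (param j c).pt ≠ 0} := fun j => by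
    have : Continuous fun c => (param j c).pt :=
      continuous_pi fun k => ((contDiff_scale j).mul (contDiff_vec j k)).continuous
    exact isOpen_ne_fun this continuous_const
  have : exceptionalᶜ = ⋃ j, chart j ⁻¹' {c | (param j c).pt ≠ 0} ∩ (chart j).source := by
    ext q
    simp only [mem_iUnion, mem_inter_iff, mem_preimage, mem_ofPred_eq]
    constructor
    · intro hq
      obtain ⟨j, hj⟩ := exists_rep_ne_zero q
      refine ⟨j, ?_, hj⟩
      change (param j (coord j q)).pt ≠ 0
      rw [param_coord j q hj]
      exact hq
    · rintro ⟨j, h, hj⟩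
      change (param j (coord j q)).pt ≠ 0 at h
      rw [param_coord j q hj] at h
      exact h
  rw [this]
  refine isOpen_iUnion fun j => ?_
  apply TopologicalSpace.GenerateOpen.basic
  simp only [mem_iUnion, mem_singleton_iff]
  exact ⟨chart j, mem_range_self j, _, key j, rfl⟩

/-- The complement of the exceptional locus, as an open set. -/
def regular : Opens A2Resolution := ⟨exceptionalᶜ, isOpen_compl_exceptional⟩

end A2Resolution

end

/-!
The group `(ℂˣ)²` acts on the resolution, so a symmetric differential on an invariant open set is
the sum of its weight components. In the logarithmic frame a component is a character times a
binary form of degree `m` with constant coefficients, and it extends holomorphically across the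
invariant curve with parameter `r` exactly when the form vanishes there to order at least `m - ⟨n,
r⟩`, where `⟨n, r⟩` is the pairing of the weight with the corresponding ray of the fan. Weight by
weight, both cohomology groups are thus cohomology groups of spaces of binary forms with
prescribed vanishing at the four points `-1, 0, 1, 2` of the projective line, whose dimensions are
elementary. Only weights of size `O(m)` contribute, so the sum over the weights divided by `m ^ 3`
is a Riemann sum, and the limits are integrals of piecewise linear functions.
-/

noncomputable section

/-! ### Laurent series in two complex variables -/

namespace Laurent

open MeasureTheory UnitAddTorus

attribute [local instance] instMeasureSpaceUnitAddCircle

local instance : IsProbabilityMeasure (volume : Measure UnitAddCircle) :=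
  inferInstanceAs (IsProbabilityMeasure AddCircle.haarAddCircle)

section Fourier

variable {d : Type*} [Fintype d]

lemma norm_mFourier_apply (n : d → ℤ) (z : UnitAddTorus d) : ‖mFourier n z‖ = 1 := by
  simp [mFourier, fourier_apply, norm_prod, Circle.norm_coe]

lemma integral_mFourier (n : d → ℤ) : ∫ z, mFourier n z = if n = 0 then 1 else 0 := by
  classical
  have := orthonormal_iff_ite.mp (orthonormal_mFourier (d := d)) 0 n
  simp only [ContinuousMap.inner_toLp, ← mFourier_neg, ← mFourier_add] at this
  simpa [eq_comm] using this

lemma norm_mFourierCoeff_le {g : UnitAddTorus d → ℂ} {M : ℝ} (h : ∀ z, ‖g z‖ ≤ M) (n : d → ℤ) :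
    ‖mFourierCoeff g n‖ ≤ M := by
  refine (norm_integral_le_of_norm_le_const (C := M) (ae_of_all _ fun z => ?_)).trans ?_
  · rw [norm_smul, norm_mFourier_apply, one_mul]
    exact h z
  · simp

lemma mFourierCoeff_of_hasSum {b : (d → ℤ) → ℂ} {g : UnitAddTorus d → ℂ}
    (h : ∀ z, HasSum (fun n => b n * mFourier n z) (g z)) (n : d → ℤ) :
    mFourierCoeff g n = b n := by
  classical
  have norm_term : ∀ (k l : d → ℤ) (z : UnitAddTorus d), ‖b k * mFourier l z‖ = ‖b k‖ :=
    fun k l z => by rw [norm_mul, norm_mFourier_apply, mul_one]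
  have hb : Summable fun k => ‖b k‖ := (h 0).summable.norm.congr fun k => norm_term k k 0
  have hshift : ∀ z, ∑' k, b k * mFourier (k - n) z = mFourier (-n) z • g z := fun z => by
    refine (((h z).mul_left (mFourier (-n) z)).congr_fun fun k => ?_).tsum_eq
    rw [sub_eq_add_neg, mFourier_add]
    ring
  have hint : ∀ k, Integrable fun z => b k * mFourier (k - n) z := fun k =>
    Continuous.integrable_of_hasCompactSupport (by fun_prop) (HasCompactSupport.of_compactSpace _)
  have hsum := hasSum_integral_of_summable_integral_norm hint (by
    simpa only [norm_term, integral_const, probReal_univ, one_smul] using hb)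
  simp only [hshift, integral_const_mul, integral_mFourier, sub_eq_zero, mul_ite, mul_one,
    mul_zero] at hsum
  exact hsum.unique (hasSum_single n fun k hk => if_neg hk) |>.trans (if_pos rfl)

end Fourier

/-- The Laurent monomial with exponents `n`. -/
def mon (n : ℤ × ℤ) (s : ℂ × ℂ) : ℂ := s.1 ^ n.1 * s.2 ^ n.2

lemma norm_mon (n : ℤ × ℤ) (s : ℂ × ℂ) : ‖mon n s‖ = ‖s.1‖ ^ n.1 * ‖s.2‖ ^ n.2 := by
  simp only [mon, norm_mul, norm_zpow]

lemma mon_ne_zero (n : ℤ × ℤ) {s : ℂ × ℂ} (h1 : s.1 ≠ 0) (h2 : s.2 ≠ 0) : mon n s ≠ 0 :=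
  mul_ne_zero (zpow_ne_zero _ h1) (zpow_ne_zero _ h2)

lemma mon_neg (n : ℤ × ℤ) (s : ℂ × ℂ) : mon (-n) s = (mon n s)⁻¹ := by
  simp only [mon, Prod.fst_neg, Prod.snd_neg, zpow_neg, mul_inv]

lemma mon_sub_mul_mon (n k : ℤ × ℤ) {s : ℂ × ℂ} (h1 : s.1 ≠ 0) (h2 : s.2 ≠ 0) :
    mon (n - k) s * mon k s = mon n s := by
  simp only [mon, Prod.fst_sub, Prod.snd_sub]
  rw [mul_mul_mul_comm, ← zpow_add₀ h1, ← zpow_add₀ h2, sub_add_cancel, sub_add_cancel]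

lemma hasFDerivAt_mon (n : ℤ × ℤ) {s : ℂ × ℂ} (h1 : s.1 ≠ 0) (h2 : s.2 ≠ 0) :
    HasFDerivAt (mon n) (mon n s • ((n.1 / s.1) • ContinuousLinearMap.fst ℂ ℂ ℂ +
      (n.2 / s.2) • ContinuousLinearMap.snd ℂ ℂ ℂ)) s := by
  have hfst := (hasDerivAt_zpow n.1 s.1 (.inl h1)).comp_hasFDerivAt s
    (hasFDerivAt_fst (𝕜 := ℂ) (E := ℂ) (F := ℂ))
  have hsnd := (hasDerivAt_zpow n.2 s.2 (.inl h2)).comp_hasFDerivAt s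
    (hasFDerivAt_snd (𝕜 := ℂ) (E := ℂ) (F := ℂ))
  refine (hfst.mul hsnd).congr_fderiv (ContinuousLinearMap.ext fun v => ?_)
  simp only [mon, Function.comp_apply, add_apply, smul_apply, ContinuousLinearMap.coe_fst',
    ContinuousLinearMap.coe_snd', smul_eq_mul, zpow_sub_one₀ h1, zpow_sub_one₀ h2]
  ring

/-- The action of the compact torus on `ℂ²` by rotation of the two coordinates, which turns a
Laurent series into a family of Fourier series. -/
def rotate (s : ℂ × ℂ) (z : UnitAddTorus (Fin 2)) : ℂ × ℂ :=
  (s.1 * fourier 1 (z 0), s.2 * fourier 1 (z 1))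

lemma norm_rotate_fst (s : ℂ × ℂ) (z : UnitAddTorus (Fin 2)) : ‖(rotate s z).1‖ = ‖s.1‖ := by
  simp [rotate, fourier_apply, Circle.norm_coe]

lemma norm_rotate_snd (s : ℂ × ℂ) (z : UnitAddTorus (Fin 2)) : ‖(rotate s z).2‖ = ‖s.2‖ := by
  simp [rotate, fourier_apply, Circle.norm_coe]

lemma rotate_fst_ne_zero {s : ℂ × ℂ} (h : s.1 ≠ 0) (z : UnitAddTorus (Fin 2)) :
    (rotate s z).1 ≠ 0 := by
  rwa [← norm_ne_zero_iff, norm_rotate_fst, norm_ne_zero_iff]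

lemma rotate_snd_ne_zero {s : ℂ × ℂ} (h : s.2 ≠ 0) (z : UnitAddTorus (Fin 2)) :
    (rotate s z).2 ≠ 0 := by
  rwa [← norm_ne_zero_iff, norm_rotate_snd, norm_ne_zero_iff]

lemma rotate_zero (s : ℂ × ℂ) : rotate s 0 = s := by
  simp [rotate]

lemma continuous_rotate : Continuous fun p : (ℂ × ℂ) × UnitAddTorus (Fin 2) =>
    rotate p.1 p.2 := by
  unfold rotate
  fun_prop

lemma mon_rotate (n : ℤ × ℤ) (s : ℂ × ℂ) (z : UnitAddTorus (Fin 2)) :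
    mon n (rotate s z) = mon n s * mFourier ![n.1, n.2] z := by
  have fourier_one_zpow : ∀ (k : ℤ) (x : UnitAddCircle), (fourier 1 x : ℂ) ^ k = fourier k x :=
    fun k x => by simp only [fourier_apply, one_smul, AddCircle.toCircle_zsmul, Circle.coe_zpow]
  simp only [mon, rotate, mul_zpow, fourier_one_zpow, mFourier, ContinuousMap.coe_mk,
    Fin.prod_univ_two, Matrix.cons_val_zero, Matrix.cons_val_one]
  ring

section Coefficients

variable {a b : ℤ × ℤ → ℂ} {g : ℂ × ℂ → ℂ} {s : ℂ × ℂ}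

lemma coeff_mul_mon_eq_mFourierCoeff
    (h : ∀ z, HasSum (fun n => a n * mon n (rotate s z)) (g (rotate s z))) (n : ℤ × ℤ) :
    a n * mon n s = mFourierCoeff (fun z => g (rotate s z)) ![n.1, n.2] := by
  set b : (Fin 2 → ℤ) → ℂ := fun k => a (k 0, k 1) * mon (k 0, k 1) s
  refine (mFourierCoeff_of_hasSum (b := b) (fun z => ?_) ![n.1, n.2]).symm
  rw [← (finTwoArrowEquiv ℤ).symm.hasSum_iff]
  refine (h z).congr_fun fun k => ?_
  simp only [b, Function.comp_apply, finTwoArrowEquiv_symm_apply, Matrix.cons_val_zero,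
    Matrix.cons_val_one, mon_rotate, mul_assoc]

lemma norm_coeff_mul_mon_le {M : ℝ}
    (h : ∀ z, HasSum (fun n => a n * mon n (rotate s z)) (g (rotate s z)))
    (hM : ∀ z, ‖g (rotate s z)‖ ≤ M) (n : ℤ × ℤ) : ‖a n * mon n s‖ ≤ M := by
  rw [coeff_mul_mon_eq_mFourierCoeff h]
  exact norm_mFourierCoeff_le hM _

lemma coeff_unique (h1 : s.1 ≠ 0) (h2 : s.2 ≠ 0)
    (ha : ∀ z, HasSum (fun n => a n * mon n (rotate s z)) (g (rotate s z)))
    (hb : ∀ z, HasSum (fun n => b n * mon n (rotate s z)) (g (rotate s z))) : a = b :=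
  funext fun n => mul_right_cancel₀ (mon_ne_zero n h1 h2) <|
    (coeff_mul_mon_eq_mFourierCoeff ha n).trans (coeff_mul_mon_eq_mFourierCoeff hb n).symm

end Coefficients

lemma integral_mul_fourier_eq_circleAverage (h : ℂ → ℂ) (s : ℂ) :
    ∫ x : UnitAddCircle, h (s * fourier 1 x) = Real.circleAverage h 0 ‖s‖ := by
  have htwo_pi : (2 * Real.pi) ≠ 0 := by positivity
  have hperiod := AddCircle.intervalIntegral_preimage (1 : ℝ) 0 fun x => h (s * fourier 1 x)
  rw [AddCircle.volume_eq_smul_haarAddCircle, zero_add, ENNReal.ofReal_one, one_smul] at hperiod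
  have hpolar : ∀ x : ℝ, s * fourier 1 (x : UnitAddCircle) =
      circleMap 0 ‖s‖ (2 * Real.pi * x + s.arg) := fun x => by
    conv_lhs => rw [← Complex.norm_mul_exp_arg_mul_I s]
    rw [fourier_coe_apply, circleMap, mul_assoc, ← Complex.exp_add]
    push_cast
    ring_nf
  have hangle := intervalIntegral.integral_comp_mul_left (a := 0) (b := 1)
    (fun θ => h (circleMap 0 ‖s‖ (θ + s.arg))) htwo_pi
  rw [mul_zero, mul_one] at hangle
  rw [Real.circleAverage_eq_integral_add s.arg, ← hangle]
  simp only [hpolar] at hperiod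
  exact hperiod.symm

lemma integral_mul_fourier_eq_of_differentiableOn {h : ℂ → ℂ} {s t : ℂ} (hs : s ≠ 0)
    (hst : ‖s‖ ≤ ‖t‖) (hh : DifferentiableOn ℂ h (Metric.closedBall 0 ‖t‖ \ Metric.ball 0 ‖s‖)) :
    ∫ x : UnitAddCircle, h (t * fourier 1 x) = ∫ x : UnitAddCircle, h (s * fourier 1 x) := by
  have hs' : 0 < ‖s‖ := norm_pos_iff.mpr hs
  rw [integral_mul_fourier_eq_circleAverage, integral_mul_fourier_eq_circleAverage,
    Real.circleAverage_eq_circleIntegral hs'.ne',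
    Real.circleAverage_eq_circleIntegral (hs'.trans_le hst).ne']
  congr 1
  refine Complex.circleIntegral_sub_center_inv_smul_eq_of_differentiable_on_annulus_off_countable
    hs' hst countable_empty hh.continuousOn fun z hz => hh.differentiableAt ?_
  filter_upwards [(Metric.isOpen_ball.sdiff Metric.isClosed_closedBall).mem_nhds hz.1] with w hw
  exact ⟨Metric.ball_subset_closedBall hw.1, fun h => hw.2 (Metric.ball_subset_closedBall h)⟩

lemma integral_rotate_eq_prod (g : ℂ × ℂ → ℂ) (s : ℂ × ℂ) : ∫ z, g (rotate s z) =
    ∫ p : UnitAddCircle × UnitAddCircle, g (s.1 * fourier 1 p.1, s.2 * fourier 1 p.2) := by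
  rw [← (volume_preserving_finTwoArrow UnitAddCircle).integral_comp
    (MeasurableEquiv.measurableEmbedding _)]
  rfl

/-- The part off the coordinate axes of a complete Reinhardt domain: an open subset of `(ℂˣ)²`
that contains with each point all points with smaller coordinates. -/
structure IsCompleteReinhardt (D : Set (ℂ × ℂ)) : Prop where
  isOpen : IsOpen D
  ne_zero : ∀ s ∈ D, s.1 ≠ 0 ∧ s.2 ≠ 0
  mem : ∀ s ∈ D, ∀ t : ℂ × ℂ, t.1 ≠ 0 → t.2 ≠ 0 → ‖t.1‖ ≤ ‖s.1‖ → ‖t.2‖ ≤ ‖s.2‖ → t ∈ D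

namespace IsCompleteReinhardt

variable {D : Set (ℂ × ℂ)} {g : ℂ × ℂ → ℂ} {s t : ℂ × ℂ}

lemma rotate_mem (hD : IsCompleteReinhardt D) (hs : s ∈ D) (z : UnitAddTorus (Fin 2)) :
    rotate s z ∈ D :=
  hD.mem s hs _ (rotate_fst_ne_zero (hD.ne_zero s hs).1 z)
    (rotate_snd_ne_zero (hD.ne_zero s hs).2 z) (norm_rotate_fst s z).le (norm_rotate_snd s z).le

lemma continuous_comp_rotate (hD : IsCompleteReinhardt D) (hg : ContinuousOn g D) (hs : s ∈ D) :
    Continuous fun z => g (rotate s z) :=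
  hg.comp_continuous (continuous_rotate.comp (Continuous.prodMk_right s)) (hD.rotate_mem hs)

/-- Cauchy's theorem, applied to one coordinate after the other. -/
lemma integral_rotate_eq_of_norm_le (hD : IsCompleteReinhardt D) (hg : DifferentiableOn ℂ g D)
    (hs : s ∈ D) (ht : t ∈ D) (h1 : ‖s.1‖ ≤ ‖t.1‖) (h2 : ‖s.2‖ ≤ ‖t.2‖) :
    ∫ z, g (rotate t z) = ∫ z, g (rotate s z) := by
  obtain ⟨hs1, hs2⟩ := hD.ne_zero s hs
  have hst : (s.1, t.2) ∈ D := hD.mem t ht _ hs1 (hD.ne_zero t ht).2 h1 le_rfl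
  have ne_zero_of_le : ∀ {v w : ℂ}, v ≠ 0 → ‖v‖ ≤ ‖w‖ → w ≠ 0 := fun hv hvw =>
    norm_pos_iff.mp ((norm_pos_iff.mpr hv).trans_le hvw)
  have hint : ∀ w ∈ D, Integrable fun p : UnitAddCircle × UnitAddCircle =>
      g (w.1 * fourier 1 p.1, w.2 * fourier 1 p.2) := fun w hw =>
    Continuous.integrable_of_hasCompactSupport
      (hg.continuousOn.comp_continuous (by fun_prop) fun p => hD.rotate_mem hw ![p.1, p.2])
      (HasCompactSupport.of_compactSpace _)
  trans ∫ z, g (rotate (s.1, t.2) z)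
  · rw [integral_rotate_eq_prod, integral_rotate_eq_prod, Measure.volume_eq_prod,
      integral_prod_symm _ (hint t ht), integral_prod_symm _ (hint _ hst)]
    congr 1 with y
    refine integral_mul_fourier_eq_of_differentiableOn (h := fun w => g (w, t.2 * fourier 1 y))
      hs1 h1 (hg.comp (by fun_prop) fun w hw => ?_)
    simp only [Set.mem_sdiff, mem_closedBall_zero_iff, mem_ball_zero_iff, not_lt] at hw
    exact hD.mem _ (hD.rotate_mem ht ![0, y]) _ (ne_zero_of_le hs1 hw.2)
      (hD.ne_zero _ (hD.rotate_mem ht ![0, y])).2 (by rw [norm_rotate_fst]; exact hw.1) le_rfl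
  · rw [integral_rotate_eq_prod, integral_rotate_eq_prod, Measure.volume_eq_prod,
      integral_prod _ (hint _ hst), integral_prod _ (hint s hs)]
    congr 1 with x
    refine integral_mul_fourier_eq_of_differentiableOn (h := fun w => g (s.1 * fourier 1 x, w))
      hs2 h2 (hg.comp (by fun_prop) fun w hw => ?_)
    simp only [Set.mem_sdiff, mem_closedBall_zero_iff, mem_ball_zero_iff, not_lt] at hw
    exact hD.mem _ (hD.rotate_mem hst ![x, 0]) _ (hD.ne_zero _ (hD.rotate_mem hst ![x, 0])).1
      (ne_zero_of_le hs2 hw.2) le_rfl (by rw [norm_rotate_snd]; exact hw.1)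

lemma integral_rotate_eq (hD : IsCompleteReinhardt D) (hg : DifferentiableOn ℂ g D)
    (hs : s ∈ D) (ht : t ∈ D) : ∫ z, g (rotate s z) = ∫ z, g (rotate t z) := by
  have smaller : ∀ x y : ℂ, x ≠ 0 → y ≠ 0 → ∃ u : ℂ, u ≠ 0 ∧ ‖u‖ ≤ ‖x‖ ∧ ‖u‖ ≤ ‖y‖ :=
    fun x y hx hy => (le_total ‖x‖ ‖y‖).elim (fun h => ⟨x, hx, le_rfl, h⟩)
      fun h => ⟨y, hy, h, le_rfl⟩
  obtain ⟨u₁, hu₁, hus₁, hut₁⟩ := smaller s.1 t.1 (hD.ne_zero s hs).1 (hD.ne_zero t ht).1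
  obtain ⟨u₂, hu₂, hus₂, hut₂⟩ := smaller s.2 t.2 (hD.ne_zero s hs).2 (hD.ne_zero t ht).2
  have hu : (u₁, u₂) ∈ D := hD.mem s hs _ hu₁ hu₂ hus₁ hus₂
  rw [hD.integral_rotate_eq_of_norm_le hg hu hs hus₁ hus₂,
    hD.integral_rotate_eq_of_norm_le hg hu ht hut₁ hut₂]

end IsCompleteReinhardt

/-- The Laurent coefficients of `g`, computed on the torus through `s`. -/
def laurentCoeff (g : ℂ × ℂ → ℂ) (s : ℂ × ℂ) (n : ℤ × ℤ) : ℂ :=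
  ∫ z, g (rotate s z) * mon (-n) (rotate s z)

lemma laurentCoeff_mul_mon (g : ℂ × ℂ → ℂ) {s : ℂ × ℂ} (h1 : s.1 ≠ 0) (h2 : s.2 ≠ 0)
    (n : ℤ × ℤ) :
    laurentCoeff g s n * mon n s = mFourierCoeff (fun z => g (rotate s z)) ![n.1, n.2] := by
  have hneg : -![n.1, n.2] = ![(-n).1, (-n).2] := by
    simp only [Matrix.neg_cons, Matrix.neg_empty, Prod.fst_neg, Prod.snd_neg]
  rw [laurentCoeff, mFourierCoeff, ← integral_mul_const]
  congr 1 with z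
  rw [mon_rotate, mon_neg, hneg, smul_eq_mul]
  field_simp [mon_ne_zero n h1 h2]

lemma exists_zpow_eq_pow_natAbs {l : ℝ} (hl : 1 ≤ l) (k : ℤ) :
    ∃ e ∈ Icc l⁻¹ l, e ^ k = l ^ k.natAbs := by
  have hinv : l⁻¹ ≤ l := (inv_le_one_of_one_le₀ hl).trans hl
  obtain ⟨j, rfl | rfl⟩ := k.eq_nat_or_neg
  · exact ⟨l, right_mem_Icc.mpr hinv, by simp⟩
  · exact ⟨l⁻¹, left_mem_Icc.mpr hinv, by simp⟩

lemma summable_pow_natAbs_mul_pow_natAbs {r : ℝ} (h0 : 0 ≤ r) (h1 : r < 1) :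
    Summable fun n : ℤ × ℤ => r ^ n.1.natAbs * r ^ n.2.natAbs := by
  have h : Summable fun n : ℤ => r ^ n.natAbs := by
    rw [summable_int_iff_summable_nat_and_neg]
    simpa using summable_geometric_of_lt_one h0 h1
  exact h.mul_of_nonneg h (fun n => by positivity) fun n => by positivity

namespace IsCompleteReinhardt

variable {D : Set (ℂ × ℂ)} {g : ℂ × ℂ → ℂ} {s t : ℂ × ℂ}

lemma laurentCoeff_eq (hD : IsCompleteReinhardt D) (hg : DifferentiableOn ℂ g D) (hs : s ∈ D)
    (ht : t ∈ D) : laurentCoeff g s = laurentCoeff g t :=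
  funext fun n => hD.integral_rotate_eq (hg.mul fun u hu => (hasFDerivAt_mon (-n)
    (hD.ne_zero u hu).1 (hD.ne_zero u hu).2).differentiableAt.differentiableWithinAt) hs ht

lemma exists_one_lt_mul_mem (hD : IsCompleteReinhardt D) (hs : s ∈ D) :
    ∃ l : ℝ, 1 < l ∧ ((l : ℂ) * s.1, (l : ℂ) * s.2) ∈ D := by
  have hlim : Tendsto (fun l : ℝ => ((l : ℂ) * s.1, (l : ℂ) * s.2)) (𝓝[>] 1) (𝓝 s) := by
    have : Continuous fun l : ℝ => ((l : ℂ) * s.1, (l : ℂ) * s.2) := by fun_prop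
    simpa using (this.tendsto 1).mono_left nhdsWithin_le_nhds
  obtain ⟨l, hl, hl1⟩ := ((hlim.eventually (hD.isOpen.mem_nhds hs)).and self_mem_nhdsWithin).exists
  exact ⟨l, hl1, hl⟩

/-- Cauchy's estimates on the tori through the points `(e₁ s₁, e₂ s₂)` with `l⁻¹ ≤ eᵢ ≤ l`. -/
lemma exists_norm_laurentCoeff_mul_mon_le (hD : IsCompleteReinhardt D)
    (hg : DifferentiableOn ℂ g D) (hs : s ∈ D) :
    ∃ l > 1, ∃ M : ℝ, ∀ n : ℤ × ℤ,
      ‖laurentCoeff g s n * mon n s‖ * (l ^ n.1.natAbs * l ^ n.2.natAbs) ≤ M := by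
  obtain ⟨l, hl, hls⟩ := hD.exists_one_lt_mul_mem hs
  set scale : ℝ × ℝ → ℂ × ℂ := fun e => (e.1 * s.1, e.2 * s.2)
  have hpos : ∀ e ∈ Icc l⁻¹ l, 0 < e := fun e he => (by positivity : 0 < l⁻¹).trans_le he.1
  have hle : ∀ e ∈ Icc l⁻¹ l, ∀ w : ℂ, ‖(e : ℂ) * w‖ ≤ ‖(l : ℂ) * w‖ := fun e he w => by
    simp only [norm_mul, Complex.norm_real, Real.norm_of_nonneg (hpos e he).le,
      Real.norm_of_nonneg (zero_le_one.trans hl.le)]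
    exact mul_le_mul_of_nonneg_right he.2 (norm_nonneg w)
  have hmem : ∀ e ∈ Icc l⁻¹ l ×ˢ Icc l⁻¹ l, scale e ∈ D := fun e he => hD.mem _ hls _
    (mul_ne_zero (Complex.ofReal_ne_zero.mpr (hpos _ he.1).ne') (hD.ne_zero s hs).1)
    (mul_ne_zero (Complex.ofReal_ne_zero.mpr (hpos _ he.2).ne') (hD.ne_zero s hs).2)
    (hle _ he.1 _) (hle _ he.2 _)
  obtain ⟨M, hM⟩ : ∃ M, ∀ p ∈ (Icc l⁻¹ l ×ˢ Icc l⁻¹ l) ×ˢ (univ : Set (UnitAddTorus (Fin 2))),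
      ‖g (rotate (scale p.1) p.2)‖ ≤ M := by
    refine ((isCompact_Icc.prod isCompact_Icc).prod isCompact_univ).exists_bound_of_continuousOn
      (hg.continuousOn.comp (Continuous.continuousOn ?_)
        fun p hp => hD.rotate_mem (hmem p.1 hp.1) p.2)
    exact continuous_rotate.comp (f := fun p : (ℝ × ℝ) × UnitAddTorus (Fin 2) =>
      (scale p.1, p.2)) (by fun_prop)
  refine ⟨l, hl, M, fun n => ?_⟩
  obtain ⟨e₁, he₁, hpow₁⟩ := exists_zpow_eq_pow_natAbs hl.le n.1
  obtain ⟨e₂, he₂, hpow₂⟩ := exists_zpow_eq_pow_natAbs hl.le n.2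
  have he : scale (e₁, e₂) ∈ D := hmem _ ⟨he₁, he₂⟩
  calc ‖laurentCoeff g s n * mon n s‖ * (l ^ n.1.natAbs * l ^ n.2.natAbs)
      = ‖laurentCoeff g (scale (e₁, e₂)) n * mon n (scale (e₁, e₂))‖ := by
        rw [hD.laurentCoeff_eq hg hs he, norm_mul, norm_mul, norm_mon, norm_mon, ← hpow₁, ← hpow₂]
        simp only [scale, norm_mul, mul_zpow, Complex.norm_real,
          Real.norm_of_nonneg (hpos _ he₁).le, Real.norm_of_nonneg (hpos _ he₂).le]
        ring
    _ ≤ M := by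
        rw [laurentCoeff_mul_mon g (hD.ne_zero _ he).1 (hD.ne_zero _ he).2]
        exact norm_mFourierCoeff_le (fun z => hM ((e₁, e₂), z) ⟨⟨he₁, he₂⟩, mem_univ z⟩) _

lemma summable_laurentCoeff_mul_mon (hD : IsCompleteReinhardt D) (hg : DifferentiableOn ℂ g D)
    (hs : s ∈ D) : Summable fun n => laurentCoeff g s n * mon n s := by
  obtain ⟨l, hl, M, hM⟩ := hD.exists_norm_laurentCoeff_mul_mon_le hg hs
  refine Summable.of_norm_bounded ((summable_pow_natAbs_mul_pow_natAbs (r := l⁻¹) (by positivity)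
    (inv_lt_one_of_one_lt₀ hl)).mul_left M) fun n => ?_
  rw [inv_pow, inv_pow, ← mul_inv, ← div_eq_mul_inv, le_div_iff₀ (by positivity)]
  exact hM n

lemma hasSum_laurentCoeff_mul_mon (hD : IsCompleteReinhardt D) (hg : DifferentiableOn ℂ g D)
    (hs : s ∈ D) : HasSum (fun n => laurentCoeff g s n * mon n s) (g s) := by
  set F : C(UnitAddTorus (Fin 2), ℂ) :=
    ⟨fun z => g (rotate s z), hD.continuous_comp_rotate hg.continuousOn hs⟩
  have hcoeff : ∀ n : ℤ × ℤ, laurentCoeff g s n * mon n s =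
      mFourierCoeff F ((finTwoArrowEquiv ℤ).symm n) :=
    laurentCoeff_mul_mon g (hD.ne_zero s hs).1 (hD.ne_zero s hs).2
  have hsummable : Summable (mFourierCoeff F) := by
    rw [← (finTwoArrowEquiv ℤ).symm.summable_iff]
    exact (hD.summable_laurentCoeff_mul_mon hg hs).congr hcoeff
  have hfourier := hasSum_mFourier_series_apply_of_summable hsummable 0
  rw [← (finTwoArrowEquiv ℤ).symm.hasSum_iff, ContinuousMap.coe_mk, rotate_zero] at hfourier
  refine hfourier.congr_fun fun n => ?_
  have hone : mFourier ((finTwoArrowEquiv ℤ).symm n) 0 = 1 := by simp [mFourier]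
  rw [hcoeff, Function.comp_apply, hone, smul_eq_mul, mul_one]
  rfl

theorem exists_hasSum_laurent (hD : IsCompleteReinhardt D) (hg : DifferentiableOn ℂ g D) :
    ∃ a : ℤ × ℤ → ℂ, ∀ s ∈ D, HasSum (fun n => a n * mon n s) (g s) := by
  rcases D.eq_empty_or_nonempty with rfl | ⟨s₀, hs₀⟩
  · exact ⟨0, fun s hs => absurd hs (notMem_empty s)⟩
  · refine ⟨laurentCoeff g s₀, fun s hs => ?_⟩
    rw [hD.laurentCoeff_eq hg hs₀ hs]
    exact hD.hasSum_laurentCoeff_mul_mon hg hs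

end IsCompleteReinhardt

theorem differentiableOn_tsum {ι E F : Type*} [NormedAddCommGroup E] [NormedSpace ℂ E]
    [NormedAddCommGroup F] [NormedSpace ℂ F] [CompleteSpace F]
    {f : ι → E → F} {u : ι → ℝ} {V : Set E} (hV : IsOpen V) (hu : Summable u)
    (hf : ∀ i, DifferentiableOn ℂ (f i) V) (hfu : ∀ i, ∀ x ∈ V, ‖f i x‖ ≤ u i) :
    DifferentiableOn ℂ (fun x => ∑' i, f i x) V := by
  intro x hx
  obtain ⟨r, hr, hrV⟩ := Metric.isOpen_iff.mp hV x hx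
  have hball : ∀ y ∈ Metric.ball x (r / 2), Metric.ball y (r / 2) ⊆ V := fun y hy =>
    (Metric.ball_subset_ball' (by rw [Metric.mem_ball] at hy; linarith)).trans hrV
  have hmem : ∀ y ∈ Metric.ball x (r / 2), y ∈ V := fun y hy =>
    hball y hy (Metric.mem_ball_self (by linarith))
  have hxball : x ∈ Metric.ball x (r / 2) := Metric.mem_ball_self (by linarith)
  have hderiv : ∀ i, ∀ y ∈ Metric.ball x (r / 2), ‖fderiv ℂ (f i) y‖ ≤ 2 * u i / (r / 2) := by
    intro i y hy
    refine Complex.norm_fderiv_le_div_of_mapsTo_ball ((hf i).mono (hball y hy)) (fun w hw => ?_)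
      (by linarith)
    rw [mem_closedBall_iff_norm]
    refine (norm_sub_le _ _).trans ?_
    linarith [hfu i w (hball y hy hw), hfu i y (hmem y hy)]
  exact (hasFDerivAt_tsum_of_isPreconnected
    ((hu.mul_left 2).div_const (r / 2))
    Metric.isOpen_ball (convex_ball x (r / 2)).isPreconnected
    (fun i y hy => ((hf i).differentiableAt (hV.mem_nhds (hmem y hy))).hasFDerivAt) hderiv hxball
    (Summable.of_norm_bounded hu fun i => hfu i x hx)
    hxball).differentiableAt.differentiableWithinAt

end Laurent

/-! ### Binary forms as polynomials -/

namespace BinaryForm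

open Polynomial

section Multiples

variable {K : Type*} [Field K]

/-- The polynomials of degree at most `m` divisible by `h`: the dehomogenizations of the binary
forms of degree `m` divisible by a given one. -/
def multiples (m : ℕ) (h : K[X]) : Submodule K K[X] where
  carrier := {p | p.natDegree ≤ m ∧ h ∣ p}
  add_mem' hp hq := ⟨(natDegree_add_le _ _).trans (max_le hp.1 hq.1), dvd_add hp.2 hq.2⟩
  zero_mem' := ⟨by simp, dvd_zero _⟩
  smul_mem' c p hp := ⟨(natDegree_smul_le c p).trans hp.1, dvd_smul_of_dvd c hp.2⟩

lemma mem_multiples {m : ℕ} {h p : K[X]} : p ∈ multiples m h ↔ p.natDegree ≤ m ∧ h ∣ p := Iff.rfl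

lemma multiples_eq_map_degreeLT (m : ℕ) {h : K[X]} (hh : h ≠ 0) :
    multiples m h = (degreeLT K (m + 1 - h.natDegree)).map (LinearMap.mulLeft K h) := by
  have degree_iff : ∀ q : K[X],
      (h * q).natDegree ≤ m ↔ q ∈ degreeLT K (m + 1 - h.natDegree) := fun q => by
    rcases eq_or_ne q 0 with rfl | hq
    · simp
    · rw [natDegree_mul hh hq, mem_degreeLT, ← natDegree_lt_iff_degree_lt hq]
      omega
  ext p
  simp only [mem_multiples, Submodule.mem_map, LinearMap.mulLeft_apply, ← degree_iff]
  constructor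
  · rintro ⟨hp, q, rfl⟩
    exact ⟨q, hp, rfl⟩
  · rintro ⟨q, hq, rfl⟩
    exact ⟨hq, dvd_mul_right _ _⟩

lemma finrank_multiples (m : ℕ) {h : K[X]} (hh : h ≠ 0) :
    Module.finrank K (multiples m h) = m + 1 - h.natDegree := by
  rw [multiples_eq_map_degreeLT m hh, ← (Submodule.equivMapOfInjective (LinearMap.mulLeft K h)
    (mul_right_injective₀ hh) _).finrank_eq, (degreeLTEquiv K _).finrank_eq, Module.finrank_fin_fun]

instance (m : ℕ) (h : K[X]) : FiniteDimensional K (multiples m h) := by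
  have hle : multiples m h ≤ degreeLT K (m + 1) := fun p hp => by
    rw [mem_degreeLT]
    exact (natDegree_le_iff_degree_le.mp hp.1).trans_lt (by exact_mod_cast m.lt_succ_self)
  have := (degreeLTEquiv K (m + 1)).symm.finiteDimensional
  exact Submodule.finiteDimensional_of_le hle

lemma multiples_inf (m : ℕ) {h k : K[X]} (hk : IsCoprime h k) :
    multiples m h ⊓ multiples m k = multiples m (h * k) := by
  ext p
  simp only [Submodule.mem_inf, mem_multiples]
  exact ⟨fun ⟨⟨hp, hh⟩, _, hk'⟩ => ⟨hp, hk.mul_dvd hh hk'⟩, fun ⟨hp, hhk⟩ =>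
    ⟨⟨hp, (dvd_mul_right _ _).trans hhk⟩, hp, (dvd_mul_left _ _).trans hhk⟩⟩

end Multiples

/-- The polynomials of degree at most `m` vanishing to order `e` at `r`. -/
def vanishing (m : ℕ) (r : ℤ) (e : ℕ) : Submodule ℂ ℂ[X] := multiples m ((X - C (r : ℂ)) ^ e)

instance (m : ℕ) (r : ℤ) (e : ℕ) : FiniteDimensional ℂ (vanishing m r e) :=
  inferInstanceAs (FiniteDimensional ℂ (multiples m _))

lemma isCoprime_X_sub_C_pow {r s : ℤ} (h : r ≠ s) (e f : ℕ) :
    IsCoprime ((X - C (r : ℂ)) ^ e) ((X - C (s : ℂ)) ^ f) :=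
  (isCoprime_X_sub_C_of_isUnit_sub
    (isUnit_iff_ne_zero.mpr (sub_ne_zero.mpr (by exact_mod_cast h)))).pow

lemma X_sub_C_pow_ne_zero (r : ℤ) (e : ℕ) : (X - C (r : ℂ)) ^ e ≠ 0 :=
  pow_ne_zero _ (X_sub_C_ne_zero _)

lemma natDegree_X_sub_C_pow (r : ℤ) (e : ℕ) : ((X - C (r : ℂ)) ^ e).natDegree = e := by
  rw [natDegree_pow, natDegree_X_sub_C, mul_one]

lemma finrank_vanishing (m : ℕ) (r : ℤ) (e : ℕ) :
    Module.finrank ℂ (vanishing m r e) = m + 1 - e := by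
  rw [vanishing, finrank_multiples m (X_sub_C_pow_ne_zero r e), natDegree_X_sub_C_pow]

lemma finrank_vanishing_inf (m : ℕ) {r s : ℤ} (h : r ≠ s) (e f : ℕ) :
    Module.finrank ℂ ↥(vanishing m r e ⊓ vanishing m s f) = m + 1 - (e + f) := by
  have hr := X_sub_C_pow_ne_zero r e
  have hs := X_sub_C_pow_ne_zero s f
  rw [vanishing, vanishing, multiples_inf m (isCoprime_X_sub_C_pow h e f),
    finrank_multiples m (mul_ne_zero hr hs), natDegree_mul hr hs, natDegree_X_sub_C_pow,
    natDegree_X_sub_C_pow]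

lemma finrank_vanishing_inf₄ (m : ℕ) {r s t u : ℤ} (hrs : r ≠ s) (hrt : r ≠ t) (hru : r ≠ u)
    (hst : s ≠ t) (hsu : s ≠ u) (htu : t ≠ u) (e f g h : ℕ) :
    Module.finrank ℂ ↥(vanishing m r e ⊓ vanishing m s f ⊓ (vanishing m t g ⊓ vanishing m u h)) =
      m + 1 - (e + f + g + h) := by
  have hr := X_sub_C_pow_ne_zero r e
  have hs := X_sub_C_pow_ne_zero s f
  have ht := X_sub_C_pow_ne_zero t g
  have hu := X_sub_C_pow_ne_zero u h
  have hcoprime := ((isCoprime_X_sub_C_pow hrt e g).mul_right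
    (isCoprime_X_sub_C_pow hru e h)).mul_left
      ((isCoprime_X_sub_C_pow hst f g).mul_right (isCoprime_X_sub_C_pow hsu f h))
  rw [vanishing, vanishing, vanishing, vanishing,
    multiples_inf m (isCoprime_X_sub_C_pow hrs e f),
    multiples_inf m (isCoprime_X_sub_C_pow htu g h), multiples_inf m hcoprime,
    finrank_multiples m (mul_ne_zero (mul_ne_zero hr hs) (mul_ne_zero ht hu)),
    natDegree_mul (mul_ne_zero hr hs) (mul_ne_zero ht hu), natDegree_mul hr hs,
    natDegree_mul ht hu]
  simp only [natDegree_X_sub_C_pow, add_assoc]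

lemma vanishing_eq_bot {m : ℕ} (r : ℤ) {e : ℕ} (h : m < e) : vanishing m r e = ⊥ := by
  rw [← Submodule.finrank_eq_zero (R := ℂ), finrank_vanishing]
  omega

lemma vanishing_min (m : ℕ) (r : ℤ) (e : ℕ) : vanishing m r (min e (m + 1)) = vanishing m r e := by
  rcases le_total e (m + 1) with h | h
  · rw [min_eq_left h]
  · rw [min_eq_right h, vanishing_eq_bot r (Nat.lt_succ_self m), vanishing_eq_bot r (by omega)]

/-- The value at `(u, v)` of the binary form of degree `m` whose dehomogenization at `u = 1` is
`p`. -/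
def homEval (m : ℕ) (p : ℂ[X]) (u v : ℂ) : ℂ := MvPolynomial.eval ![v, u] (p.homogenize m)

lemma homEval_add (m : ℕ) (p q : ℂ[X]) (u v : ℂ) :
    homEval m (p + q) u v = homEval m p u v + homEval m q u v := by
  simp only [homEval, homogenize_add, map_add]

lemma homEval_smul (m : ℕ) (c : ℂ) (p : ℂ[X]) (u v : ℂ) :
    homEval m (c • p) u v = c * homEval m p u v := by
  simp only [homEval, homogenize_smul, MvPolynomial.smul_eval]

lemma homEval_eq_sum (m : ℕ) (p : ℂ[X]) (u v : ℂ) :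
    homEval m p u v = ∑ k ∈ Finset.range (m + 1), p.coeff k * (v ^ k * u ^ (m - k)) := by
  simp [homEval, homogenize, Finset.Nat.sum_antidiagonal_eq_sum_range_succ_mk,
    MvPolynomial.eval_monomial, Finsupp.prod_fintype]

lemma homEval_one {m : ℕ} {p : ℂ[X]} (hp : p.natDegree ≤ m) (v : ℂ) :
    homEval m p 1 v = p.eval v := by
  rw [homEval, eval_homogenize hp _ one_ne_zero]
  simp

lemma homEval_monomial {m k : ℕ} (hk : k ≤ m) (a u v : ℂ) :
    homEval m (monomial k a) u v = a * (v ^ k * u ^ (m - k)) := by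
  rw [homEval_eq_sum, Finset.sum_eq_single_of_mem k (Finset.mem_range_succ_iff.mpr hk)
    fun l _ hl => by rw [coeff_monomial_of_ne _ hl, zero_mul], coeff_monomial_same]

lemma homEval_sum {ι : Type*} (s : Finset ι) (m : ℕ) (p : ι → ℂ[X]) (u v : ℂ) :
    homEval m (∑ i ∈ s, p i) u v = ∑ i ∈ s, homEval m (p i) u v := by
  simp only [homEval, homogenize_finsetSum, map_sum]

section Multilinear

variable {m : ℕ}

lemma exists_homEval_eq_multilinearMap (A : MultilinearMap ℂ (fun _ : Fin m => ℂ × ℂ) ℂ) :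
    ∃ p : ℂ[X], p.natDegree ≤ m ∧ ∀ w : ℂ × ℂ, A (fun _ => w) = homEval m p w.2 w.1 := by
  classical
  let B (s : Finset (Fin m)) : ℂ := A (s.piecewise (fun _ => (1, 0)) fun _ => (0, 1))
  have apply_piecewise (w : ℂ × ℂ) (s : Finset (Fin m)) :
      A (s.piecewise (fun _ => w.1 • (1, 0)) fun _ => w.2 • (0, 1)) =
        B s * (w.1 ^ s.card * w.2 ^ (m - s.card)) := by
    have hsmul : (s.piecewise (fun _ => w.1 • (1, 0)) fun _ => w.2 • (0, 1) : Fin m → ℂ × ℂ) =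
        fun i => (if i ∈ s then w.1 else w.2) •
          s.piecewise (fun _ => ((1 : ℂ), (0 : ℂ))) (fun _ => (0, 1)) i := by
      funext i
      by_cases hi : i ∈ s <;> simp [Finset.piecewise, hi]
    rw [hsmul, A.map_smul_univ, Finset.prod_ite, Finset.prod_const, Finset.prod_const,
      Finset.filter_univ_mem, Finset.filter_not, Finset.filter_univ_mem,
      ← Finset.compl_eq_univ_sdiff, Finset.card_compl, Fintype.card_fin, smul_eq_mul, mul_comm]
  refine ⟨∑ s : Finset (Fin m), monomial s.card (B s),
    natDegree_sum_le_of_forall_le _ _ fun s _ =>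
      (natDegree_monomial_le _).trans (card_finset_fin_le s), fun w => ?_⟩
  have hw : (fun _ : Fin m => w) = (fun _ => w.1 • (1, 0)) + fun _ => w.2 • (0, 1) := by
    ext <;> simp
  rw [hw, A.map_add_univ, homEval_sum]
  exact Finset.sum_congr rfl fun s _ => by
    rw [apply_piecewise, homEval_monomial (card_finset_fin_le s)]

lemma exists_multilinearMap_eq_sum (P : ℕ → ℂ) :
    ∃ A : MultilinearMap ℂ (fun _ : Fin m => ℂ × ℂ) ℂ, ∀ w : ℂ × ℂ, A (fun _ => w) =
      ∑ i ∈ Finset.range (m + 1), P i * (w.1 ^ i * w.2 ^ (m - i)) := by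
  classical
  refine ⟨∑ i ∈ Finset.range (m + 1), P i • (MultilinearMap.mkPiAlgebra ℂ (Fin m) ℂ).compLinearMap
    (fun k : Fin m => if (k : ℕ) < i then LinearMap.fst ℂ ℂ ℂ else LinearMap.snd ℂ ℂ ℂ),
    fun w => ?_⟩
  simp only [sum_apply, smul_apply, smul_eq_mul,
    MultilinearMap.compLinearMap_apply, MultilinearMap.mkPiAlgebra_apply]
  refine Finset.sum_congr rfl fun i hi => ?_
  have apply_ite (k : Fin m) : (if (k : ℕ) < i then LinearMap.fst ℂ ℂ ℂ else
      LinearMap.snd ℂ ℂ ℂ) w = if (k : ℕ) < i then w.1 else w.2 := by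
    split_ifs <;> rfl
  simp only [apply_ite]
  rw [Fin.prod_univ_eq_prod_range (fun k => if k < i then w.1 else w.2) m,
    ← Finset.prod_range_mul_prod_Ico _ (Finset.mem_range_succ_iff.mp hi),
    Finset.prod_congr rfl fun k hk => if_pos (Finset.mem_range.mp hk),
    Finset.prod_congr rfl fun k hk => if_neg (not_lt.mpr (Finset.mem_Ico.mp hk).1)]
  simp

end Multilinear

/-- The linear substitution of `(a x + b y, c x + d y)` for the variables of a binary form of
degree `m`, with the result dehomogenized at `y = 1`. -/
def substitute (m : ℕ) (a b c d : ℂ) : ℂ[X] →ₗ[ℂ] ℂ[X] :=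
  (MvPolynomial.aeval ![C a * X + C b, C c * X + C d]).toLinearMap ∘ₗ homogenizeLM m

section Substitute

variable (m : ℕ) (a b c d : ℂ)

lemma substitute_apply (p : ℂ[X]) : substitute m a b c d p =
    MvPolynomial.aeval ![C a * X + C b, C c * X + C d] (p.homogenize m) := rfl

lemma substitute_eq_sum (p : ℂ[X]) : substitute m a b c d p =
    ∑ k ∈ Finset.range (m + 1), p.coeff k • ((C a * X + C b) ^ k * (C c * X + C d) ^ (m - k)) := by
  simp [substitute_apply, homogenize, Finset.Nat.sum_antidiagonal_eq_sum_range_succ_mk,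
    MvPolynomial.aeval_monomial, Finsupp.prod_fintype, smul_eq_C_mul]

lemma natDegree_substitute_le (p : ℂ[X]) : (substitute m a b c d p).natDegree ≤ m := by
  rw [substitute_eq_sum]
  refine natDegree_sum_le_of_forall_le (Finset.range (m + 1)) _ fun k hk => ?_
  refine (natDegree_smul_le _ _).trans (natDegree_mul_le.trans ?_)
  have h1 := natDegree_pow_le_of_le k (natDegree_linear_le (a := a) (b := b))
  have h2 := natDegree_pow_le_of_le (m - k) (natDegree_linear_le (a := c) (b := d))
  have := Finset.mem_range_succ_iff.mp hk
  omega

lemma homogenize_substitute (p : ℂ[X]) : (substitute m a b c d p).homogenize m =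
    MvPolynomial.aeval ![MvPolynomial.C a * MvPolynomial.X 0 + MvPolynomial.C b * MvPolynomial.X 1,
      MvPolynomial.C c * MvPolynomial.X 0 + MvPolynomial.C d * MvPolynomial.X 1]
      (p.homogenize m) := by
  have isHomogeneous_linear (s t : ℂ) : (MvPolynomial.C s * MvPolynomial.X 0 +
      MvPolynomial.C t * MvPolynomial.X 1 : MvPolynomial (Fin 2) ℂ).IsHomogeneous 1 :=
    (MvPolynomial.isHomogeneous_C_mul_X s 0).add (MvPolynomial.isHomogeneous_C_mul_X t 1)
  refine homogenize_eq_of_isHomogeneous ?_ ?_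
  · nth_rewrite 2 [← one_mul m]
    refine (isHomogeneous_homogenize p).aeval _ ?_
    exact Fin.forall_fin_two.mpr ⟨isHomogeneous_linear a b, isHomogeneous_linear c d⟩
  · rw [substitute_apply, MvPolynomial.comp_aeval_apply]
    refine congrArg (MvPolynomial.aeval · _) (funext fun i => ?_)
    fin_cases i <;> simp [MvPolynomial.algHom_C]

lemma homEval_substitute (p : ℂ[X]) (x y : ℂ) :
    homEval m (substitute m a b c d p) y x = homEval m p (c * x + d * y) (a * x + b * y) := by
  rw [homEval, homogenize_substitute, homEval, ← MvPolynomial.aeval_eq_eval,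
    MvPolynomial.comp_aeval_apply]
  refine congrArg (MvPolynomial.eval · _) (funext fun i => ?_)
  fin_cases i <;> simp

lemma eval_substitute (p : ℂ[X]) (x : ℂ) :
    (substitute m a b c d p).eval x = homEval m p (c * x + d) (a * x + b) := by
  rw [← homEval_one (natDegree_substitute_le m a b c d p), homEval_substitute, mul_one, mul_one]

end Substitute

lemma substitute_mul {m n : ℕ} (a b c d : ℂ) {p q : ℂ[X]} (hp : p.natDegree ≤ m)
    (hq : q.natDegree ≤ n) : substitute (m + n) a b c d (p * q) =
      substitute m a b c d p * substitute n a b c d q := by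
  simp only [substitute_apply, homogenize_mul p q hp hq, map_mul]

lemma substitute_X_sub_C_pow (e : ℕ) (a b c d r : ℂ) : substitute e a b c d ((X - C r) ^ e) =
    (C a * X + C b - C r * (C c * X + C d)) ^ e := by
  induction e with
  | zero => simp [substitute_apply]
  | succ e ih =>
    have hdeg : ((X - C r) ^ e).natDegree ≤ e := by
      rw [natDegree_pow, natDegree_X_sub_C, mul_one]
    rw [pow_succ, substitute_mul a b c d hdeg (natDegree_X_sub_C r).le, ih, pow_succ]
    simp [substitute_apply, homogenize_X]

/-- The form `p` in the coordinates `x`, `y` with `u = x + y` and `v = j x + (j - 1) y`,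
dehomogenized at `y = 1`. -/
def chartForm (m : ℕ) (j : ℤ) : ℂ[X] →ₗ[ℂ] ℂ[X] := substitute m j (j - 1) 1 1

/-- The form given by the polynomial `p` in the coordinates `x`, `y` of `chartForm m j`. -/
def ofChartForm (m : ℕ) (j : ℤ) : ℂ[X] →ₗ[ℂ] ℂ[X] := substitute m 1 (1 - j) (-1) j

lemma natDegree_chartForm_le (m : ℕ) (j : ℤ) (p : ℂ[X]) : (chartForm m j p).natDegree ≤ m :=
  natDegree_substitute_le ..

lemma natDegree_ofChartForm_le (m : ℕ) (j : ℤ) (p : ℂ[X]) : (ofChartForm m j p).natDegree ≤ m :=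
  natDegree_substitute_le ..

lemma homEval_chartForm (m : ℕ) (j : ℤ) (p : ℂ[X]) (x y : ℂ) :
    homEval m (chartForm m j p) y x = homEval m p (x + y) (j * x + (j - 1) * y) := by
  rw [chartForm, homEval_substitute, one_mul, one_mul]

lemma homEval_ofChartForm (m : ℕ) (j : ℤ) (p : ℂ[X]) (x y : ℂ) :
    homEval m (ofChartForm m j p) (x + y) (j * x + (j - 1) * y) = homEval m p y x := by
  rw [ofChartForm, homEval_substitute]
  congr 1 <;> ring

lemma ofChartForm_chartForm {m : ℕ} (j : ℤ) {p : ℂ[X]} (hp : p.natDegree ≤ m) :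
    ofChartForm m j (chartForm m j p) = p := by
  refine Polynomial.funext fun t => ?_
  rw [ofChartForm, eval_substitute, homEval_chartForm, ← homEval_one hp]
  congr 1 <;> ring

/-- The coefficient of `x ^ i * y ^ (m - i)` of the form `p` in the coordinates of
`chartForm m j`. -/
def chartCoeff (m : ℕ) (j : ℤ) (i : ℕ) : ℂ[X] →ₗ[ℂ] ℂ := lcoeff ℂ i ∘ₗ chartForm m j

lemma chartCoeff_apply (m : ℕ) (j : ℤ) (i : ℕ) (p : ℂ[X]) :
    chartCoeff m j i p = (chartForm m j p).coeff i := rfl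

lemma homEval_eq_sum_chartCoeff (m : ℕ) (j : ℤ) (p : ℂ[X]) (x y : ℂ) :
    homEval m p (x + y) (j * x + (j - 1) * y) =
      ∑ i ∈ Finset.range (m + 1), chartCoeff m j i p * (x ^ i * y ^ (m - i)) := by
  rw [← homEval_chartForm, homEval_eq_sum]
  rfl

lemma eq_sum_chartCoeff {m : ℕ} (j : ℤ) {p : ℂ[X]} (hp : p.natDegree ≤ m) :
    p = ∑ i ∈ Finset.range (m + 1), chartCoeff m j i p •
      ((X - C ((j - 1 : ℤ) : ℂ)) ^ i * (-(X - C (j : ℂ))) ^ (m - i)) := by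
  conv_lhs => rw [← ofChartForm_chartForm j hp, ofChartForm, substitute_eq_sum]
  refine Finset.sum_congr rfl fun i _ => ?_
  rw [chartCoeff_apply]
  congr 3
  · simp; ring
  · simp; ring

lemma chartCoeff_eq_zero_of_lt {m : ℕ} (j : ℤ) {i : ℕ} (hi : m < i) (p : ℂ[X]) :
    chartCoeff m j i p = 0 :=
  coeff_eq_zero_of_natDegree_lt ((natDegree_chartForm_le m j p).trans_lt hi)

lemma exists_chartForm_eq_of_mem_vanishing {m : ℕ} {r : ℤ} {e : ℕ} {p : ℂ[X]}
    (hp : p ∈ vanishing m r e) (hp0 : p ≠ 0) (j : ℤ) : ∃ q : ℂ[X], q.natDegree + e ≤ m ∧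
      chartForm m j p = (C ((j - r : ℤ) : ℂ) * X + C ((j - 1 - r : ℤ) : ℂ)) ^ e * q := by
  obtain ⟨hdeg, q, rfl⟩ := hp
  rw [natDegree_mul (X_sub_C_pow_ne_zero r e) (right_ne_zero_of_mul hp0),
    natDegree_X_sub_C_pow] at hdeg
  refine ⟨chartForm (m - e) j q, ?_, ?_⟩
  · have := natDegree_chartForm_le (m - e) j q
    omega
  · obtain ⟨d, rfl⟩ := Nat.exists_eq_add_of_le (le_of_add_le_left hdeg)
    rw [chartForm, substitute_mul _ _ _ _ (natDegree_X_sub_C_pow r e).le (by omega),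
      substitute_X_sub_C_pow, Nat.add_sub_cancel_left, chartForm]
    congr 2
    simp
    ring

lemma mem_vanishing_iff_chartCoeff {m : ℕ} {j : ℤ} {e : ℕ} {p : ℂ[X]} (hp : p.natDegree ≤ m) :
    p ∈ vanishing m j e ↔ ∀ i, m < i + e → chartCoeff m j i p = 0 := by
  refine ⟨fun h i hi => ?_, fun h => ⟨hp, ?_⟩⟩
  · rcases eq_or_ne p 0 with rfl | hp0
    · exact map_zero _
    obtain ⟨q, hq, hpq⟩ := exists_chartForm_eq_of_mem_vanishing h hp0 j
    have hconst : C ((j - j : ℤ) : ℂ) * X + C ((j - 1 - j : ℤ) : ℂ) = C (-1) := by simp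
    rw [chartCoeff_apply, hpq, hconst, ← C_pow, coeff_C_mul,
      coeff_eq_zero_of_natDegree_lt (by omega), mul_zero]
  · rw [eq_sum_chartCoeff j hp]
    refine Finset.dvd_sum fun i _ => ?_
    rcases lt_or_ge m (i + e) with hlt | hge
    · simp only [h i hlt, zero_smul, dvd_zero]
    · exact dvd_smul_of_dvd _ (((pow_dvd_pow _ (by omega)).trans
        (pow_dvd_pow_of_dvd (dvd_neg.mpr dvd_rfl) _)).mul_left _)

lemma mem_vanishing_sub_one_iff_chartCoeff {m : ℕ} {j : ℤ} {e : ℕ} {p : ℂ[X]}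
    (hp : p.natDegree ≤ m) :
    p ∈ vanishing m (j - 1) e ↔ ∀ i < e, chartCoeff m j i p = 0 := by
  refine ⟨fun h i hi => ?_, fun h => ⟨hp, ?_⟩⟩
  · rcases eq_or_ne p 0 with rfl | hp0
    · exact map_zero _
    obtain ⟨q, -, hpq⟩ := exists_chartForm_eq_of_mem_vanishing h hp0 j
    have hX : C ((j - (j - 1) : ℤ) : ℂ) * X + C ((j - 1 - (j - 1) : ℤ) : ℂ) = X := by simp
    rw [chartCoeff_apply, hpq, hX, mul_comm, coeff_mul_X_pow', if_neg (by omega)]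
  · rw [eq_sum_chartCoeff j hp]
    refine Finset.dvd_sum fun i _ => ?_
    rcases lt_or_ge i e with hlt | hge
    · simp only [h i hlt, zero_smul, dvd_zero]
    · exact dvd_smul_of_dvd _ ((pow_dvd_pow _ hge).mul_right _)

/-- The sum of the absolute values of the coefficients of degree at most `m`, a norm on the binary
forms of degree `m`. -/
def coeffNorm (m : ℕ) (p : ℂ[X]) : ℝ := ∑ k ∈ Finset.range (m + 1), ‖p.coeff k‖

lemma coeffNorm_nonneg (m : ℕ) (p : ℂ[X]) : 0 ≤ coeffNorm m p :=
  Finset.sum_nonneg fun _ _ => norm_nonneg _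

lemma exists_norm_le_mul_coeffNorm {E : Type*} [SeminormedAddCommGroup E] [NormedSpace ℂ E]
    (m : ℕ) (L : ℂ[X] →ₗ[ℂ] E) :
    ∃ K, 0 ≤ K ∧ ∀ p : ℂ[X], p.natDegree ≤ m → ‖L p‖ ≤ K * coeffNorm m p := by
  refine ⟨∑ k ∈ Finset.range (m + 1), ‖L (X ^ k)‖, Finset.sum_nonneg fun _ _ => norm_nonneg _,
    fun p hp => ?_⟩
  have hsum : L p = ∑ k ∈ Finset.range (m + 1), p.coeff k • L (X ^ k) := by
    conv_lhs => rw [as_sum_range' p (m + 1) (Nat.lt_succ_of_le hp)]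
    simp only [map_sum, ← smul_X_eq_monomial, map_smul]
  rw [hsum, coeffNorm, Finset.mul_sum]
  refine norm_sum_le_of_le _ fun k hk => ?_
  rw [norm_smul, mul_comm]
  exact mul_le_mul_of_nonneg_right
    (Finset.single_le_sum (f := fun k => ‖L (X ^ k)‖) (fun _ _ => norm_nonneg _) hk) (norm_nonneg _)

lemma exists_coeffNorm_le_mul_coeffNorm (m : ℕ) (L : ℂ[X] →ₗ[ℂ] ℂ[X]) :
    ∃ K, 0 ≤ K ∧ ∀ p : ℂ[X], p.natDegree ≤ m → coeffNorm m (L p) ≤ K * coeffNorm m p := by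
  choose K hK0 hK using fun k => exists_norm_le_mul_coeffNorm m (lcoeff ℂ k ∘ₗ L)
  refine ⟨∑ k ∈ Finset.range (m + 1), K k, Finset.sum_nonneg fun _ _ => hK0 _, fun p hp => ?_⟩
  rw [Finset.sum_mul, coeffNorm]
  exact Finset.sum_le_sum fun k _ => hK k p hp

lemma exists_coeff_eq_sum_eval (m : ℕ) : ∃ l : ℕ → ℕ → ℂ, ∀ p : ℂ[X], p.natDegree ≤ m → ∀ k,
    p.coeff k = ∑ t ∈ Finset.range (m + 1), l k t * p.eval (t : ℂ) := by
  refine ⟨fun k t => (Lagrange.basis (Finset.range (m + 1)) (fun t : ℕ => (t : ℂ)) t).coeff k,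
    fun p hp k => ?_⟩
  have hinterp := Lagrange.eq_interpolate (s := Finset.range (m + 1)) (v := fun t : ℕ => (t : ℂ))
    (f := p) (Nat.cast_injective (R := ℂ)).injOn (by
      rw [Finset.card_range]
      exact (natDegree_le_iff_degree_le.mp hp).trans_lt (by exact_mod_cast m.lt_succ_self))
  conv_lhs => rw [hinterp]
  simp [Lagrange.interpolate_apply, mul_comm]

end BinaryForm

/-! ### Symmetric differentials in the charts of the resolution -/

namespace SymmetricDifferential

variable {M : Type*} [TopologicalSpace M] {E : Type*} [NormedAddCommGroup E] [NormedSpace ℂ E]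
  [ChartedSpace E M]

lemma mdifferentiableAt_subtype_iff {F : Type*} [NormedAddCommGroup F] [NormedSpace ℂ F]
    {H N : Type*} [TopologicalSpace H] {J : ModelWithCorners ℂ E H} [TopologicalSpace N]
    [ChartedSpace H N] {U : Opens N} {f : N → F} {x : U} :
    MDifferentiableAt J 𝓘(ℂ, F) (fun y : U => f y) x ↔ MDifferentiableAt J 𝓘(ℂ, F) f x :=
  (differentiableWithinAt_localInvariantProp.liftPropAt_iff_comp_subtype_val _ _).symm

variable [IsManifold 𝓘(ℂ, E) ω M]

/-- The extension by zero of a symmetric differential to a function on the tangent bundle. -/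
def extend {m : ℕ} {U : Opens M} (f : sections E m U) (v : TangentBundle 𝓘(ℂ, E) M) : ℂ :=
  open Classical in if h : v ∈ tangentOver E U then f.1 ⟨v, h⟩ else 0

lemma extend_apply {m : ℕ} {U : Opens M} (f : sections E m U) (v : tangentOver E U) :
    extend f v = f.1 v := dif_pos v.2

lemma extend_of_mem {m : ℕ} {U : Opens M} (f : sections E m U) {v : TangentBundle 𝓘(ℂ, E) M}
    (h : v.proj ∈ U) : extend f v = f.1 ⟨v, h⟩ := dif_pos h

lemma extend_restrict {m : ℕ} {U V : Opens M} (h : U ≤ V) (f : sections E m V)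
    {v : TangentBundle 𝓘(ℂ, E) M} (hv : v.proj ∈ U) :
    extend (restrict E m h f) v = extend f v := by
  rw [extend_of_mem _ hv, extend_of_mem _ (h hv)]
  rfl

lemma extend_add {m : ℕ} {U : Opens M} (f g : sections E m U) (v : TangentBundle 𝓘(ℂ, E) M) :
    extend (f + g) v = extend f v + extend g v := by
  unfold extend
  split_ifs
  · rfl
  · simp

lemma extend_smul {m : ℕ} {U : Opens M} (c : ℂ) (f : sections E m U)
    (v : TangentBundle 𝓘(ℂ, E) M) : extend (c • f) v = c * extend f v := by
  unfold extend
  split_ifs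
  · rfl
  · simp

lemma mdifferentiableAt_extend {m : ℕ} {U : Opens M} (f : sections E m U)
    {v : TangentBundle 𝓘(ℂ, E) M} (h : v.proj ∈ U) :
    MDifferentiableAt 𝓘(ℂ, E).tangent 𝓘(ℂ, ℂ) (extend f) v := by
  have := f.2.1 ⟨v, h⟩
  rw [← mdifferentiableAt_subtype_iff (U := tangentOver E U) (x := ⟨v, h⟩)]
  convert this using 2 with y
  exact extend_apply f _

lemma mem_sections_of_local {m : ℕ} {U : Opens M} {F : TangentBundle 𝓘(ℂ, E) M → ℂ}
    (h : ∀ q ∈ U, ∃ N : Opens M, q ∈ N ∧ ∃ g : sections E m N, ∀ v : TangentBundle 𝓘(ℂ, E) M,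
      v.proj ∈ N → v.proj ∈ U → F v = extend g v) :
    (fun v : tangentOver E U => F v) ∈ sections E m U := by
  refine ⟨fun v => ?_, fun p => ?_⟩
  · rw [mdifferentiableAt_subtype_iff (f := F)]
    obtain ⟨N, hN, g, hg⟩ := h v.1.proj v.2
    refine (mdifferentiableAt_extend g hN).congr_of_eventuallyEq ?_
    have : (tangentOver E N ⊓ tangentOver E U : Opens _).1 ∈ 𝓝 v.1 :=
      (tangentOver E N ⊓ tangentOver E U).isOpen.mem_nhds ⟨hN, v.2⟩
    filter_upwards [this] with w hw
    exact hg w hw.1 hw.2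
  · obtain ⟨N, hN, g, hg⟩ := h p.1 p.2
    obtain ⟨A, hA⟩ := g.2.2 ⟨p.1, hN⟩
    refine ⟨A, fun v => ?_⟩
    rw [← hA v]
    exact (hg (tangentPt E p v).1 hN p.2).trans (extend_of_mem g (v := ⟨p.1, v⟩) hN)

end SymmetricDifferential

namespace A2Resolution

open SymmetricDifferential

local notation "I₂" => 𝓘(ℂ, ℂ × ℂ)

/-- The `j`-th chart as an open partial homeomorphism. -/
def openChart (j : Fin 3) : OpenPartialHomeomorph A2Resolution (ℂ × ℂ) :=
  core.openPartialHomeomorph (chart j) (mem_range_self j)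

lemma openChart_mem (j : Fin 3) : openChart j ∈ IsManifold.maximalAtlas I₂ ω A2Resolution :=
  IsManifold.subset_maximalAtlas (mem_iUnion₂.mpr ⟨chart j, mem_range_self j, rfl⟩)

lemma contMDiff_param (j : Fin 3) : ContMDiff I₂ I₂ ω (param j) := by
  rw [← contMDiffOn_univ]
  exact contMDiffOn_symm_of_mem_maximalAtlas (openChart_mem j)

lemma contMDiffOn_coord (j : Fin 3) : ContMDiffOn I₂ I₂ ω (coord j) (chartDomain j) :=
  contMDiffOn_of_mem_maximalAtlas (openChart_mem j)

lemma param_mem_chartDomain (j : Fin 3) (c : ℂ × ℂ) : param j c ∈ chartDomain j :=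
  (chart j).map_target (mem_univ c)

lemma continuous_param (j : Fin 3) : Continuous (param j) := (contMDiff_param j).continuous

lemma mdifferentiableAt_param (j : Fin 3) (c : ℂ × ℂ) : MDifferentiableAt I₂ I₂ (param j) c :=
  (contMDiff_param j).mdifferentiable (by simp) c

lemma mdifferentiableAt_coord {j : Fin 3} {q : A2Resolution} (hq : q ∈ chartDomain j) :
    MDifferentiableAt I₂ I₂ (coord j) q :=
  ((contMDiffOn_coord j).contMDiffAt ((chartDomain j).isOpen.mem_nhds hq)).mdifferentiableAt
    (by simp)

/-- The tangent vector at `param j c` with coordinates `w` in the `j`-th chart. -/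
def tangentVec (j : Fin 3) (z : (ℂ × ℂ) × (ℂ × ℂ)) : TangentBundle I₂ A2Resolution :=
  ⟨param j z.1, mfderiv I₂ I₂ (param j) z.1 z.2⟩

lemma mdifferentiable_tangentVec (j : Fin 3) :
    MDifferentiable 𝓘(ℂ, (ℂ × ℂ) × (ℂ × ℂ)) (I₂).tangent (tangentVec j) := by
  have htangentMap : ContMDiff (I₂).tangent (I₂).tangent 1 (tangentMap I₂ I₂ (param j)) :=
    (contMDiff_param j).contMDiff_tangentMap (m := 1) (by decide)
  have htriv : ContMDiff ((I₂).prod 𝓘(ℂ, ℂ × ℂ)) (I₂).tangent 1 _ :=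
    contMDiff_tangentBundleModelSpaceHomeomorph_symm (I := I₂) (n := 1)
  rw [modelWithCornersSelf_prod (𝕜 := ℂ) (E := ℂ × ℂ) (F := ℂ × ℂ)]
  exact (htangentMap.comp htriv).mdifferentiable (by simp)

/-- The coordinates of a tangent vector in the `j`-th chart. -/
def tangentCoord (j : Fin 3) (v : TangentBundle I₂ A2Resolution) : (ℂ × ℂ) × (ℂ × ℂ) :=
  (coord j v.proj, mfderiv I₂ I₂ (coord j) v.proj v.2)

lemma mdifferentiableAt_tangentCoord {j : Fin 3} {v : TangentBundle I₂ A2Resolution}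
    (hv : v.proj ∈ chartDomain j) :
    MDifferentiableAt (I₂).tangent 𝓘(ℂ, (ℂ × ℂ) × (ℂ × ℂ)) (tangentCoord j) v := by
  have htangentMap : ContMDiffOn (I₂).tangent (I₂).tangent 1 (tangentMapWithin I₂ I₂ (coord j)
      (chartDomain j)) _ := (contMDiffOn_coord j).contMDiffOn_tangentMapWithin (m := 1) (by decide)
    (chartDomain j).isOpen.uniqueMDiffOn
  have htriv : ContMDiff (I₂).tangent ((I₂).prod 𝓘(ℂ, ℂ × ℂ)) 1 _ :=
    contMDiff_tangentBundleModelSpaceHomeomorph (I := I₂) (n := 1)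
  have hnhds : (tangentOver (ℂ × ℂ) (chartDomain j)).1 ∈ 𝓝 v :=
    (tangentOver (ℂ × ℂ) (chartDomain j)).isOpen.mem_nhds hv
  have hcomp := ((htriv.comp_contMDiffOn htangentMap).contMDiffAt hnhds).mdifferentiableAt (by simp)
  rw [modelWithCornersSelf_prod (𝕜 := ℂ) (E := ℂ × ℂ) (F := ℂ × ℂ)]
  refine hcomp.congr_of_eventuallyEq ?_
  filter_upwards [hnhds] with w hw
  have : mfderivWithin I₂ I₂ (coord j) (chartDomain j) w.proj = mfderiv I₂ I₂ (coord j) w.proj :=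
    mfderivWithin_of_isOpen (chartDomain j).isOpen hw
  exact Prod.ext rfl (DFunLike.congr_fun this w.2).symm

lemma tangentCoord_tangentVec (j : Fin 3) (z : (ℂ × ℂ) × (ℂ × ℂ)) :
    tangentCoord j (tangentVec j z) = z := by
  have hc : coord j ∘ param j = id := funext (coord_param j)
  have h := mfderiv_comp z.1 (mdifferentiableAt_coord (param_mem_chartDomain j z.1))
    (mdifferentiableAt_param j z.1)
  rw [hc, mfderiv_id] at h
  refine Prod.ext (coord_param j z.1) ?_
  exact (DFunLike.congr_fun h z.2).symm

lemma tangentVec_tangentCoord {j : Fin 3} {v : TangentBundle I₂ A2Resolution}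
    (hv : v.proj ∈ chartDomain j) : tangentVec j (tangentCoord j v) = v := by
  have hc : param j ∘ coord j =ᶠ[𝓝 v.proj] id := by
    filter_upwards [(chartDomain j).isOpen.mem_nhds hv] with q hq
    exact param_coord j q hq
  have h := mfderiv_comp v.proj (mdifferentiableAt_param j _) (mdifferentiableAt_coord hv)
  rw [hc.mfderiv_eq, mfderiv_id] at h
  obtain ⟨q, w⟩ := v
  have hw := DFunLike.congr_fun h w
  have hq : param j (coord j q) = q := param_coord j q hv
  refine Bundle.TotalSpace.ext hq ?_
  exact heq_of_eq hw.symm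

open Laurent BinaryForm

variable {m : ℕ} {U V : Opens A2Resolution}

/-- The value of a symmetric differential at the tangent vector with coordinates `w` in the `j`-th
chart at the point with coordinates `c`. -/
def rep (j : Fin 3) (f : sections (ℂ × ℂ) m U) (c w : ℂ × ℂ) : ℂ := extend f (tangentVec j (c, w))

lemma rep_restrict (j : Fin 3) (h : U ≤ V) (f : sections (ℂ × ℂ) m V) {c : ℂ × ℂ}
    (hc : param j c ∈ U) (w : ℂ × ℂ) : rep j (restrict (ℂ × ℂ) m h f) c w = rep j f c w :=
  extend_restrict h f hc

lemma rep_add (j : Fin 3) (f g : sections (ℂ × ℂ) m U) (c w : ℂ × ℂ) :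
    rep j (f + g) c w = rep j f c w + rep j g c w := extend_add f g _

lemma rep_smul (j : Fin 3) (a : ℂ) (f : sections (ℂ × ℂ) m U) (c w : ℂ × ℂ) :
    rep j (a • f) c w = a * rep j f c w := extend_smul a f _

lemma isOpen_preimage_param (j : Fin 3) (U : Opens A2Resolution) :
    IsOpen {c : ℂ × ℂ | param j c ∈ U} := U.isOpen.preimage (continuous_param j)

lemma differentiableOn_rep (j : Fin 3) (f : sections (ℂ × ℂ) m U) :
    DifferentiableOn ℂ (fun z : (ℂ × ℂ) × (ℂ × ℂ) => rep j f z.1 z.2)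
      {z | param j z.1 ∈ U} := fun z hz => by
  have h : MDifferentiableAt (I₂).tangent 𝓘(ℂ, ℂ) (extend f) (tangentVec j z) :=
    mdifferentiableAt_extend f hz
  exact (h.comp z (mdifferentiable_tangentVec j z)).differentiableAt.differentiableWithinAt

lemma exists_multilinearMap_eq_rep (j : Fin 3) (f : sections (ℂ × ℂ) m U) {c : ℂ × ℂ}
    (hc : param j c ∈ U) :
    ∃ A : MultilinearMap ℂ (fun _ : Fin m => ℂ × ℂ) ℂ, ∀ w, rep j f c w = A fun _ => w := by
  obtain ⟨A, hA⟩ := f.2.2 ⟨param j c, hc⟩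
  let L : ℂ × ℂ →L[ℂ] TangentSpace I₂ (param j c) := mfderiv I₂ I₂ (param j) c
  refine ⟨A.compLinearMap fun _ => L.toLinearMap, fun w => ?_⟩
  exact (extend_of_mem f (v := tangentVec j (c, w)) hc).trans (hA (L w))

lemma exists_coeff (j : Fin 3) (f : sections (ℂ × ℂ) m U) :
    ∃ F : ℕ → ℂ × ℂ → ℂ, (∀ i, DifferentiableOn ℂ (F i) {c | param j c ∈ U}) ∧
      ∀ c, param j c ∈ U → ∀ w : ℂ × ℂ,
        rep j f c w = ∑ i ∈ Finset.range (m + 1), F i c * (w.1 ^ i * w.2 ^ (m - i)) := by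
  obtain ⟨l, hl⟩ := exists_coeff_eq_sum_eval m
  refine ⟨fun i c => ∑ t ∈ Finset.range (m + 1), l i t * rep j f c ((t : ℂ), 1), fun i => ?_,
    fun c hc w => ?_⟩
  · refine DifferentiableOn.fun_sum fun t _ => DifferentiableOn.const_mul ?_ _
    exact (differentiableOn_rep j f).comp
      (f := fun c : ℂ × ℂ => (c, ((t : ℂ), (1 : ℂ)))) (by fun_prop) fun c hc => hc
  · obtain ⟨A, hA⟩ := exists_multilinearMap_eq_rep j f hc
    obtain ⟨p, hdeg, hp⟩ := exists_homEval_eq_multilinearMap A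
    rw [hA, hp, homEval_eq_sum]
    refine Finset.sum_congr rfl fun i _ => ?_
    simp only [hl p hdeg, hA, hp, homEval_one hdeg]

lemma exists_section (m : ℕ) (j : Fin 3) (hV : V ≤ chartDomain j) (F : ℕ → ℂ × ℂ → ℂ)
    (hF : ∀ i ≤ m, DifferentiableOn ℂ (F i) {c | param j c ∈ V}) :
    ∃ f : sections (ℂ × ℂ) m V, ∀ c w : ℂ × ℂ, param j c ∈ V →
      rep j f c w = ∑ i ∈ Finset.range (m + 1), F i c * (w.1 ^ i * w.2 ^ (m - i)) := by
  let G : (ℂ × ℂ) × (ℂ × ℂ) → ℂ := fun z =>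
    ∑ i ∈ Finset.range (m + 1), F i z.1 * (z.2.1 ^ i * z.2.2 ^ (m - i))
  have hG : DifferentiableOn ℂ G {z | param j z.1 ∈ V} := by
    refine DifferentiableOn.fun_sum fun i hi => DifferentiableOn.mul ?_ (by fun_prop)
    exact (hF i (Finset.mem_range_succ_iff.mp hi)).comp (by fun_prop) fun z hz => hz
  have hGo : IsOpen {z : (ℂ × ℂ) × (ℂ × ℂ) | param j z.1 ∈ V} :=
    (isOpen_preimage_param j V).preimage continuous_fst
  have hcoord : ∀ v : TangentBundle I₂ A2Resolution, v.proj ∈ V →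
      param j (tangentCoord j v).1 ∈ V := fun v hv => by
    have : param j (coord j v.proj) = v.proj := param_coord j _ (hV hv)
    change param j (coord j v.proj) ∈ V
    rwa [this]
  refine ⟨⟨fun v => G (tangentCoord j v), fun v => ?_, fun p => ?_⟩, fun c w hc => ?_⟩
  · rw [mdifferentiableAt_subtype_iff (f := fun v => G (tangentCoord j v))]
    have hGv : MDifferentiableAt 𝓘(ℂ, (ℂ × ℂ) × (ℂ × ℂ)) 𝓘(ℂ, ℂ) G (tangentCoord j v) :=
      (hG.differentiableAt (hGo.mem_nhds (hcoord v v.2))).mdifferentiableAt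
    exact hGv.comp v.1 (mdifferentiableAt_tangentCoord (hV v.2))
  · obtain ⟨A, hA⟩ := exists_multilinearMap_eq_sum (m := m) fun i => F i (coord j p)
    let L : TangentSpace I₂ (p : A2Resolution) →L[ℂ] ℂ × ℂ := mfderiv I₂ I₂ (coord j) p
    exact ⟨A.compLinearMap fun _ => L.toLinearMap, fun v => (hA (L v)).symm⟩
  · rw [rep, extend_of_mem _ (v := tangentVec j (c, w)) hc]
    change G (tangentCoord j (tangentVec j (c, w))) = _
    rw [tangentCoord_tangentVec]

lemma sections_ext_rep {f g : sections (ℂ × ℂ) m U}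
    (h : ∀ j c, param j c ∈ U → ∀ w, rep j f c w = rep j g c w) : f = g := by
  refine Subtype.ext (funext fun v => ?_)
  obtain ⟨j, hj⟩ := exists_rep_ne_zero v.1.proj
  have hv := tangentVec_tangentCoord (v := v.1) (j := j) hj
  have hU : param j (tangentCoord j v.1).1 ∈ U := by
    have : param j (coord j v.1.proj) = v.1.proj := param_coord j _ hj
    change param j (coord j v.1.proj) ∈ U
    rw [this]
    exact v.2
  have := h j (tangentCoord j v.1).1 hU (tangentCoord j v.1).2
  rw [rep, rep, hv, extend_apply, extend_apply] at this
  exact this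

/-- The coordinates in the middle chart as functions of those in the `j`-th chart. -/
def toMiddle (j : Fin 3) (c : ℂ × ℂ) : ℂ × ℂ :=
  (mon ((j : ℕ), (j : ℕ) - 1) c, mon (1 - (j : ℕ), 2 - (j : ℕ)) c)

lemma exists_toMiddle_eq (j : Fin 3) {d : ℂ × ℂ} (h1 : d.1 ≠ 0) (h2 : d.2 ≠ 0) :
    ∃ c : ℂ × ℂ, c.1 ≠ 0 ∧ c.2 ≠ 0 ∧ toMiddle j c = d := by
  refine ⟨(mon (2 - (j : ℕ), 1 - (j : ℕ)) d, mon ((j : ℕ) - 1, (j : ℕ)) d), mon_ne_zero _ h1 h2,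
    mon_ne_zero _ h1 h2, Prod.ext ?_ ?_⟩ <;> fin_cases j <;> simp [toMiddle, mon] <;> field_simp

lemma exists_smul_vec_eq (j : Fin 3) {c : ℂ × ℂ} (h1 : c.1 ≠ 0) (h2 : c.2 ≠ 0) :
    ∃ t : ℂ, t • vec j c = vec 1 (toMiddle j c) ∧ scale j c = scale 1 (toMiddle j c) * t := by
  fin_cases j
  · refine ⟨c.2⁻¹, funext fun k => ?_, ?_⟩
    · fin_cases k <;> simp [vec, toMiddle, mon] <;> field_simp
    · simp [scale, toMiddle, mon]
      field_simp
  · exact ⟨1, by simp [vec, toMiddle, mon], by simp [scale, toMiddle, mon]⟩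
  · refine ⟨c.1⁻¹, funext fun k => ?_, ?_⟩
    · fin_cases k <;> simp [vec, toMiddle, mon] <;> field_simp
    · simp [scale, toMiddle, mon]
      field_simp

lemma param_toMiddle (j : Fin 3) {c : ℂ × ℂ} (h1 : c.1 ≠ 0) (h2 : c.2 ≠ 0) :
    param 1 (toMiddle j c) = param j c := by
  obtain ⟨t, ht, hs⟩ := exists_smul_vec_eq j h1 h2
  ext1
  · change scale 1 (toMiddle j c) • vec 1 (toMiddle j c) = scale j c • vec j c
    rw [← ht, hs, smul_smul]
  · change Projectivization.mk ℂ (vec 1 (toMiddle j c)) _ = Projectivization.mk ℂ (vec j c) _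
    rw [Projectivization.mk_eq_mk_iff']
    exact ⟨t, ht⟩

lemma hasMFDerivAt_toMiddle (j : Fin 3) {c : ℂ × ℂ} (h1 : c.1 ≠ 0) (h2 : c.2 ≠ 0) :
    ∃ L : ℂ × ℂ →L[ℂ] ℂ × ℂ, HasMFDerivAt I₂ I₂ (toMiddle j) c L ∧
      ∀ x y, L (c.1 * x, c.2 * y) = ((toMiddle j c).1 * ((j : ℕ) * x + ((j : ℕ) - 1) * y),
        (toMiddle j c).2 * ((1 - (j : ℕ)) * x + (2 - (j : ℕ)) * y)) := by
  refine ⟨_, ((hasFDerivAt_mon _ h1 h2).prodMk (hasFDerivAt_mon _ h1 h2)).hasMFDerivAt,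
    fun x y => ?_⟩
  refine Prod.ext ?_ ?_ <;> simp [toMiddle] <;> field_simp

lemma rep_toMiddle (j : Fin 3) (f : sections (ℂ × ℂ) m U) {c : ℂ × ℂ} (h1 : c.1 ≠ 0)
    (h2 : c.2 ≠ 0) (x y : ℂ) :
    rep j f c (c.1 * x, c.2 * y) = rep 1 f (toMiddle j c)
      ((toMiddle j c).1 * ((j : ℕ) * x + ((j : ℕ) - 1) * y),
        (toMiddle j c).2 * ((1 - (j : ℕ)) * x + (2 - (j : ℕ)) * y)) := by
  obtain ⟨L, hL, hLapply⟩ := hasMFDerivAt_toMiddle j h1 h2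
  have heq : param 1 ∘ toMiddle j =ᶠ[𝓝 c] param j := by
    have hopen : IsOpen {c : ℂ × ℂ | c.1 ≠ 0 ∧ c.2 ≠ 0} :=
      (isOpen_ne_fun continuous_fst continuous_const).inter
        (isOpen_ne_fun continuous_snd continuous_const)
    filter_upwards [hopen.mem_nhds ⟨h1, h2⟩] with d hd
    exact param_toMiddle j hd.1 hd.2
  have hderiv := heq.mfderiv_eq (I := I₂) (I' := I₂)
  rw [mfderiv_comp c (mdifferentiableAt_param 1 (toMiddle j c)) hL.mdifferentiableAt,
    hL.mfderiv] at hderiv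
  rw [← hLapply, rep, rep]
  congr 1
  refine Bundle.TotalSpace.ext (param_toMiddle j h1 h2).symm (heq_of_eq ?_)
  exact (DFunLike.congr_fun hderiv (c.1 * x, c.2 * y)).symm

end A2Resolution

/-! ### Laurent expansions of symmetric differentials -/

namespace A2Resolution

open SymmetricDifferential Laurent BinaryForm Polynomial

variable {m : ℕ} {U V : Opens A2Resolution}

/-- The exponents in the `j`-th chart of the monomial of weight `n`, that is, of the function
`y ^ n.1 * (x / y) ^ n.2` on the torus. -/
def wt (j : Fin 3) : ℤ × ℤ ≃ ℤ × ℤ where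
  toFun n := (n.1 + (j : ℕ) * n.2, n.1 + ((j : ℕ) - 1) * n.2)
  invFun k := (k.1 - (j : ℕ) * (k.1 - k.2), k.1 - k.2)
  left_inv n := Prod.ext (by simp only; ring) (by simp only; ring)
  right_inv k := Prod.ext (by simp only; ring) (by simp only; ring)

lemma wt_fst (j : Fin 3) (n : ℤ × ℤ) : (wt j n).1 = n.1 + (j : ℕ) * n.2 := rfl

lemma wt_snd (j : Fin 3) (n : ℤ × ℤ) : (wt j n).2 = n.1 + ((j : ℕ) - 1) * n.2 := rfl

/-- The order to which a form of degree `m` and weight `n` has to vanish at `r` in order to be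
regular along the `r`-th invariant curve. The curves `r = 0` and `r = 1` are the components of the
exceptional locus; `r = -1` and `r = 2` are the two noncompact ones. -/
def ord (m : ℕ) (n : ℤ × ℤ) (r : ℤ) : ℕ := (m - (n.1 + r * n.2)).toNat

/-- The forms of degree `m` that are regular in weight `n` along the `r`-th invariant curve. -/
def reg (m : ℕ) (n : ℤ × ℤ) (r : ℤ) : Submodule ℂ ℂ[X] := vanishing m r (ord m n r)

lemma mem_reg_iff_chartCoeff {j : Fin 3} {n : ℤ × ℤ} {p : ℂ[X]} (hp : p.natDegree ≤ m) :
    p ∈ reg m n (j : ℕ) ↔ ∀ i ≤ m, (wt j n).1 < i → chartCoeff m (j : ℕ) i p = 0 := by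
  simp only [reg, mem_vanishing_iff_chartCoeff hp, ord, wt_fst]
  refine ⟨fun h i _ hi => h i (by omega), fun h i hi => ?_⟩
  rcases lt_or_ge m i with hmi | hmi
  · exact chartCoeff_eq_zero_of_lt _ hmi _
  · exact h i hmi (by omega)

lemma mem_reg_sub_one_iff_chartCoeff {j : Fin 3} {n : ℤ × ℤ} {p : ℂ[X]} (hp : p.natDegree ≤ m) :
    p ∈ reg m n ((j : ℕ) - 1) ↔
      ∀ i ≤ m, (wt j n).2 < (m - i : ℕ) → chartCoeff m (j : ℕ) i p = 0 := by
  simp only [reg, mem_vanishing_sub_one_iff_chartCoeff hp, ord, wt_snd]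
  refine ⟨fun h i _ hi => h i (by omega), fun h i hi => ?_⟩
  rcases lt_or_ge m i with hmi | hmi
  · exact chartCoeff_eq_zero_of_lt _ hmi _
  · exact h i hmi (by omega)

lemma mon_wt_toMiddle (j : Fin 3) (n : ℤ × ℤ) {c : ℂ × ℂ} (h1 : c.1 ≠ 0) (h2 : c.2 ≠ 0) :
    mon (wt 1 n) (toMiddle j c) = mon (wt j n) c := by
  simp only [mon, toMiddle, wt_fst, wt_snd, mul_zpow, ← zpow_mul]
  calc _ = (c.1 ^ ((j : ℕ) * (n.1 + ((1 : Fin 3) : ℕ) * n.2) : ℤ) *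
          c.1 ^ ((1 - (j : ℕ)) * (n.1 + (((1 : Fin 3) : ℕ) - 1) * n.2) : ℤ)) *
        (c.2 ^ (((j : ℕ) - 1) * (n.1 + ((1 : Fin 3) : ℕ) * n.2) : ℤ) *
          c.2 ^ ((2 - (j : ℕ)) * (n.1 + (((1 : Fin 3) : ℕ) - 1) * n.2) : ℤ)) := by ring
    _ = _ := by
      rw [← zpow_add₀ h1, ← zpow_add₀ h2]
      congr 2 <;> · simp only [Fin.val_one, Nat.cast_one]; ring

/-- The symmetric differential `f` has the Laurent expansion `∑ p n` on the torus, where the form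
`p n` of weight `n` is evaluated on logarithmic tangent vectors `(c.1 * x, c.2 * y)`. -/
structure HasExpansion (f : sections (ℂ × ℂ) m U) (p : ℤ × ℤ → ℂ[X]) : Prop where
  natDegree_le : ∀ n, (p n).natDegree ≤ m
  hasSum : ∀ (j : Fin 3) (c : ℂ × ℂ), c.1 ≠ 0 → c.2 ≠ 0 → param j c ∈ U → ∀ x y : ℂ,
    HasSum (fun n => mon (wt j n) c * homEval m (p n) (x + y) ((j : ℕ) * x + ((j : ℕ) - 1) * y))
      (rep j f c (c.1 * x, c.2 * y))

lemma HasExpansion.of_middle {f : sections (ℂ × ℂ) m U} {p : ℤ × ℤ → ℂ[X]}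
    (hp : ∀ n, (p n).natDegree ≤ m) (h : ∀ c : ℂ × ℂ, c.1 ≠ 0 → c.2 ≠ 0 → param 1 c ∈ U →
      ∀ x y : ℂ, HasSum (fun n => mon (wt 1 n) c * homEval m (p n) (x + y) x)
        (rep 1 f c (c.1 * x, c.2 * y))) : HasExpansion f p := by
  refine ⟨hp, fun j c h1 h2 hc x y => ?_⟩
  rw [rep_toMiddle j f h1 h2]
  have := h (toMiddle j c) (mon_ne_zero _ h1 h2) (mon_ne_zero _ h1 h2)
    (by rwa [param_toMiddle j h1 h2]) ((j : ℕ) * x + ((j : ℕ) - 1) * y)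
    ((1 - (j : ℕ)) * x + (2 - (j : ℕ)) * y)
  refine this.congr_fun fun n => ?_
  rw [mon_wt_toMiddle j n h1 h2]
  congr 2
  ring

lemma HasExpansion.of_chart (j : Fin 3) {f : sections (ℂ × ℂ) m U} {p : ℤ × ℤ → ℂ[X]}
    (hp : ∀ n, (p n).natDegree ≤ m) (h : ∀ c : ℂ × ℂ, c.1 ≠ 0 → c.2 ≠ 0 → param j c ∈ U →
      ∀ x y : ℂ, HasSum
        (fun n => mon (wt j n) c * homEval m (p n) (x + y) ((j : ℕ) * x + ((j : ℕ) - 1) * y))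
        (rep j f c (c.1 * x, c.2 * y))) : HasExpansion f p := by
  refine .of_middle hp fun d hd1 hd2 hd x y => ?_
  obtain ⟨c, h1, h2, rfl⟩ := exists_toMiddle_eq j hd1 hd2
  have hsum := h c h1 h2 (by rwa [← param_toMiddle j h1 h2])
    ((2 - (j : ℕ)) * x + (1 - (j : ℕ)) * y) (((j : ℕ) - 1) * x + (j : ℕ) * y)
  rw [rep_toMiddle j f h1 h2] at hsum
  convert! hsum.congr_fun fun n => ?_ using 3
  · ring
  · ring
  · rw [mon_wt_toMiddle j n h1 h2]
    congr 2 <;> ring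

lemma exists_hasExpansion (f : sections (ℂ × ℂ) m U)
    (hU : IsCompleteReinhardt {c : ℂ × ℂ | c.1 ≠ 0 ∧ c.2 ≠ 0 ∧ param 1 c ∈ U}) :
    ∃ p, HasExpansion f p := by
  obtain ⟨F, hF, hFf⟩ := exists_coeff 1 f
  have hlog : ∀ i, DifferentiableOn ℂ (fun c : ℂ × ℂ => F i c * (c.1 ^ i * c.2 ^ (m - i)))
      {c : ℂ × ℂ | c.1 ≠ 0 ∧ c.2 ≠ 0 ∧ param 1 c ∈ U} := fun i =>
    ((hF i).mono fun c hc => hc.2.2).mul (by fun_prop)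
  choose a ha using fun i => hU.exists_hasSum_laurent (hlog i)
  let q (n : ℤ × ℤ) : ℂ[X] := ∑ i ∈ Finset.range (m + 1), monomial i (a i (wt 1 n))
  have hq : ∀ n x y, homEval m (ofChartForm m 1 (q n)) (x + y) x =
      ∑ i ∈ Finset.range (m + 1), a i (wt 1 n) * (x ^ i * y ^ (m - i)) := fun n x y => by
    have hform := homEval_ofChartForm m 1 (q n) x y
    rw [Int.cast_one, one_mul, sub_self, zero_mul, add_zero] at hform
    rw [hform, homEval_sum]
    exact Finset.sum_congr rfl fun i hi => homEval_monomial (Finset.mem_range_succ_iff.mp hi) ..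
  refine ⟨fun n => ofChartForm m 1 (q n), .of_middle (fun n => natDegree_ofChartForm_le m 1 _)
    fun c h1 h2 hc x y => ?_⟩
  simp only [hq, Finset.mul_sum, hFf c hc]
  refine hasSum_sum fun i _ => ?_
  have hsum := ((wt 1).hasSum_iff.mpr (ha i c ⟨h1, h2, hc⟩)).mul_right (x ^ i * y ^ (m - i))
  rw [show F i c * ((c.1 * x) ^ i * (c.2 * y) ^ (m - i)) =
    F i c * (c.1 ^ i * c.2 ^ (m - i)) * (x ^ i * y ^ (m - i)) by rw [mul_pow, mul_pow]; ring]
  exact hsum.congr_fun fun n => by rw [Function.comp_apply]; ring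

namespace HasExpansion

variable {f g : sections (ℂ × ℂ) m U} {p q : ℤ × ℤ → ℂ[X]}

lemma restrict (h : V ≤ U) (hf : HasExpansion f p) :
    HasExpansion (SymmetricDifferential.restrict (ℂ × ℂ) m h f) p :=
  ⟨hf.natDegree_le, fun j c h1 h2 hc x y => by
    rw [rep_restrict j h f hc]
    exact hf.hasSum j c h1 h2 (h hc) x y⟩

lemma add (hf : HasExpansion f p) (hg : HasExpansion g q) : HasExpansion (f + g) (p + q) :=
  ⟨fun n => (natDegree_add_le _ _).trans (max_le (hf.natDegree_le n) (hg.natDegree_le n)),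
    fun j c h1 h2 hc x y => by
    rw [rep_add]
    refine ((hf.hasSum j c h1 h2 hc x y).add (hg.hasSum j c h1 h2 hc x y)).congr_fun fun n => ?_
    rw [Pi.add_apply, homEval_add, mul_add]⟩

lemma smul (a : ℂ) (hf : HasExpansion f p) : HasExpansion (a • f) (a • p) :=
  ⟨fun n => (natDegree_smul_le _ _).trans (hf.natDegree_le n), fun j c h1 h2 hc x y => by
    rw [rep_smul]
    refine ((hf.hasSum j c h1 h2 hc x y).mul_left a).congr_fun fun n => ?_
    rw [Pi.smul_apply, homEval_smul]
    ring⟩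

lemma sub (hf : HasExpansion f p) (hg : HasExpansion g q) : HasExpansion (f - g) (p - q) := by
  rw [show f - g = f + (-1 : ℂ) • g by module, show p - q = p + (-1 : ℂ) • q by module]
  exact hf.add (hg.smul (-1))

lemma eq (hf : HasExpansion f p) (hg : HasExpansion g p) : f = g := by
  refine sections_ext_rep fun j c hc w => ?_
  have hcont : ∀ f : sections (ℂ × ℂ) m U, ContinuousOn (fun c => rep j f c w)
      {c | param j c ∈ U} := fun f => (differentiableOn_rep j f).continuousOn.comp
    (f := fun c : ℂ × ℂ => (c, w)) (by fun_prop) fun c hc => hc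
  have hdense : Dense {c : ℂ × ℂ | c.1 ≠ 0 ∧ c.2 ≠ 0} :=
    (dense_compl_singleton (0 : ℂ)).prod (dense_compl_singleton (0 : ℂ))
  have htorus : EqOn (fun c => rep j f c w) (fun c => rep j g c w)
      ({c | param j c ∈ U} ∩ {c : ℂ × ℂ | c.1 ≠ 0 ∧ c.2 ≠ 0}) := fun d ⟨hdU, h1, h2⟩ => by
    have hw : w = (d.1 * (w.1 / d.1), d.2 * (w.2 / d.2)) := by
      rw [mul_div_cancel₀ _ h1, mul_div_cancel₀ _ h2]
    simp only
    rw [hw]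
    exact (hf.hasSum j d h1 h2 hdU _ _).unique (hg.hasSum j d h1 h2 hdU _ _)
  exact htorus.of_subset_closure (hcont f) (hcont g) inter_subset_left
    (hdense.open_subset_closure_inter (isOpen_preimage_param j U)) hc

lemma hasSum_eval (hf : HasExpansion f p) (j : Fin 3) {c : ℂ × ℂ} (h1 : c.1 ≠ 0) (h2 : c.2 ≠ 0)
    (hc : param j c ∈ U) (t : ℂ) : HasSum (fun n => mon (wt j n) c * (p n).eval t)
      (rep j f c (c.1 * (t + 1 - (j : ℕ)), c.2 * ((j : ℕ) - t))) := by
  refine (hf.hasSum j c h1 h2 hc _ _).congr_fun fun n => ?_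
  rw [show t + 1 - (j : ℕ) + ((j : ℕ) - t) = (1 : ℂ) by ring,
    show (j : ℕ) * (t + 1 - (j : ℕ)) + ((j : ℕ) - 1) * ((j : ℕ) - t) = t by ring,
    homEval_one (hf.natDegree_le n)]

lemma summable (hf : HasExpansion f p) (j : Fin 3) {c : ℂ × ℂ} (h1 : c.1 ≠ 0) (h2 : c.2 ≠ 0)
    (hc : param j c ∈ U) : Summable fun n => ‖mon (wt j n) c‖ * coeffNorm m (p n) := by
  obtain ⟨l, hl⟩ := exists_coeff_eq_sum_eval m
  simp only [coeffNorm, Finset.mul_sum]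
  refine summable_sum fun k _ => ?_
  have hcoeff : Summable fun n => mon (wt j n) c * (p n).coeff k := by
    have hsum : Summable fun n => ∑ t ∈ Finset.range (m + 1),
        l k t * (mon (wt j n) c * (p n).eval (t : ℂ)) :=
      summable_sum fun t _ => (hf.hasSum_eval j h1 h2 hc t).summable.mul_left _
    refine hsum.congr fun n => ?_
    rw [hl (p n) (hf.natDegree_le n), Finset.mul_sum]
    exact Finset.sum_congr rfl fun t _ => by ring
  simpa only [norm_mul] using hcoeff.norm

lemma coeff_unique (hf : HasExpansion f p) (hg : HasExpansion f q) {s : ℂ × ℂ} (h1 : s.1 ≠ 0)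
    (h2 : s.2 ≠ 0) (hs : ∀ z, param 1 (rotate s z) ∈ U) : p = q := by
  funext n
  refine Polynomial.funext fun t => ?_
  have hasSum_eval : ∀ r : ℤ × ℤ → ℂ[X], HasExpansion f r → ∀ z,
      HasSum (fun k => (r ((wt 1).symm k)).eval t * mon k (rotate s z))
        (rep 1 f (rotate s z) ((rotate s z).1 * (t + 1 - ((1 : Fin 3) : ℕ)),
          (rotate s z).2 * (((1 : Fin 3) : ℕ) - t))) := fun r hr z => by
    rw [← (wt 1).hasSum_iff]
    refine (hr.hasSum_eval 1 (rotate_fst_ne_zero h1 z) (rotate_snd_ne_zero h2 z) (hs z)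
      t).congr_fun fun n => ?_
    rw [Function.comp_apply, Equiv.symm_apply_apply, mul_comm]
  have hunique := congrFun (Laurent.coeff_unique (g := fun c => rep 1 f c
    (c.1 * (t + 1 - ((1 : Fin 3) : ℕ)), c.2 * (((1 : Fin 3) : ℕ) - t))) h1 h2
    (hasSum_eval p hf) (hasSum_eval q hg)) (wt 1 n)
  rwa [Equiv.symm_apply_apply] at hunique

lemma hasSum_chartCoeff (hf : HasExpansion f p) (j : Fin 3) {F : ℕ → ℂ × ℂ → ℂ}
    {c : ℂ × ℂ} (h1 : c.1 ≠ 0) (h2 : c.2 ≠ 0) (hc : param j c ∈ U)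
    (hF : ∀ w : ℂ × ℂ,
      rep j f c w = ∑ i ∈ Finset.range (m + 1), F i c * (w.1 ^ i * w.2 ^ (m - i)))
    {i : ℕ} (hi : i ≤ m) :
    HasSum (fun n => chartCoeff m (j : ℕ) i (p n) * mon (wt j n) c)
      (F i c * (c.1 ^ i * c.2 ^ (m - i))) := by
  obtain ⟨l, hl⟩ := exists_coeff_eq_sum_eval m
  set P : ℂ[X] := ∑ i ∈ Finset.range (m + 1), monomial i (F i c * (c.1 ^ i * c.2 ^ (m - i)))
    with hP
  have hdeg : P.natDegree ≤ m := natDegree_sum_le_of_forall_le (Finset.range (m + 1))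
    (fun i => monomial i (F i c * (c.1 ^ i * c.2 ^ (m - i)))) fun i hi =>
    (natDegree_monomial_le _).trans (Finset.mem_range_succ_iff.mp hi)
  have heval : ∀ t : ℂ, P.eval t = rep j f c (c.1 * t, c.2 * 1) := fun t => by
    rw [hF, hP]
    simp only [eval_finsetSum, eval_monomial, mul_one, mul_pow]
    exact Finset.sum_congr rfl fun i _ => by ring
  have hcoeff : P.coeff i = F i c * (c.1 ^ i * c.2 ^ (m - i)) := by
    rw [hP]
    simp only [finsetSum_coeff, coeff_monomial]
    rw [Finset.sum_ite_eq' _ i, if_pos (Finset.mem_range_succ_iff.mpr hi)]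
  rw [← hcoeff, hl P hdeg i]
  simp only [heval]
  refine (hasSum_sum fun (t : ℕ) _ => (hf.hasSum j c h1 h2 hc (t : ℂ) 1).mul_left
    (l i t)).congr_fun fun n => ?_
  rw [chartCoeff_apply, hl _ (natDegree_chartForm_le _ _ _), Finset.sum_mul]
  refine Finset.sum_congr rfl fun t _ => ?_
  rw [← homEval_one (natDegree_chartForm_le _ _ _), homEval_chartForm, Int.cast_natCast]
  ring

lemma exists_norm_chartCoeff_le (hf : HasExpansion f p) (j : Fin 3) {K : Set (ℂ × ℂ)}
    (hK : IsCompact K) (hKU : ∀ c ∈ K, param j c ∈ U) {i : ℕ} (hi : i ≤ m) :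
    ∃ M, ∀ s : ℂ × ℂ, s.1 ≠ 0 → s.2 ≠ 0 → (∀ z, rotate s z ∈ K) → ∀ n,
      ‖chartCoeff m (j : ℕ) i (p n)‖ * (‖s.1‖ ^ (wt j n).1 * ‖s.2‖ ^ (wt j n).2) ≤
        M * (‖s.1‖ ^ i * ‖s.2‖ ^ (m - i)) := by
  obtain ⟨F, hF, hFf⟩ := exists_coeff j f
  obtain ⟨M, hM⟩ := hK.exists_bound_of_continuousOn ((hF i).continuousOn.mono hKU)
  refine ⟨M, fun s h1 h2 hs n => ?_⟩
  have hbound := norm_coeff_mul_mon_le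
    (a := fun k => chartCoeff m (j : ℕ) i (p ((wt j).symm k))) (s := s)
    (g := fun c => F i c * (c.1 ^ i * c.2 ^ (m - i))) (M := M * (‖s.1‖ ^ i * ‖s.2‖ ^ (m - i)))
    (fun z => ?_) (fun z => ?_) (wt j n)
  · rwa [Equiv.symm_apply_apply, norm_mul, norm_mon] at hbound
  · rw [← (wt j).hasSum_iff]
    refine (hf.hasSum_chartCoeff j (rotate_fst_ne_zero h1 z) (rotate_snd_ne_zero h2 z)
      (hKU _ (hs z)) (hFf _ (hKU _ (hs z))) hi).congr_fun fun n => ?_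
    rw [Function.comp_apply, Equiv.symm_apply_apply]
  · rw [norm_mul, norm_mul, norm_pow, norm_pow, norm_rotate_fst, norm_rotate_snd]
    exact mul_le_mul_of_nonneg_right (hM _ (hs z)) (by positivity)

end HasExpansion

lemma eq_zero_of_forall_mul_zpow_le {a M r₀ : ℝ} (ha : 0 ≤ a) (hr₀ : 0 < r₀) {k : ℤ} {i : ℕ}
    (hk : k < i) (h : ∀ r, 0 < r → r ≤ r₀ → a * r ^ k ≤ M * r ^ i) : a = 0 := by
  have hlim : Tendsto (fun r : ℝ => M * r ^ (i - k).toNat) (𝓝[>] 0) (𝓝 0) := by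
    have hcont : Continuous fun r : ℝ => M * r ^ (i - k).toNat := by fun_prop
    have hpos : (i - k).toNat ≠ 0 := by omega
    simpa only [zero_pow hpos, mul_zero] using
      (hcont.tendsto 0).mono_left (nhdsWithin_le_nhds (s := Ioi 0))
  refine le_antisymm (ge_of_tendsto hlim ?_) ha
  filter_upwards [Ioc_mem_nhdsGT hr₀] with r hr
  refine le_of_mul_le_mul_right ?_ (zpow_pos hr.1 k)
  rw [mul_assoc, ← zpow_natCast r, ← zpow_add₀ hr.1.ne',
    show ((i - k).toNat : ℤ) + k = i by omega, zpow_natCast]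
  exact h r hr.1 hr.2

namespace HasExpansion

variable {f : sections (ℂ × ℂ) m U} {p : ℤ × ℤ → ℂ[X]} {ρ₁ ρ₂ : ℝ}

lemma mem_reg (hf : HasExpansion f p) (j : Fin 3) (h1 : 0 < ρ₁) (h2 : 0 < ρ₂)
    (hU : ∀ c : ℂ × ℂ, ‖c.1‖ ≤ ρ₁ → ‖c.2‖ = ρ₂ → param j c ∈ U) (n : ℤ × ℤ) :
    p n ∈ reg m n (j : ℕ) := by
  refine (mem_reg_iff_chartCoeff (hf.natDegree_le n)).mpr fun i hmi hlt => ?_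
  obtain ⟨M, hM⟩ := hf.exists_norm_chartCoeff_le j
    ((isCompact_closedBall (0 : ℂ) ρ₁).prod (isCompact_sphere (0 : ℂ) ρ₂))
    (fun c hc => hU c (mem_closedBall_zero_iff.mp hc.1) (mem_sphere_zero_iff_norm.mp hc.2)) hmi
  have hpos : 0 < ρ₂ ^ (wt j n).2 := zpow_pos h2 _
  refine norm_eq_zero.mp ((mul_eq_zero_iff_right hpos.ne').mp
    (eq_zero_of_forall_mul_zpow_le (M := M * ρ₂ ^ (m - i)) (by positivity) h1 hlt
      fun r hr hrρ => ?_))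
  have hs1 : ‖(r : ℂ)‖ = r := Complex.norm_of_nonneg hr.le
  have hs2 : ‖(ρ₂ : ℂ)‖ = ρ₂ := Complex.norm_of_nonneg h2.le
  have hbound := hM ((r : ℂ), (ρ₂ : ℂ)) (Complex.ofReal_ne_zero.mpr hr.ne')
    (Complex.ofReal_ne_zero.mpr h2.ne') (fun z => ⟨mem_closedBall_zero_iff.mpr (by
      rwa [norm_rotate_fst, hs1]), mem_sphere_zero_iff_norm.mpr (by rw [norm_rotate_snd, hs2])⟩) n
  rw [hs1, hs2] at hbound
  linarith

lemma mem_reg_sub_one (hf : HasExpansion f p) (j : Fin 3) (h1 : 0 < ρ₁) (h2 : 0 < ρ₂)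
    (hU : ∀ c : ℂ × ℂ, ‖c.1‖ = ρ₁ → ‖c.2‖ ≤ ρ₂ → param j c ∈ U) (n : ℤ × ℤ) :
    p n ∈ reg m n ((j : ℕ) - 1) := by
  refine (mem_reg_sub_one_iff_chartCoeff (hf.natDegree_le n)).mpr fun i hmi hlt => ?_
  obtain ⟨M, hM⟩ := hf.exists_norm_chartCoeff_le j
    ((isCompact_sphere (0 : ℂ) ρ₁).prod (isCompact_closedBall (0 : ℂ) ρ₂))
    (fun c hc => hU c (mem_sphere_zero_iff_norm.mp hc.1) (mem_closedBall_zero_iff.mp hc.2)) hmi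
  have hpos : 0 < ρ₁ ^ (wt j n).1 := zpow_pos h1 _
  refine norm_eq_zero.mp ((mul_eq_zero_iff_right hpos.ne').mp
    (eq_zero_of_forall_mul_zpow_le (M := M * ρ₁ ^ i) (by positivity) h2 hlt fun r hr hrρ => ?_))
  have hs1 : ‖(ρ₁ : ℂ)‖ = ρ₁ := Complex.norm_of_nonneg h1.le
  have hs2 : ‖(r : ℂ)‖ = r := Complex.norm_of_nonneg hr.le
  have hbound := hM ((ρ₁ : ℂ), (r : ℂ)) (Complex.ofReal_ne_zero.mpr h1.ne')
    (Complex.ofReal_ne_zero.mpr hr.ne') (fun z => ⟨mem_sphere_zero_iff_norm.mpr (by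
      rw [norm_rotate_fst, hs1]), mem_closedBall_zero_iff.mpr (by rwa [norm_rotate_snd, hs2])⟩) n
  rw [hs1, hs2] at hbound
  linarith

end HasExpansion

/-- The open set with coordinates in `N` in the `j`-th chart. -/
def chartOpen (j : Fin 3) (N : Opens (ℂ × ℂ)) : Opens A2Resolution :=
  ⟨chartDomain j ∩ coord j ⁻¹' N,
    (contMDiffOn_coord j).continuousOn.isOpen_inter_preimage (chartDomain j).isOpen N.isOpen⟩

lemma param_mem_chartOpen {j : Fin 3} {N : Opens (ℂ × ℂ)} {c : ℂ × ℂ} :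
    param j c ∈ chartOpen j N ↔ c ∈ N := by
  change (param j c ∈ chartDomain j ∧ coord j (param j c) ∈ N) ↔ c ∈ N
  rw [coord_param]
  exact and_iff_right (param_mem_chartDomain j c)

lemma chartOpen_le (j : Fin 3) (N : Opens (ℂ × ℂ)) : chartOpen j N ≤ chartDomain j :=
  fun _ h => h.1

lemma exists_hasExpansion_of_local {p : ℤ × ℤ → ℂ[X]} (hp : ∀ n, (p n).natDegree ≤ m)
    (h : ∀ q ∈ U, ∃ N : Opens A2Resolution, q ∈ N ∧ ∃ g : sections (ℂ × ℂ) m N,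
      HasExpansion g p) : ∃ f : sections (ℂ × ℂ) m U, HasExpansion f p := by
  classical
  choose! N hN g hg using h
  have agree : ∀ q ∈ U, ∀ q' ∈ U, ∀ v : TangentBundle 𝓘(ℂ, ℂ × ℂ) A2Resolution,
      v.proj ∈ N q → v.proj ∈ N q' → extend (g q) v = extend (g q') v := by
    intro q hq q' hq' v hv hv'
    have hglue := ((hg q hq).restrict (V := N q ⊓ N q') inf_le_left).eq
      ((hg q' hq').restrict (V := N q ⊓ N q') inf_le_right)
    rw [← extend_restrict (inf_le_left : N q ⊓ N q' ≤ N q) (g q) (v := v) ⟨hv, hv'⟩, hglue,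
      extend_restrict (inf_le_right : N q ⊓ N q' ≤ N q') (g q') (v := v) ⟨hv, hv'⟩]
  let F : TangentBundle 𝓘(ℂ, ℂ × ℂ) A2Resolution → ℂ := fun v => extend (g v.proj) v
  have hF : ∀ q ∈ U, ∀ v : TangentBundle 𝓘(ℂ, ℂ × ℂ) A2Resolution,
      v.proj ∈ N q → v.proj ∈ U → F v = extend (g q) v := fun q hq v hv hU =>
    agree _ hU q hq v (hN _ hU) hv
  refine ⟨⟨fun v => F v, mem_sections_of_local fun q hq => ⟨N q, hN q hq, g q, hF q hq⟩⟩,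
    hp, fun j c h1 h2 hc x y => ?_⟩
  rw [rep, extend_of_mem _ (v := tangentVec j (c, (c.1 * x, c.2 * y))) hc]
  exact (hg _ hc).hasSum j c h1 h2 (hN _ hc) x y

lemma exists_glue {A B W : Opens A2Resolution} (hW : W ≤ A ⊔ B) (hA : A ≤ W)
    (f : sections (ℂ × ℂ) m A) (g : sections (ℂ × ℂ) m B)
    (h : restrict (ℂ × ℂ) m (inf_le_left : A ⊓ B ≤ A) f =
      restrict (ℂ × ℂ) m (inf_le_right : A ⊓ B ≤ B) g) :
    ∃ F : sections (ℂ × ℂ) m W, restrict (ℂ × ℂ) m hA F = f := by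
  classical
  let F : TangentBundle 𝓘(ℂ, ℂ × ℂ) A2Resolution → ℂ := fun v =>
    if v.proj ∈ A then extend f v else extend g v
  have hFA : ∀ v : TangentBundle 𝓘(ℂ, ℂ × ℂ) A2Resolution, v.proj ∈ A → F v = extend f v :=
    fun v hv => if_pos hv
  have hFB : ∀ v : TangentBundle 𝓘(ℂ, ℂ × ℂ) A2Resolution, v.proj ∈ B → F v = extend g v := by
    intro v hv
    by_cases hA : v.proj ∈ A
    · rw [hFA v hA, ← extend_restrict (inf_le_left : A ⊓ B ≤ A) f (v := v) ⟨hA, hv⟩, h,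
        extend_restrict (inf_le_right : A ⊓ B ≤ B) g (v := v) ⟨hA, hv⟩]
    · exact if_neg hA
  refine ⟨⟨fun v => F v, mem_sections_of_local fun q hq => ?_⟩, Subtype.ext (funext fun v => ?_)⟩
  · rcases hW hq with h | h
    · exact ⟨A, h, f, fun v hv _ => hFA v hv⟩
    · exact ⟨B, h, g, fun v hv _ => hFB v hv⟩
  · exact (hFA v.1 v.2).trans (extend_apply f v)

/-- The term of weight `n` of the `i`-th coefficient in the `j`-th chart, if `p` is the form of
weight `n`. The shift of the exponents passes from the logarithmic frame to the coordinate frame. -/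
def laurentTerm (m : ℕ) (j : Fin 3) (i : ℕ) (n : ℤ × ℤ) (p : ℂ[X]) (c : ℂ × ℂ) : ℂ :=
  chartCoeff m (j : ℕ) i p * mon (wt j n - ((i : ℤ), ((m - i : ℕ) : ℤ))) c

section LaurentTerm

variable {j : Fin 3} {n : ℤ × ℤ} {p : ℂ[X]} {i : ℕ} {c c₀ : ℂ × ℂ}

lemma sum_laurentTerm (h1 : c.1 ≠ 0) (h2 : c.2 ≠ 0) (x y : ℂ) :
    ∑ i ∈ Finset.range (m + 1), laurentTerm m j i n p c * ((c.1 * x) ^ i * (c.2 * y) ^ (m - i)) =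
      mon (wt j n) c * homEval m p (x + y) ((j : ℕ) * x + ((j : ℕ) - 1) * y) := by
  have hform := homEval_eq_sum_chartCoeff m (j : ℕ) p x y
  rw [Int.cast_natCast] at hform
  rw [hform, Finset.mul_sum]
  refine Finset.sum_congr rfl fun i _ => ?_
  rw [← mon_sub_mul_mon (wt j n) ((i : ℤ), ((m - i : ℕ) : ℤ)) h1 h2, laurentTerm, mul_pow, mul_pow]
  simp only [mon, zpow_natCast]
  ring

lemma differentiableAt_laurentTerm (hp : p.natDegree ≤ m) (hi : i ≤ m)
    (h1 : c.1 = 0 → p ∈ reg m n (j : ℕ)) (h2 : c.2 = 0 → p ∈ reg m n ((j : ℕ) - 1)) :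
    DifferentiableAt ℂ (laurentTerm m j i n p) c := by
  by_cases hzero : chartCoeff m (j : ℕ) i p = 0
  · have : laurentTerm m j i n p = fun _ => 0 := funext fun c => by
      rw [laurentTerm, hzero, zero_mul]
    exact this ▸ differentiableAt_const 0
  · have hfst : c.1 ≠ 0 ∨ 0 ≤ (wt j n).1 - i := by
      by_contra! h
      exact hzero ((mem_reg_iff_chartCoeff hp).mp (h1 h.1) i hi (by omega))
    have hsnd : c.2 ≠ 0 ∨ 0 ≤ (wt j n).2 - (m - i : ℕ) := by
      by_contra! h
      exact hzero ((mem_reg_sub_one_iff_chartCoeff hp).mp (h2 h.1) i hi (by omega))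
    unfold laurentTerm mon
    exact ((differentiableAt_fst.zpow hfst).mul (differentiableAt_snd.zpow hsnd)).const_mul _

lemma norm_mon_le_of_nonneg {k : ℤ × ℤ} (hk1 : 0 ≤ k.1) (hk2 : 0 ≤ k.2) (h1 : ‖c.1‖ ≤ ‖c₀.1‖)
    (h2 : ‖c.2‖ ≤ ‖c₀.2‖) : ‖mon k c‖ ≤ ‖mon k c₀‖ := by
  rw [norm_mon, norm_mon]
  exact mul_le_mul (zpow_le_zpow_left₀ hk1 (norm_nonneg _) h1)
    (zpow_le_zpow_left₀ hk2 (norm_nonneg _) h2) (by positivity) (by positivity)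

lemma exists_norm_laurentTerm_le (j : Fin 3) (hi : i ≤ m) (h1 : c₀.1 ≠ 0) (h2 : c₀.2 ≠ 0) :
    ∃ K, 0 ≤ K ∧ ∀ n (p : ℂ[X]), p ∈ reg m n (j : ℕ) → p ∈ reg m n ((j : ℕ) - 1) →
      ∀ c : ℂ × ℂ, ‖c.1‖ ≤ ‖c₀.1‖ → ‖c.2‖ ≤ ‖c₀.2‖ →
        ‖laurentTerm m j i n p c‖ ≤ K * (‖mon (wt j n) c₀‖ * coeffNorm m p) := by
  obtain ⟨K, hK0, hK⟩ := exists_norm_le_mul_coeffNorm m (chartCoeff m (j : ℕ) i)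
  refine ⟨K * ‖mon ((i : ℤ), ((m - i : ℕ) : ℤ)) c₀‖⁻¹, by positivity,
    fun n p hp1 hp2 c hc1 hc2 => ?_⟩
  have hnorm := coeffNorm_nonneg m p
  by_cases hzero : chartCoeff m (j : ℕ) i p = 0
  · rw [laurentTerm, hzero, zero_mul, norm_zero]
    positivity
  have hfst : (i : ℤ) ≤ (wt j n).1 := by
    by_contra! h
    exact hzero ((mem_reg_iff_chartCoeff hp1.1).mp hp1 i hi h)
  have hsnd : ((m - i : ℕ) : ℤ) ≤ (wt j n).2 := by
    by_contra! h
    exact hzero ((mem_reg_sub_one_iff_chartCoeff hp1.1).mp hp2 i hi h)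
  have hmon := norm_mon_le_of_nonneg (k := wt j n - ((i : ℤ), ((m - i : ℕ) : ℤ)))
    (sub_nonneg.mpr hfst) (sub_nonneg.mpr hsnd) hc1 hc2
  have hne : ‖mon ((i : ℤ), ((m - i : ℕ) : ℤ)) c₀‖ ≠ 0 := norm_ne_zero_iff.mpr (mon_ne_zero _ h1 h2)
  rw [laurentTerm, norm_mul]
  calc _ ≤ (K * coeffNorm m p) * ‖mon (wt j n - ((i : ℤ), ((m - i : ℕ) : ℤ))) c₀‖ :=
        mul_le_mul (hK _ hp1.1) hmon (norm_nonneg _) (by positivity)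
    _ = _ := by
      rw [← mon_sub_mul_mon (wt j n) ((i : ℤ), ((m - i : ℕ) : ℤ)) h1 h2, norm_mul]
      field_simp

end LaurentTerm

lemma exists_hasExpansion_chartOpen (j : Fin 3) (N : Opens (ℂ × ℂ)) {p : ℤ × ℤ → ℂ[X]}
    (hp : ∀ n, (p n).natDegree ≤ m) (h1 : ∀ c ∈ N, c.1 = 0 → ∀ n, p n ∈ reg m n (j : ℕ))
    (h2 : ∀ c ∈ N, c.2 = 0 → ∀ n, p n ∈ reg m n ((j : ℕ) - 1))
    (hbound : ∀ i ≤ m, ∃ u : ℤ × ℤ → ℝ, Summable u ∧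
      ∀ n, ∀ c ∈ N, ‖laurentTerm m j i n (p n) c‖ ≤ u n) :
    ∃ f : sections (ℂ × ℂ) m (chartOpen j N), HasExpansion f p := by
  have hdiff : ∀ i ≤ m, DifferentiableOn ℂ (fun c => ∑' n, laurentTerm m j i n (p n) c)
      {c | param j c ∈ chartOpen j N} := fun i hi => by
    obtain ⟨u, hu, hbu⟩ := hbound i hi
    rw [show {c | param j c ∈ chartOpen j N} = N from ext fun c => param_mem_chartOpen]
    exact differentiableOn_tsum N.isOpen hu (fun n c hc => (differentiableAt_laurentTerm (hp n) hi
      (fun h => h1 c hc h n) (fun h => h2 c hc h n)).differentiableWithinAt) hbu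
  obtain ⟨f, hf⟩ := exists_section m j (chartOpen_le j N) _ hdiff
  refine ⟨f, .of_chart j hp fun c hc1 hc2 hc x y => ?_⟩
  rw [hf c _ hc]
  simp only [← sum_laurentTerm hc1 hc2]
  refine hasSum_sum fun i hi => ?_
  obtain ⟨u, hu, hbu⟩ := hbound i (Finset.mem_range_succ_iff.mp hi)
  exact (Summable.of_norm_bounded hu fun n =>
    hbu n c (param_mem_chartOpen.mp hc)).hasSum.mul_right _

/-- The open bidisc centred at the origin whose radii are the absolute values of the coordinates
of `c₀`. -/
def bidisc (c₀ : ℂ × ℂ) : Opens (ℂ × ℂ) :=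
  ⟨Metric.ball 0 ‖c₀.1‖ ×ˢ Metric.ball 0 ‖c₀.2‖, Metric.isOpen_ball.prod Metric.isOpen_ball⟩

lemma mem_bidisc {c₀ c : ℂ × ℂ} : c ∈ bidisc c₀ ↔ ‖c.1‖ < ‖c₀.1‖ ∧ ‖c.2‖ < ‖c₀.2‖ := by
  rw [← mem_ball_zero_iff, ← mem_ball_zero_iff (a := c.2)]
  rfl

lemma exists_hasExpansion_bidisc (j : Fin 3) {p : ℤ × ℤ → ℂ[X]}
    (h1 : ∀ n, p n ∈ reg m n (j : ℕ)) (h2 : ∀ n, p n ∈ reg m n ((j : ℕ) - 1)) {c₀ : ℂ × ℂ}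
    (hc₀1 : c₀.1 ≠ 0) (hc₀2 : c₀.2 ≠ 0)
    (hs : Summable fun n => ‖mon (wt j n) c₀‖ * coeffNorm m (p n)) :
    ∃ f : sections (ℂ × ℂ) m (chartOpen j (bidisc c₀)), HasExpansion f p := by
  refine exists_hasExpansion_chartOpen j _ (fun n => (h1 n).1) (fun c _ _ => h1)
    (fun c _ _ => h2) fun i hi => ?_
  obtain ⟨K, -, hK⟩ := exists_norm_laurentTerm_le j hi hc₀1 hc₀2
  refine ⟨_, hs.mul_left K, fun n c hc => ?_⟩
  obtain ⟨hc1, hc2⟩ := mem_bidisc.mp hc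
  exact hK n (p n) (h1 n) (h2 n) c hc1.le hc2.le

lemma exists_hasExpansion_of_summable {p : ℤ × ℤ → ℂ[X]} (hp : ∀ n, (p n).natDegree ≤ m)
    (h : ∀ q ∈ U, ∃ j : Fin 3, q ∈ chartDomain j ∧
      (∀ n, p n ∈ reg m n ((j : ℕ) - 1) ⊓ reg m n (j : ℕ)) ∧
      ∃ c₀ : ℂ × ℂ, ‖(coord j q).1‖ < ‖c₀.1‖ ∧ ‖(coord j q).2‖ < ‖c₀.2‖ ∧
        Summable fun n => ‖mon (wt j n) c₀‖ * coeffNorm m (p n)) :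
    ∃ f : sections (ℂ × ℂ) m U, HasExpansion f p := by
  refine exists_hasExpansion_of_local hp fun q hq => ?_
  obtain ⟨j, hqj, hreg, c₀, hlt1, hlt2, hsum⟩ := h q hq
  obtain ⟨g, hg⟩ := exists_hasExpansion_bidisc j (fun n => (hreg n).2) (fun n => (hreg n).1)
    (norm_pos_iff.mp ((norm_nonneg _).trans_lt hlt1))
    (norm_pos_iff.mp ((norm_nonneg _).trans_lt hlt2)) hsum
  exact ⟨chartOpen j (bidisc c₀), ⟨hqj, mem_bidisc.mpr ⟨hlt1, hlt2⟩⟩, g, hg⟩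

lemma exists_hasExpansion_of_finite {p : ℤ × ℤ → ℂ[X]} (hp : ∀ n, (p n).natDegree ≤ m)
    (hfin : {n | p n ≠ 0}.Finite)
    (h1 : ∀ (j : Fin 3) (c : ℂ × ℂ), param j c ∈ U → c.1 = 0 → ∀ n, p n ∈ reg m n (j : ℕ))
    (h2 : ∀ (j : Fin 3) (c : ℂ × ℂ), param j c ∈ U → c.2 = 0 → ∀ n, p n ∈ reg m n ((j : ℕ) - 1)) :
    ∃ f : sections (ℂ × ℂ) m U, HasExpansion f p := by
  refine exists_hasExpansion_of_local hp fun q hq => ?_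
  obtain ⟨j, hj⟩ := exists_rep_ne_zero q
  set c := coord j q
  have hcq : param j c = q := param_coord j q hj
  have hcU : param j c ∈ U := by rwa [hcq]
  have hlocal : ∀ i ∈ Finset.range (m + 1), ∀ n, ∀ᶠ d in 𝓝 c,
      ‖laurentTerm m j i n (p n) d‖ ≤ ‖laurentTerm m j i n (p n) c‖ + 1 := fun i hi n =>
    ((differentiableAt_laurentTerm (hp n) (Finset.mem_range_succ_iff.mp hi)
      (fun h => h1 j c hcU h n) fun h => h2 j c hcU h n).continuousAt.norm.eventually
      (gt_mem_nhds (lt_add_one _))).mono fun d hd => hd.le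
  have hev : ∀ᶠ d in 𝓝 c, param j d ∈ U ∧ ∀ i ∈ Finset.range (m + 1), ∀ n ∈ {n | p n ≠ 0},
      ‖laurentTerm m j i n (p n) d‖ ≤ ‖laurentTerm m j i n (p n) c‖ + 1 :=
    Filter.Eventually.and ((isOpen_preimage_param j U).mem_nhds hcU) <|
      (Filter.eventually_all_finset _).mpr fun i hi =>
        (Filter.eventually_all_finite hfin).mpr fun n _ => hlocal i hi n
  obtain ⟨N, hN, hNo, hcN⟩ := eventually_nhds_iff.mp hev
  refine ⟨chartOpen j ⟨N, hNo⟩, hcq ▸ param_mem_chartOpen.mpr hcN,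
    exists_hasExpansion_chartOpen j ⟨N, hNo⟩ hp (fun d hd => h1 j d (hN d hd).1)
      (fun d hd => h2 j d (hN d hd).1) fun i hi => ?_⟩
  classical
  refine ⟨fun n => if p n = 0 then 0 else ‖laurentTerm m j i n (p n) c‖ + 1,
    summable_of_ne_finset_zero (s := hfin.toFinset) fun n hn => ?_, fun n d hd => ?_⟩
  · exact if_pos (not_not.mp fun h => hn (hfin.mem_toFinset.mpr h))
  · beta_reduce
    split_ifs with h
    · rw [h, laurentTerm, map_zero, zero_mul, norm_zero]
    · exact (hN d hd).2 i (Finset.mem_range_succ_iff.mpr hi) n h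

end A2Resolution

/-! ### The extension quotient -/

section Quotient

variable {K V X ι : Type*} [Field K] [AddCommGroup V] [Module K V] [AddCommGroup X] [Module K X]

lemma finrank_quotient_eq_sum (R : Submodule K V) (A B : ι → Submodule K X)
    [∀ n, FiniteDimensional K (A n)] (hBA : ∀ n, B n ≤ A n) (L : V →ₗ[K] ι → X) (S : Finset ι)
    (hA : ∀ f n, L f n ∈ A n) (hR : ∀ f, f ∈ R ↔ ∀ n, L f n ∈ B n) (hS : ∀ n ∉ S, A n ≤ B n)
    (hL : ∀ a : ι → X, (∀ n, a n ∈ A n) → (∀ n ∉ S, a n = 0) → ∃ f, L f = a) :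
    FiniteDimensional K (V ⧸ R) ∧ Module.finrank K (V ⧸ R) =
      ∑ n ∈ S, (Module.finrank K (A n) - Module.finrank K (B n)) := by
  classical
  let Ψ : V →ₗ[K] ∀ n : S, (A n ⧸ (B n).submoduleOf (A n)) := LinearMap.pi fun n =>
    ((B n).submoduleOf (A n)).mkQ ∘ₗ
      ((LinearMap.proj (R := K) (φ := fun _ : ι => X) n.1 ∘ₗ L).codRestrict (A n) fun f => hA f n)
  have hΨ : ∀ f (n : S), Ψ f n = 0 ↔ L f n ∈ B n := fun f n =>
    (Submodule.Quotient.mk_eq_zero _).trans Iff.rfl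
  have hker : LinearMap.ker Ψ = R := by
    ext f
    rw [hR, LinearMap.mem_ker, funext_iff]
    refine ⟨fun h n => ?_, fun h n => (hΨ f n).mpr (h n)⟩
    by_cases hn : n ∈ S
    · exact (hΨ f ⟨n, hn⟩).mp (h ⟨n, hn⟩)
    · exact hS n hn (hA f n)
  have hsurj : Function.Surjective Ψ := by
    intro b
    choose a ha using fun n : S => Submodule.mkQ_surjective _ (b n)
    obtain ⟨f, hf⟩ := hL (fun n => if h : n ∈ S then (a ⟨n, h⟩ : X) else 0)
      (fun n => by
        split_ifs
        exacts [Subtype.prop _, zero_mem _])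
      fun n hn => dif_neg hn
    refine ⟨f, funext fun n => (congrArg (Submodule.mkQ _) (Subtype.ext ?_)).trans (ha n)⟩
    exact (congrFun hf n).trans (dif_pos n.2)
  have e := (Submodule.quotEquivOfEq _ _ hker.symm).trans (Ψ.quotKerEquivOfSurjective hsurj)
  refine ⟨e.symm.finiteDimensional, ?_⟩
  rw [e.finrank_eq, Module.finrank_pi_fintype, ← Finset.sum_coe_sort S]
  refine Finset.sum_congr rfl fun n _ => ?_
  rw [Submodule.finrank_quotient, (Submodule.submoduleOfEquivOfLe (hBA n)).finrank_eq]

end Quotient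

namespace A2Resolution

open SymmetricDifferential Laurent BinaryForm Polynomial

variable {m : ℕ} {U : Opens A2Resolution} {ε : ℝ}

/-- The open sets that meet the torus, in the coordinates of the middle chart, in a non-empty
complete Reinhardt domain; on these every symmetric differential has a unique Laurent expansion. -/
structure IsReinhardt (U : Opens A2Resolution) : Prop where
  isCompleteReinhardt : IsCompleteReinhardt {c : ℂ × ℂ | c.1 ≠ 0 ∧ c.2 ≠ 0 ∧ param 1 c ∈ U}
  nonempty : {c : ℂ × ℂ | c.1 ≠ 0 ∧ c.2 ≠ 0 ∧ param 1 c ∈ U}.Nonempty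

namespace IsReinhardt

lemma of_forall_norm_le (hne : ∃ c : ℂ × ℂ, c.1 ≠ 0 ∧ c.2 ≠ 0 ∧ param 1 c ∈ U)
    (hU : ∀ c d : ℂ × ℂ, param 1 c ∈ U → d.1 ≠ 0 → d.2 ≠ 0 → ‖d.1‖ ≤ ‖c.1‖ → ‖d.2‖ ≤ ‖c.2‖ →
      param 1 d ∈ U) : IsReinhardt U where
  isCompleteReinhardt :=
    { isOpen := (isOpen_ne_fun continuous_fst continuous_const).inter
        ((isOpen_ne_fun continuous_snd continuous_const).inter (isOpen_preimage_param 1 U))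
      ne_zero := fun _ hs => ⟨hs.1, hs.2.1⟩
      mem := fun c hc d hd1 hd2 hle1 hle2 => ⟨hd1, hd2, hU c d hc.2.2 hd1 hd2 hle1 hle2⟩ }
  nonempty := hne

lemma coeff_unique (hU : IsReinhardt U) {f : sections (ℂ × ℂ) m U} {p q : ℤ × ℤ → ℂ[X]}
    (hp : HasExpansion f p) (hq : HasExpansion f q) : p = q := by
  obtain ⟨s, hs⟩ := hU.nonempty
  exact hp.coeff_unique hq hs.1 hs.2.1 fun z => (hU.isCompleteReinhardt.rotate_mem hs z).2.2

/-- The coefficients of the Laurent expansion of a symmetric differential. -/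
def laurent (hU : IsReinhardt U) (m : ℕ) : sections (ℂ × ℂ) m U →ₗ[ℂ] ℤ × ℤ → ℂ[X] where
  toFun f := (exists_hasExpansion f hU.isCompleteReinhardt).choose
  map_add' f g :=
    hU.coeff_unique (exists_hasExpansion (f + g) hU.isCompleteReinhardt).choose_spec
      ((exists_hasExpansion f hU.isCompleteReinhardt).choose_spec.add
        (exists_hasExpansion g hU.isCompleteReinhardt).choose_spec)
  map_smul' a f :=
    hU.coeff_unique (exists_hasExpansion (a • f) hU.isCompleteReinhardt).choose_spec
      ((exists_hasExpansion f hU.isCompleteReinhardt).choose_spec.smul a)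

lemma hasExpansion_laurent (hU : IsReinhardt U) (f : sections (ℂ × ℂ) m U) :
    HasExpansion f (hU.laurent m f) :=
  (exists_hasExpansion f hU.isCompleteReinhardt).choose_spec

lemma laurent_eq (hU : IsReinhardt U) {f : sections (ℂ × ℂ) m U} {p : ℤ × ℤ → ℂ[X]}
    (hf : HasExpansion f p) : hU.laurent m f = p :=
  hU.coeff_unique (hU.hasExpansion_laurent f) hf

end IsReinhardt

lemma norm_pt_param_le (j k : Fin 3) {c d : ℂ × ℂ} (h1 : ‖d.1‖ ≤ ‖c.1‖) (h2 : ‖d.2‖ ≤ ‖c.2‖) :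
    ‖(param j d).pt k‖ ≤ ‖(param j c).pt k‖ := by
  have mul {a a' b b' : ℂ} (ha : ‖a‖ ≤ ‖a'‖) (hb : ‖b‖ ≤ ‖b'‖) : ‖a * b‖ ≤ ‖a' * b'‖ :=
    (norm_mul_le_of_le ha hb).trans_eq (norm_mul _ _).symm
  have cube {a b : ℂ} (h : ‖a‖ ≤ ‖b‖) : ‖a ^ 3‖ ≤ ‖b ^ 3‖ := by
    rw [norm_pow, norm_pow]
    gcongr
  refine mul ?_ ?_
  · fin_cases j
    exacts [h1, mul h1 h2, h2]
  · fin_cases j <;> fin_cases k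
    exacts [le_rfl, h2, mul h1 (cube h2), h1, le_rfl, h2, mul (cube h1) h2, h1, le_rfl]

lemma continuous_pt (k : Fin 3) : Continuous fun q : A2Resolution => q.pt k := by
  refine continuous_iff_continuousAt.mpr fun q => ?_
  obtain ⟨j, hj⟩ := exists_rep_ne_zero q
  have hcoord : ContinuousAt (coord j) q :=
    (contMDiffOn_coord j).continuousOn.continuousAt ((chartDomain j).isOpen.mem_nhds hj)
  have hparam : Continuous fun c => (param j c).pt k :=
    ((contDiff_scale j).mul (contDiff_vec j k)).continuous
  refine (hparam.continuousAt.comp hcoord).congr ?_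
  filter_upwards [(chartDomain j).isOpen.mem_nhds hj] with q' hq'
  rw [Function.comp_apply, param_coord j q' hq']

/-- The preimage of a polydisc around the singular point. -/
def tube (ε : ℝ) : Opens A2Resolution :=
  ⟨{q | ∀ k, ‖q.pt k‖ < ε}, by
    simp only [Set.ofPred_forall]
    exact isOpen_iInter_of_finite fun k => isOpen_lt (continuous_pt k).norm continuous_const⟩

lemma param_mem_tube_of_le {j : Fin 3} {c d : ℂ × ℂ} (h : param j c ∈ tube ε)
    (h1 : ‖d.1‖ ≤ ‖c.1‖) (h2 : ‖d.2‖ ≤ ‖c.2‖) : param j d ∈ tube ε :=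
  fun k => (norm_pt_param_le j k h1 h2).trans_lt (h k)

lemma mem_tube_of_pt_eq_zero (hε : 0 < ε) {q : A2Resolution} (hq : q.pt = 0) : q ∈ tube ε :=
  fun k => by rwa [hq, Pi.zero_apply, norm_zero]

lemma param_mem_regular {j : Fin 3} {c : ℂ × ℂ} : param j c ∈ regular ↔ scale j c ≠ 0 := by
  change scale j c • vec j c ≠ 0 ↔ _
  rw [smul_ne_zero_iff, and_iff_left (vec_ne_zero j c)]

lemma scale_ne_zero (j : Fin 3) {c : ℂ × ℂ} (h1 : c.1 ≠ 0) (h2 : c.2 ≠ 0) : scale j c ≠ 0 := by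
  fin_cases j
  exacts [h1, mul_ne_zero h1 h2, h2]

lemma exists_norm_lt_param_mem_tube {j : Fin 3} {c : ℂ × ℂ} (hc : param j c ∈ tube ε) :
    ∃ d : ℂ × ℂ, ‖c.1‖ < ‖d.1‖ ∧ ‖c.2‖ < ‖d.2‖ ∧ param j d ∈ tube ε := by
  let d : ℝ → ℂ × ℂ := fun t => (((‖c.1‖ + t : ℝ) : ℂ), ((‖c.2‖ + t : ℝ) : ℂ))
  have hcont : Continuous fun t => param j (d t) := (continuous_param j).comp (by fun_prop)
  have h0 : param j (d 0) ∈ tube ε := param_mem_tube_of_le hc (by simp [d]) (by simp [d])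
  have hev : ∀ᶠ t in 𝓝[>] 0, param j (d t) ∈ tube ε :=
    (hcont.continuousAt.eventually ((tube ε).isOpen.mem_nhds h0)).filter_mono nhdsWithin_le_nhds
  obtain ⟨t, ht, ht0⟩ := (hev.and self_mem_nhdsWithin).exists
  have hlt : ∀ z : ℂ, ‖z‖ < ‖((‖z‖ + t : ℝ) : ℂ)‖ := fun z =>
    ((lt_add_of_pos_right _ ht0).trans_le (le_abs_self _)).trans_eq (Complex.norm_real _).symm
  exact ⟨d t, hlt _, hlt _, ht⟩

lemma exists_forall_norm_le_param_mem_tube (hε : 0 < ε) :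
    ∃ δ : ℝ, 0 < δ ∧ ∀ (j : Fin 3) (c : ℂ × ℂ), ‖c.1‖ ≤ δ → ‖c.2‖ ≤ δ → param j c ∈ tube ε := by
  have h0 : ∀ j, param j 0 ∈ tube ε := fun j => mem_tube_of_pt_eq_zero hε <| by
    fin_cases j <;> simp [param, scale]
  choose d hd1 hd2 hd using fun j => exists_norm_lt_param_mem_tube (h0 j)
  obtain ⟨i, hi⟩ := Finite.exists_min fun j => min ‖(d j).1‖ ‖(d j).2‖
  refine ⟨min ‖(d i).1‖ ‖(d i).2‖, lt_min ((norm_nonneg _).trans_lt (hd1 i))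
    ((norm_nonneg _).trans_lt (hd2 i)), fun j c hc1 hc2 => param_mem_tube_of_le (hd j) ?_ ?_⟩
  · exact hc1.trans ((hi j).trans (min_le_left _ _))
  · exact hc2.trans ((hi j).trans (min_le_right _ _))

lemma exists_param_mem_of_norm_scale_lt {W : Opens A2Resolution} (hW : exceptional ⊆ W)
    (j : Fin 3) : ∃ ε : ℝ, 0 < ε ∧ ∀ c : ℂ × ℂ, ‖c.1‖ ≤ 1 → ‖c.2‖ ≤ 1 → ‖scale j c‖ < ε →
      param j c ∈ W := by
  have hcompact : IsCompact ((Metric.closedBall (0 : ℂ) 1 ×ˢ Metric.closedBall (0 : ℂ) 1) ∩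
      {c : ℂ × ℂ | param j c ∈ W}ᶜ) :=
    ((isCompact_closedBall _ _).prod (isCompact_closedBall _ _)).inter_right
      (isOpen_preimage_param j W).isClosed_compl
  obtain ⟨ε, hε, hle⟩ := hcompact.exists_forall_le'
    (contDiff_scale j).continuous.norm.continuousOn (a := 0) fun c hc =>
      norm_pos_iff.mpr fun h0 => hc.2 <| hW <| show scale j c • vec j c = 0 by rw [h0, zero_smul]
  refine ⟨ε, hε, fun c h1 h2 hlt => ?_⟩
  by_contra hcW
  exact hlt.not_ge (hle c ⟨⟨mem_closedBall_zero_iff.mpr h1, mem_closedBall_zero_iff.mpr h2⟩, hcW⟩)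

lemma exists_param_eq_norm_vec_le_one (q : A2Resolution) :
    ∃ (j : Fin 3) (c : ℂ × ℂ), param j c = q ∧ ∀ k, ‖vec j c k‖ ≤ 1 := by
  obtain ⟨j, hj⟩ := Finite.exists_max fun k => ‖q.line.rep k‖
  obtain ⟨k, hk⟩ := exists_rep_ne_zero q
  have hcq : param j (coord j q) = q :=
    param_coord j q (norm_pos_iff.mp ((norm_pos_iff.mpr hk).trans_le (hj k)))
  refine ⟨j, coord j q, hcq, fun k => ?_⟩
  have hratio := ratio_param j j k (coord j q)
  rw [hcq, vec_self, div_one] at hratio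
  rw [← hratio, norm_div]
  exact div_le_one_of_le₀ (hj k) (norm_nonneg _)

lemma pt_param_self (j : Fin 3) (c : ℂ × ℂ) : (param j c).pt j = scale j c := by
  change scale j c * vec j c j = _
  rw [vec_self, mul_one]

lemma norm_le_one_of_norm_scale_le_one {j : Fin 3} {c : ℂ × ℂ} (hs : ‖scale j c‖ ≤ 1)
    (hv : ∀ k, ‖vec j c k‖ ≤ 1) : ‖c.1‖ ≤ 1 ∧ ‖c.2‖ ≤ 1 := by
  fin_cases j
  exacts [⟨hs, hv 1⟩, ⟨hv 0, hv 2⟩, ⟨hv 1, hs⟩]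

lemma exists_tube_le {W : Opens A2Resolution} (hW : exceptional ⊆ W) :
    ∃ ε : ℝ, 0 < ε ∧ tube ε ≤ W := by
  choose ε hε hεW using exists_param_mem_of_norm_scale_lt hW
  obtain ⟨i, hi⟩ := Finite.exists_min ε
  refine ⟨min (ε i) 1, lt_min (hε i) one_pos, fun q hq => ?_⟩
  obtain ⟨j, c, rfl, hvec⟩ := exists_param_eq_norm_vec_le_one q
  have hscale := hq j
  rw [pt_param_self, lt_min_iff] at hscale
  obtain ⟨hc1, hc2⟩ := norm_le_one_of_norm_scale_le_one hscale.2.le hvec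
  exact hεW j c hc1 hc2 (hscale.1.trans_le (hi j))

lemma exists_param_mem_tube_inf_regular (hε : 0 < ε) :
    ∃ c : ℂ × ℂ, c.1 ≠ 0 ∧ c.2 ≠ 0 ∧ param 1 c ∈ tube ε ⊓ regular := by
  obtain ⟨d, hd1, hd2, hd⟩ := exists_norm_lt_param_mem_tube (j := 1) (c := 0)
    (mem_tube_of_pt_eq_zero hε (by simp [param, scale]))
  have h1 : d.1 ≠ 0 := norm_pos_iff.mp ((norm_nonneg _).trans_lt hd1)
  have h2 : d.2 ≠ 0 := norm_pos_iff.mp ((norm_nonneg _).trans_lt hd2)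
  exact ⟨d, h1, h2, hd, param_mem_regular.mpr (scale_ne_zero 1 h1 h2)⟩

lemma isReinhardt_tube (hε : 0 < ε) : IsReinhardt (tube ε) := by
  obtain ⟨c, h1, h2, hc⟩ := exists_param_mem_tube_inf_regular hε
  exact .of_forall_norm_le ⟨c, h1, h2, hc.1⟩ fun _ _ hc _ _ => param_mem_tube_of_le hc

lemma isReinhardt_tube_inf_regular (hε : 0 < ε) : IsReinhardt (tube ε ⊓ regular) :=
  .of_forall_norm_le (exists_param_mem_tube_inf_regular hε) fun _ _ hc h1 h2 hle1 hle2 =>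
    ⟨param_mem_tube_of_le hc.1 hle1 hle2, param_mem_regular.mpr (scale_ne_zero 1 h1 h2)⟩

lemma HasExpansion.mem_reg_of_tube_inf_regular (hε : 0 < ε)
    {f : sections (ℂ × ℂ) m (tube ε ⊓ regular)} {p : ℤ × ℤ → ℂ[X]} (hf : HasExpansion f p)
    (n : ℤ × ℤ) : p n ∈ reg m n (-1) ⊓ reg m n 2 := by
  obtain ⟨δ, hδ, hmem⟩ := exists_forall_norm_le_param_mem_tube hε
  have hne : ∀ {z : ℂ}, ‖z‖ = δ → z ≠ 0 := fun h => norm_pos_iff.mp (hδ.trans_eq h.symm)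
  exact ⟨hf.mem_reg_sub_one 0 hδ hδ (fun c h1 h2 =>
      ⟨hmem 0 c h1.le h2, param_mem_regular.mpr (hne h1)⟩) n,
    hf.mem_reg 2 hδ hδ (fun c h1 h2 => ⟨hmem 2 c h1 h2.le, param_mem_regular.mpr (hne h2)⟩) n⟩

lemma HasExpansion.mem_reg_of_tube (hε : 0 < ε) {f : sections (ℂ × ℂ) m (tube ε)}
    {p : ℤ × ℤ → ℂ[X]} (hf : HasExpansion f p) (n : ℤ × ℤ) : p n ∈ reg m n 0 ⊓ reg m n 1 := by
  obtain ⟨δ, hδ, hmem⟩ := exists_forall_norm_le_param_mem_tube hε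
  exact ⟨hf.mem_reg 0 hδ hδ (fun c h1 h2 => hmem 0 c h1 h2.le) n,
    hf.mem_reg 1 hδ hδ (fun c h1 h2 => hmem 1 c h1 h2.le) n⟩

lemma exists_hasExpansion_tube (hε : 0 < ε) {f : sections (ℂ × ℂ) m (tube ε ⊓ regular)}
    {p : ℤ × ℤ → ℂ[X]} (hf : HasExpansion f p) (hp : ∀ n, p n ∈ reg m n 0 ⊓ reg m n 1) :
    ∃ g : sections (ℂ × ℂ) m (tube ε), HasExpansion g p := by
  refine exists_hasExpansion_of_summable hf.natDegree_le fun q hq => ?_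
  obtain ⟨j, hj⟩ := exists_rep_ne_zero q
  obtain ⟨d, hd1, hd2, hd⟩ := exists_norm_lt_param_mem_tube (ε := ε) (c := coord j q)
    (by rwa [param_coord j q hj])
  have h1 : d.1 ≠ 0 := norm_pos_iff.mp ((norm_nonneg _).trans_lt hd1)
  have h2 : d.2 ≠ 0 := norm_pos_iff.mp ((norm_nonneg _).trans_lt hd2)
  refine ⟨j, hj, fun n => ?_, d, hd1, hd2,
    hf.summable j h1 h2 ⟨hd, param_mem_regular.mpr (scale_ne_zero j h1 h2)⟩⟩
  obtain ⟨hneg, htwo⟩ := hf.mem_reg_of_tube_inf_regular hε n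
  obtain ⟨hzero, hone⟩ := hp n
  fin_cases j
  exacts [⟨hneg, hzero⟩, ⟨hzero, hone⟩, ⟨hone, htwo⟩]

lemma mem_range_restrict_iff {W : Opens A2Resolution} (hε : 0 < ε) (hεW : tube ε ≤ W)
    (f : sections (ℂ × ℂ) m (W ⊓ regular)) :
    f ∈ LinearMap.range (restrict (ℂ × ℂ) m (inf_le_left : W ⊓ regular ≤ W)) ↔
      ∀ n, (isReinhardt_tube_inf_regular hε).laurent m
        (restrict (ℂ × ℂ) m (inf_le_inf_right _ hεW) f) n ∈ reg m n 0 ⊓ reg m n 1 := by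
  constructor
  · rintro ⟨F, rfl⟩ n
    have hF := (isReinhardt_tube hε).hasExpansion_laurent (restrict (ℂ × ℂ) m hεW F)
    have hrestrict := hF.restrict (V := tube ε ⊓ regular) inf_le_left
    have hL := (isReinhardt_tube_inf_regular hε).laurent_eq hrestrict
    exact (congrFun hL n).symm ▸ hF.mem_reg_of_tube hε n
  · intro h
    have hf := (isReinhardt_tube_inf_regular hε).hasExpansion_laurent
      (restrict (ℂ × ℂ) m (inf_le_inf_right regular hεW) f)
    obtain ⟨g, hg⟩ := exists_hasExpansion_tube hε hf h
    have hcover : W ≤ W ⊓ regular ⊔ tube ε := fun q hq =>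
      (em (q ∈ regular)).imp (fun hr => ⟨hq, hr⟩)
        fun hr => mem_tube_of_pt_eq_zero hε (not_not.mp hr)
    have hle : W ⊓ regular ⊓ tube ε ≤ tube ε ⊓ regular := fun q hq => ⟨hq.2, hq.1.2⟩
    exact exists_glue hcover inf_le_left f g ((hf.restrict hle).eq (hg.restrict inf_le_right))

lemma exists_hasExpansion_regular {a : ℤ × ℤ → ℂ[X]}
    (ha : ∀ n, a n ∈ reg m n (-1) ⊓ reg m n 2) (hfin : {n | a n ≠ 0}.Finite) (hU : U ≤ regular) :
    ∃ f : sections (ℂ × ℂ) m U, HasExpansion f a := by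
  refine exists_hasExpansion_of_finite (fun n => (ha n).1.1) hfin (fun j c hc h0 n => ?_)
    fun j c hc h0 n => ?_
  · have hs := param_mem_regular.mp (hU hc)
    fin_cases j
    exacts [absurd h0 hs, absurd (mul_eq_zero_of_left h0 _) hs, (ha n).2]
  · have hs := param_mem_regular.mp (hU hc)
    fin_cases j
    exacts [(ha n).1, absurd (mul_eq_zero_of_right _ h0) hs, absurd h0 hs]

/-- The dimension of the extension quotient in weight `n`. -/
def extDim (m : ℕ) (n : ℤ × ℤ) : ℕ :=
  (m + 1 - (ord m n (-1) + ord m n 2)) -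
    (m + 1 - (ord m n (-1) + ord m n 2 + ord m n 0 + ord m n 1))

/-- A finite set that contains all weights that occur in the cohomology. -/
def weightBox (m : ℕ) : Finset (ℤ × ℤ) :=
  Finset.Icc (-2 * m : ℤ) (3 * m) ×ˢ Finset.Icc (-1 * m : ℤ) (1 * m)

lemma lt_or_lt_of_notMem_weightBox {n : ℤ × ℤ} (h : n ∉ weightBox m) :
    n.1 < -(2 * m) ∨ 3 * m < n.1 ∨ n.2 < -m ∨ m < n.2 := by
  simp only [weightBox, Finset.mem_product, Finset.mem_Icc] at h
  omega

lemma finite_support_of_forall_notMem {ι X : Type*} [Zero X] {S : Finset ι} {a : ι → X}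
    (h : ∀ n ∉ S, a n = 0) : {n | a n ≠ 0}.Finite :=
  S.finite_toSet.subset fun n hn => not_imp_comm.mp (h n) hn

theorem finrank_extensionQuotient {W : Opens A2Resolution} (hW : exceptional ⊆ W) (m : ℕ) :
    FiniteDimensional ℂ (ExtensionQuotient (ℂ × ℂ) m W regular) ∧
      Module.finrank ℂ (ExtensionQuotient (ℂ × ℂ) m W regular) =
        ∑ n ∈ weightBox m, extDim m n := by
  obtain ⟨ε, hε, hεW⟩ := exists_tube_le hW
  have hReinhardt := isReinhardt_tube_inf_regular hε
  let A : ℤ × ℤ → Submodule ℂ ℂ[X] := fun n => reg m n (-1) ⊓ reg m n 2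
  let B : ℤ × ℤ → Submodule ℂ ℂ[X] := fun n => A n ⊓ (reg m n 0 ⊓ reg m n 1)
  let L : sections (ℂ × ℂ) m (W ⊓ regular) →ₗ[ℂ] ℤ × ℤ → ℂ[X] :=
    hReinhardt.laurent m ∘ₗ restrict (ℂ × ℂ) m (inf_le_inf_right regular hεW)
  have hA : ∀ f n, L f n ∈ A n := fun f =>
    (hReinhardt.hasExpansion_laurent _).mem_reg_of_tube_inf_regular hε
  have hAfin : ∀ n, FiniteDimensional ℂ (A n) := fun n =>
    Submodule.finiteDimensional_of_le (S₂ := vanishing m (-1) (ord m n (-1))) inf_le_left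
  have finrank_A : ∀ n, Module.finrank ℂ (A n) = m + 1 - (ord m n (-1) + ord m n 2) := fun n =>
    finrank_vanishing_inf m (by decide) _ _
  have finrank_B : ∀ n, Module.finrank ℂ (B n) =
      m + 1 - (ord m n (-1) + ord m n 2 + ord m n 0 + ord m n 1) := fun n =>
    finrank_vanishing_inf₄ m (by decide) (by decide) (by decide) (by decide) (by decide)
      (by decide) _ _ _ _
  have hS : ∀ n ∉ weightBox m, A n ≤ B n := fun n hn => by
    refine (Submodule.eq_of_le_of_finrank_eq inf_le_left ?_).ge
    have hn := lt_or_lt_of_notMem_weightBox hn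
    rw [finrank_A, finrank_B]
    simp only [ord]
    omega
  obtain ⟨hfin, hfinrank⟩ := finrank_quotient_eq_sum _ A B (fun n => inf_le_left) L (weightBox m)
    hA (fun f => (mem_range_restrict_iff hε hεW f).trans
      (forall_congr' fun n => (and_iff_right (hA f n)).symm)) hS fun a ha haS => by
    obtain ⟨f, hf⟩ := exists_hasExpansion_regular ha (finite_support_of_forall_notMem haS)
      (inf_le_right : W ⊓ regular ≤ regular)
    exact ⟨f, hReinhardt.laurent_eq (hf.restrict _)⟩
  exact ⟨hfin, hfinrank.trans
    (Finset.sum_congr rfl fun n _ => by rw [finrank_A, finrank_B, extDim])⟩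

end A2Resolution

/-! ### The first Čech cohomology -/

namespace BinaryForm

open Polynomial

/-- The product of a family of submodules, as a submodule of the product. -/
def submodulePiEquiv {K ι X : Type*} [Semiring K] [AddCommMonoid X] [Module K X]
    (A : ι → Submodule K X) :
    Submodule.pi univ A ≃ₗ[K] ∀ i, A i where
  toFun v i := ⟨v.1 i, v.2 i (mem_univ i)⟩
  invFun a := ⟨fun i => a i, fun i _ => (a i).2⟩
  map_add' _ _ := rfl
  map_smul' _ _ := rfl

/-- The Čech coboundary of forms in the three charts, on the two intersections of consecutive
charts. -/
def coboundary : (Fin 3 → ℂ[X]) →ₗ[ℂ] Fin 2 → ℂ[X] :=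
  LinearMap.funLeft ℂ ℂ[X] Fin.succ - LinearMap.funLeft ℂ ℂ[X] Fin.castSucc

lemma coboundary_apply (v : Fin 3 → ℂ[X]) (i : Fin 2) :
    coboundary v i = v i.succ - v i.castSucc := rfl

/-- The triples of forms in the three charts that vanish to order `e r` at each root `r` that
belongs to the chart; the `j`-th chart contains the roots `j - 1` and `j`. -/
def chartVanishing (m : ℕ) (e : ℤ → ℕ) : Submodule ℂ (Fin 3 → ℂ[X]) :=
  Submodule.pi univ fun j =>
    vanishing m ((j : ℕ) - 1) (e ((j : ℕ) - 1)) ⊓ vanishing m (j : ℕ) (e (j : ℕ))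

lemma finite_range_chartVanishing (m : ℕ) : (range (chartVanishing m)).Finite := by
  refine (finite_range fun t : Fin 3 → Fin (m + 2) × Fin (m + 2) => Submodule.pi univ
    fun j : Fin 3 => vanishing m ((j : ℕ) - 1) (t j).1 ⊓ vanishing m (j : ℕ) (t j).2).subset ?_
  rintro _ ⟨e, rfl⟩
  have hlt : ∀ r, min (e r) (m + 1) < m + 2 := fun r => (min_le_right _ _).trans_lt (by omega)
  refine ⟨fun j => (⟨_, hlt ((j : ℕ) - 1)⟩, ⟨_, hlt (j : ℕ)⟩), ?_⟩
  simp only [chartVanishing, vanishing_min]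

instance (m : ℕ) (r s : ℤ) (e f : ℕ) :
    FiniteDimensional ℂ ↥(vanishing m r e ⊓ vanishing m s f) :=
  Submodule.finiteDimensional_of_le (S₂ := vanishing m r e) inf_le_left

instance (m : ℕ) (e : ℤ → ℕ) : FiniteDimensional ℂ (chartVanishing m e) :=
  (submodulePiEquiv _).symm.finiteDimensional

lemma finrank_chartVanishing (m : ℕ) (e : ℤ → ℕ) :
    Module.finrank ℂ (chartVanishing m e) =
      (m + 1 - (e (-1) + e 0)) + (m + 1 - (e 0 + e 1)) + (m + 1 - (e 1 + e 2)) := by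
  rw [chartVanishing, (submodulePiEquiv _).finrank_eq, Module.finrank_pi_fintype]
  simp_rw [finrank_vanishing_inf m (sub_one_lt _).ne]
  rw [Fin.sum_univ_three]
  rfl

/-- The kernel of the coboundary consists of the forms that vanish at all four roots. -/
def kerCoboundaryEquiv (m : ℕ) (e : ℤ → ℕ) :
    LinearMap.ker (coboundary.domRestrict (chartVanishing m e)) ≃ₗ[ℂ]
      ↥(vanishing m (-1) (e (-1)) ⊓ vanishing m 0 (e 0) ⊓
        (vanishing m 1 (e 1) ⊓ vanishing m 2 (e 2))) :=
  have eq_zero (v : LinearMap.ker (coboundary.domRestrict (chartVanishing m e))) (j : Fin 3) :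
      v.1.1 j = v.1.1 0 := by
    have h (i : Fin 2) : v.1.1 i.succ = v.1.1 i.castSucc :=
      sub_eq_zero.mp (congrFun (LinearMap.mem_ker.mp v.2) i)
    fin_cases j
    exacts [rfl, h 0, (h 1).trans (h 0)]
  { toFun v := ⟨v.1.1 0, v.1.2 0 trivial, eq_zero v 2 ▸ v.1.2 2 trivial⟩
    invFun p := ⟨⟨fun _ => p, fun j _ => by
      fin_cases j
      exacts [p.2.1, ⟨p.2.1.2, p.2.2.1⟩, p.2.2]⟩, funext fun _ => sub_self _⟩
    left_inv v := Subtype.ext (Subtype.ext (funext fun j => (eq_zero v j).symm))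
    map_add' _ _ := rfl
    map_smul' _ _ := rfl }

lemma finrank_map_coboundary (m : ℕ) (e : ℤ → ℕ) :
    Module.finrank ℂ ((chartVanishing m e).map coboundary) +
        (m + 1 - (e (-1) + e 0 + e 1 + e 2)) =
      (m + 1 - (e (-1) + e 0)) + (m + 1 - (e 0 + e 1)) + (m + 1 - (e 1 + e 2)) := by
  rw [← finrank_chartVanishing, ← LinearMap.finrank_range_add_finrank_ker
    (coboundary.domRestrict (chartVanishing m e)), LinearMap.range_domRestrict,
    (kerCoboundaryEquiv m e).finrank_eq, finrank_vanishing_inf₄ m (by decide) (by decide)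
      (by decide) (by decide) (by decide) (by decide)]

lemma coeffNorm_sum_le {ι : Type*} (m : ℕ) (s : Finset ι) (p : ι → ℂ[X]) :
    coeffNorm m (∑ i ∈ s, p i) ≤ ∑ i ∈ s, coeffNorm m (p i) := by
  simp only [coeffNorm, finsetSum_coeff]
  rw [Finset.sum_comm]
  exact Finset.sum_le_sum fun _ _ => norm_sum_le _ _

section Bound

variable {ι κ : Type*} [Fintype ι]

lemma exists_coeffNorm_le_mul_sum (m : ℕ) (T : (ι → ℂ[X]) →ₗ[ℂ] ℂ[X]) :
    ∃ K, 0 ≤ K ∧ ∀ b : ι → ℂ[X], (∀ i, (b i).natDegree ≤ m) →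
      coeffNorm m (T b) ≤ K * ∑ i, coeffNorm m (b i) := by
  classical
  choose K hK0 hK using fun i =>
    exists_coeffNorm_le_mul_coeffNorm m (T ∘ₗ LinearMap.single ℂ (fun _ : ι => ℂ[X]) i)
  refine ⟨∑ i, K i, Finset.sum_nonneg fun i _ => hK0 i, fun b hb => ?_⟩
  calc coeffNorm m (T b) = coeffNorm m (∑ i, T (Pi.single i (b i))) := by
        rw [← map_sum, Finset.univ_sum_single]
    _ ≤ ∑ i, coeffNorm m (T (Pi.single i (b i))) := coeffNorm_sum_le m _ _
    _ ≤ ∑ i, K i * coeffNorm m (b i) := Finset.sum_le_sum fun i _ => hK i (b i) (hb i)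
    _ ≤ ∑ i, (∑ k, K k) * coeffNorm m (b i) := Finset.sum_le_sum fun i _ =>
        mul_le_mul_of_nonneg_right (Finset.single_le_sum (fun k _ => hK0 k) (Finset.mem_univ i))
          (coeffNorm_nonneg m _)
    _ = (∑ k, K k) * ∑ i, coeffNorm m (b i) := (Finset.mul_sum _ _ _).symm

variable [Finite κ]

lemma exists_preimage_coeffNorm_le (m : ℕ) (D : (κ → ℂ[X]) →ₗ[ℂ] ι → ℂ[X])
    (W : Submodule ℂ (κ → ℂ[X])) :
    ∃ K, ∀ b ∈ W.map D, (∀ i, (b i).natDegree ≤ m) →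
      ∃ v ∈ W, D v = b ∧ ∀ j, coeffNorm m (v j) ≤ K * ∑ i, coeffNorm m (b i) := by
  obtain ⟨S, hS⟩ := (D.submoduleMap W).exists_rightInverse_of_surjective
    (LinearMap.range_eq_top.mpr (D.submoduleMap_surjective W))
  obtain ⟨T, hT⟩ := LinearMap.exists_extend (W.subtype ∘ₗ S)
  choose K _ hK using fun j => exists_coeffNorm_le_mul_sum m (LinearMap.proj j ∘ₗ T)
  obtain ⟨M, hM⟩ := (finite_range K).bddAbove
  refine ⟨M, fun b hb hdeg => ?_⟩
  have hTb : T b = S ⟨b, hb⟩ := LinearMap.congr_fun hT ⟨b, hb⟩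
  refine ⟨T b, hTb ▸ (S ⟨b, hb⟩).2, ?_, fun j => (hK j b hdeg).trans
    (mul_le_mul_of_nonneg_right (hM ⟨j, rfl⟩) (Finset.sum_nonneg fun _ _ => coeffNorm_nonneg m _))⟩
  rw [hTb]
  exact congrArg Subtype.val (LinearMap.congr_fun hS ⟨b, hb⟩)

lemma exists_preimage_coeffNorm_le_of_finite (m : ℕ) (D : (κ → ℂ[X]) →ₗ[ℂ] ι → ℂ[X])
    {𝒲 : Set (Submodule ℂ (κ → ℂ[X]))} (h𝒲 : 𝒲.Finite) :
    ∃ K, ∀ W ∈ 𝒲, ∀ b ∈ W.map D, (∀ i, (b i).natDegree ≤ m) →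
      ∃ v ∈ W, D v = b ∧ ∀ j, coeffNorm m (v j) ≤ K * ∑ i, coeffNorm m (b i) := by
  choose K hK using exists_preimage_coeffNorm_le m D
  obtain ⟨M, hM⟩ := (h𝒲.image K).bddAbove
  refine ⟨M, fun W hW b hb hdeg => ?_⟩
  obtain ⟨v, hv, hvb, hle⟩ := hK W b hb hdeg
  exact ⟨v, hv, hvb, fun j => (hle j).trans (mul_le_mul_of_nonneg_right (hM (mem_image_of_mem K hW))
    (Finset.sum_nonneg fun _ _ => coeffNorm_nonneg m _))⟩

end Bound

/-- The preimage under `coboundary` of a pair of forms that vanishes in the first chart. -/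
def primitive (a : Fin 2 → ℂ[X]) : Fin 3 → ℂ[X] := ![0, a 0, a 0 + a 1]

lemma coboundary_primitive (a : Fin 2 → ℂ[X]) : coboundary (primitive a) = a := by
  funext i
  fin_cases i
  exacts [sub_zero (a 0), add_sub_cancel_left (a 0) (a 1)]

lemma primitive_zero : primitive 0 = 0 := by
  funext i
  fin_cases i
  exacts [rfl, rfl, add_zero _]

lemma primitive_sub_mem {a : Fin 2 → ℂ[X]} {S : Submodule ℂ ℂ[X]} {r : ℤ} {i j : Fin 3}
    (hi : (i : ℤ) ∈ Icc r (r + 1)) (hj : (j : ℤ) ∈ Icc r (r + 1))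
    (hS : ∀ k : Fin 2, (k : ℤ) = r → a k ∈ S) : primitive a j - primitive a i ∈ S := by
  have succ_sub {i j : Fin 3} (hi : (i : ℤ) = r) (hj : (j : ℤ) = r + 1) :
      primitive a j - primitive a i ∈ S := by
    have hk : (i : ℕ) < 2 := by omega
    have h := coboundary_apply (primitive a) ⟨i, hk⟩
    rw [coboundary_primitive] at h
    have hj : j = Fin.succ ⟨i, hk⟩ := Fin.ext (by change (j : ℕ) = i + 1; omega)
    exact hj ▸ h ▸ hS ⟨i, hk⟩ hi
  have hcases : i = j ∨ (i : ℤ) = r ∧ (j : ℤ) = r + 1 ∨ (j : ℤ) = r ∧ (i : ℤ) = r + 1 := by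
    simp only [mem_Icc, Fin.ext_iff] at *
    omega
  obtain rfl | ⟨hi, hj⟩ | ⟨hj, hi⟩ := hcases
  · exact (sub_self (primitive a i)).symm ▸ zero_mem S
  · exact succ_sub hi hj
  · exact sub_mem_comm_iff.mp (succ_sub hj hi)

end BinaryForm

namespace A2Resolution

open SymmetricDifferential Laurent BinaryForm Polynomial

variable {m : ℕ} {U V : Opens A2Resolution}

lemma param_mem_chartDomain_iff {i k : Fin 3} {c : ℂ × ℂ} :
    param k c ∈ chartDomain i ↔ vec k c i ≠ 0 := rep_param_ne_zero_iff k i c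

/-- The open sets that contain the torus. -/
def ContainsTorus (U : Opens A2Resolution) : Prop :=
  ∀ (k : Fin 3) (c : ℂ × ℂ), c.1 ≠ 0 → c.2 ≠ 0 → param k c ∈ U

lemma containsTorus_chartDomain (i : Fin 3) : ContainsTorus (chartDomain i) := by
  intro k c h1 h2
  rw [param_mem_chartDomain_iff]
  fin_cases k <;> fin_cases i
  exacts [one_ne_zero, h2, mul_ne_zero h1 (pow_ne_zero 3 h2), h1, one_ne_zero, h2,
    mul_ne_zero (pow_ne_zero 3 h1) h2, h1, one_ne_zero]

lemma ContainsTorus.inf (hU : ContainsTorus U) (hV : ContainsTorus V) : ContainsTorus (U ⊓ V) :=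
  fun k c h1 h2 => ⟨hU k c h1 h2, hV k c h1 h2⟩

lemma ContainsTorus.isReinhardt (hU : ContainsTorus U) : IsReinhardt U :=
  .of_forall_norm_le ⟨(1, 1), one_ne_zero, one_ne_zero, hU 1 _ one_ne_zero one_ne_zero⟩
    fun _ d _ h1 h2 _ _ => hU 1 d h1 h2

lemma IsReinhardt.eq_zero_iff (hU : IsReinhardt U) {f : sections (ℂ × ℂ) m U}
    {p : ℤ × ℤ → ℂ[X]} (hf : HasExpansion f p) : f = 0 ↔ p = 0 := by
  have hzero : HasExpansion (0 : sections (ℂ × ℂ) m U) (0 : ℤ × ℤ → ℂ[X]) :=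
    map_zero (hU.laurent m) ▸ hU.hasExpansion_laurent 0
  exact ⟨fun h => hU.coeff_unique (h ▸ hf) hzero, fun h => (h ▸ hf).eq hzero⟩

lemma HasExpansion.mem_reg_of_chartDomain {j : Fin 3} {f : sections (ℂ × ℂ) m (chartDomain j)}
    {p : ℤ × ℤ → ℂ[X]} (hf : HasExpansion f p) (n : ℤ × ℤ) :
    p n ∈ reg m n ((j : ℕ) - 1) ⊓ reg m n (j : ℕ) :=
  ⟨hf.mem_reg_sub_one j one_pos one_pos (fun c _ _ => param_mem_chartDomain j c) n,
    hf.mem_reg j one_pos one_pos (fun c _ _ => param_mem_chartDomain j c) n⟩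

lemma exists_hasExpansion_chartDomain (j : Fin 3) {p : ℤ × ℤ → ℂ[X]}
    (hp : ∀ n, p n ∈ reg m n ((j : ℕ) - 1) ⊓ reg m n (j : ℕ))
    (hs : ∀ c : ℂ × ℂ, c.1 ≠ 0 → c.2 ≠ 0 →
      Summable fun n => ‖mon (wt j n) c‖ * coeffNorm m (p n)) :
    ∃ f : sections (ℂ × ℂ) m (chartDomain j), HasExpansion f p := by
  refine exists_hasExpansion_of_summable (fun n => (hp n).1.1) fun q hq => ⟨j, hq, hp, ?_⟩
  have hlt : ∀ z : ℂ, ‖z‖ < ‖((‖z‖ + 1 : ℝ) : ℂ)‖ := fun z =>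
    ((lt_add_one _).trans_le (le_abs_self _)).trans_eq (Complex.norm_real _).symm
  have hne : ∀ z : ℂ, ((‖z‖ + 1 : ℝ) : ℂ) ≠ 0 := fun z =>
    norm_pos_iff.mp ((norm_nonneg z).trans_lt (hlt z))
  exact ⟨(_, _), hlt _, hlt _, hs (_, _) (hne _) (hne _)⟩

/-- The Čech 1-cocycles for the standard cover. -/
abbrev Cocycle (m : ℕ) : Type _ := LinearMap.ker (cechD1 (ℂ × ℂ) m chartDomain)

lemma containsTorus_inf_chartDomain (i j : Fin 3) :
    ContainsTorus (chartDomain i ⊓ chartDomain j) :=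
  (containsTorus_chartDomain i).inf (containsTorus_chartDomain j)

/-- The coefficients of the Laurent expansions of the component of a cocycle on the intersection
of two charts. -/
def cocycleLaurent (m : ℕ) (i j : Fin 3) : Cocycle m →ₗ[ℂ] ℤ × ℤ → ℂ[X] :=
  (containsTorus_inf_chartDomain i j).isReinhardt.laurent m ∘ₗ
    { toFun z := z.1 i j, map_add' _ _ := rfl, map_smul' _ _ := rfl }

lemma hasExpansion_cocycleLaurent (z : Cocycle m) (i j : Fin 3) :
    HasExpansion (z.1 i j) (cocycleLaurent m i j z) :=
  (containsTorus_inf_chartDomain i j).isReinhardt.hasExpansion_laurent _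

lemma cocycleLaurent_eq {z : Cocycle m} {i j : Fin 3} {p : ℤ × ℤ → ℂ[X]}
    (h : HasExpansion (z.1 i j) p) : cocycleLaurent m i j z = p :=
  (containsTorus_inf_chartDomain i j).isReinhardt.laurent_eq h

lemma mem_ker_cechD1_iff {z : Cochain1 (ℂ × ℂ) m chartDomain}
    {P : Fin 3 → Fin 3 → ℤ × ℤ → ℂ[X]} (hz : ∀ i j, HasExpansion (z i j) (P i j)) :
    z ∈ LinearMap.ker (cechD1 (ℂ × ℂ) m chartDomain) ↔
      ∀ i j k, P j k - P i k + P i j = 0 := by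
  have hexp : ∀ i j k, HasExpansion (cechD1 (ℂ × ℂ) m chartDomain z i j k)
      (P j k - P i k + P i j) := fun i j k =>
    (((hz j k).restrict _).sub ((hz i k).restrict _)).add ((hz i j).restrict _)
  have hzero : ∀ i j k, cechD1 (ℂ × ℂ) m chartDomain z i j k = 0 ↔ P j k - P i k + P i j = 0 :=
    fun i j k => ((containsTorus_inf_chartDomain i j).inf
      (containsTorus_chartDomain k)).isReinhardt.eq_zero_iff (hexp i j k)
  simp_rw [← hzero]
  exact ⟨fun h i j k => congrFun (congrFun (congrFun h i) j) k,
    fun h => funext fun i => funext fun j => funext fun k => h i j k⟩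

/-- The Laurent coefficients of a cocycle on the two intersections of consecutive charts, which
determine the cocycle. -/
def adjacentLaurent (m : ℕ) : Cocycle m →ₗ[ℂ] ℤ × ℤ → Fin 2 → ℂ[X] :=
  LinearMap.pi fun n => LinearMap.pi fun i =>
    LinearMap.proj n ∘ₗ cocycleLaurent m i.castSucc i.succ

lemma cocycleLaurent_eq_sub {z : Cocycle m} {v : ℤ × ℤ → Fin 3 → ℂ[X]}
    (hv : ∀ n, coboundary (v n) = adjacentLaurent m z n) (i j : Fin 3) :
    cocycleLaurent m i j z = (fun n => v n j) - fun n => v n i := by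
  have cocycle := (mem_ker_cechD1_iff (hasExpansion_cocycleLaurent z)).mp z.2
  have adjacent_zero : (fun n => v n 1) - (fun n => v n 0) = cocycleLaurent m 0 1 z :=
    _root_.funext fun n => congrFun (hv n) 0
  have adjacent_one : (fun n => v n 2) - (fun n => v n 1) = cocycleLaurent m 1 2 z :=
    _root_.funext fun n => congrFun (hv n) 1
  have h00 : cocycleLaurent m 0 0 z = 0 := by simpa only [sub_self, zero_add] using cocycle 0 0 0
  have from_zero (j : Fin 3) : cocycleLaurent m 0 j z = (fun n => v n j) - fun n => v n 0 := by
    fin_cases j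
    · exact h00.trans (sub_self _).symm
    · exact adjacent_zero.symm
    · change cocycleLaurent m 0 2 z = (fun n => v n 2) - fun n => v n 0
      linear_combination (exp := 1) -cocycle 0 1 2 - adjacent_zero - adjacent_one
  linear_combination (exp := 1) cocycle 0 i j + from_zero j - from_zero i

lemma adjacentLaurent_mem (z : Cocycle m) (n : ℤ × ℤ) (i : Fin 2) :
    adjacentLaurent m z n i ∈ reg m n (i : ℕ) := by
  have hvec (c : ℂ × ℂ) : vec i.castSucc c i.succ = c.2 := by fin_cases i <;> rfl
  refine (hasExpansion_cocycleLaurent z i.castSucc i.succ).mem_reg i.castSucc one_pos one_pos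
    (fun c _ h2 => ⟨param_mem_chartDomain _ c, param_mem_chartDomain_iff.mpr ?_⟩) n
  rw [hvec]
  exact norm_pos_iff.mp (one_pos.trans_eq h2.symm)

/-- The weight-`n` coboundaries. -/
abbrev coboundaries (m : ℕ) (n : ℤ × ℤ) : Submodule ℂ (Fin 2 → ℂ[X]) :=
  (chartVanishing m (ord m n)).map coboundary

lemma adjacentLaurent_mem_coboundaries {z : Cocycle m}
    (hz : z.1 ∈ LinearMap.range (cechD0 (ℂ × ℂ) m chartDomain)) (n : ℤ × ℤ) :
    adjacentLaurent m z n ∈ coboundaries m n := by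
  obtain ⟨s, hs⟩ := hz
  have hQ (j : Fin 3) :=
    (containsTorus_chartDomain j).isReinhardt.hasExpansion_laurent (m := m) (s j)
  refine ⟨_, fun j _ => (hQ j).mem_reg_of_chartDomain n, funext fun i => ?_⟩
  have hexp : HasExpansion (cechD0 (ℂ × ℂ) m chartDomain s i.castSucc i.succ) (_ - _) :=
    ((hQ i.succ).restrict inf_le_right).sub ((hQ i.castSucc).restrict inf_le_left)
  rw [hs] at hexp
  exact (congrFun (cocycleLaurent_eq hexp) n).symm

lemma mem_range_cechD0_of_adjacentLaurent_mem {z : Cocycle m}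
    (hz : ∀ n, adjacentLaurent m z n ∈ coboundaries m n) :
    z.1 ∈ LinearMap.range (cechD0 (ℂ × ℂ) m chartDomain) := by
  obtain ⟨K, hK⟩ := exists_preimage_coeffNorm_le_of_finite m coboundary
    (finite_range_chartVanishing m)
  choose v hv hvz hle using fun n => hK _ ⟨ord m n, rfl⟩ _ (hz n)
    fun i => (hasExpansion_cocycleLaurent z i.castSucc i.succ).natDegree_le n
  have hsum (j : Fin 3) (c : ℂ × ℂ) (h1 : c.1 ≠ 0) (h2 : c.2 ≠ 0) :
      Summable fun n => ‖mon (wt j n) c‖ * coeffNorm m (v n j) := by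
    have hadj : Summable fun n => ∑ i : Fin 2,
        ‖mon (wt j n) c‖ * coeffNorm m (adjacentLaurent m z n i) := summable_sum fun i _ =>
      (hasExpansion_cocycleLaurent z _ _).summable j h1 h2
        (containsTorus_inf_chartDomain i.castSucc i.succ j c h1 h2)
    refine (hadj.mul_left K).of_nonneg_of_le
      (fun n => mul_nonneg (norm_nonneg _) (coeffNorm_nonneg m _)) fun n => ?_
    rw [← Finset.mul_sum, mul_left_comm]
    exact mul_le_mul_of_nonneg_left (hle n j) (norm_nonneg _)
  choose s hs using fun j => exists_hasExpansion_chartDomain j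
    (fun n => hv n j (mem_univ j)) (hsum j)
  refine ⟨s, funext fun i => funext fun j => ?_⟩
  have hexp : HasExpansion (cechD0 (ℂ × ℂ) m chartDomain s i j) (_ - _) :=
    ((hs j).restrict inf_le_right).sub ((hs i).restrict inf_le_left)
  exact hexp.eq (cocycleLaurent_eq_sub hvz i j ▸ hasExpansion_cocycleLaurent z i j)

lemma mem_Icc_of_fst_eq_zero {i k : Fin 3} {c : ℂ × ℂ} (hc : param k c ∈ chartDomain i)
    (h : c.1 = 0) : (i : ℤ) ∈ Icc (k : ℤ) (k + 1) := by
  rw [param_mem_chartDomain_iff] at hc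
  fin_cases k <;> fin_cases i <;> simp_all [vec]

lemma mem_Icc_of_snd_eq_zero {i k : Fin 3} {c : ℂ × ℂ} (hc : param k c ∈ chartDomain i)
    (h : c.2 = 0) : (i : ℤ) ∈ Icc (k - 1 : ℤ) (k - 1 + 1) := by
  rw [param_mem_chartDomain_iff] at hc
  fin_cases k <;> fin_cases i <;> simp_all [vec]

lemma exists_adjacentLaurent_eq {a : ℤ × ℤ → Fin 2 → ℂ[X]}
    (ha : ∀ n (i : Fin 2), a n i ∈ reg m n (i : ℕ)) (hfin : {n | a n ≠ 0}.Finite) :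
    ∃ z : Cocycle m, adjacentLaurent m z = a := by
  have hdeg (n : ℤ × ℤ) (i : Fin 3) : (primitive (a n) i).natDegree ≤ m := by
    fin_cases i
    exacts [(natDegree_zero).trans_le (Nat.zero_le m), (ha n 0).1,
      natDegree_add_le_of_degree_le (ha n 0).1 (ha n 1).1]
  have hreg (n : ℤ × ℤ) {r : ℤ} (k : Fin 2) (hk : (k : ℤ) = r) : a n k ∈ reg m n r := hk ▸ ha n k
  choose z hz using fun i j : Fin 3 => exists_hasExpansion_of_finite (m := m)
    (U := chartDomain i ⊓ chartDomain j) (p := fun n => primitive (a n) j - primitive (a n) i)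
    (fun n => (natDegree_sub_le_of_le (hdeg n j) (hdeg n i)).trans_eq (max_self m))
    (hfin.subset fun n hn h0 => hn (by simp only [h0, primitive_zero, Pi.zero_apply, sub_zero]))
    (fun k c hc h0 n => primitive_sub_mem (mem_Icc_of_fst_eq_zero hc.1 h0)
      (mem_Icc_of_fst_eq_zero hc.2 h0) (hreg n))
    (fun k c hc h0 n => primitive_sub_mem (mem_Icc_of_snd_eq_zero hc.1 h0)
      (mem_Icc_of_snd_eq_zero hc.2 h0) (hreg n))
  have hker : (z : Cochain1 (ℂ × ℂ) m chartDomain) ∈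
      LinearMap.ker (cechD1 (ℂ × ℂ) m chartDomain) :=
    (mem_ker_cechD1_iff hz).mpr fun i j k => funext fun n => by
      simp only [Pi.add_apply, Pi.sub_apply, Pi.zero_apply]
      ring
  refine ⟨⟨z, hker⟩, funext fun n => funext fun i => ?_⟩
  exact (congrFun (cocycleLaurent_eq (z := ⟨z, hker⟩) (hz i.castSucc i.succ)) n).trans
    (congrFun (coboundary_primitive (a n)) i)

/-- The dimension of the first cohomology in weight `n`. -/
def cechDim (m : ℕ) (n : ℤ × ℤ) : ℕ :=
  (m + 1 - ord m n 0) + (m + 1 - ord m n 1) -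
    ((m + 1 - (ord m n (-1) + ord m n 0)) + (m + 1 - (ord m n 0 + ord m n 1)) +
      (m + 1 - (ord m n 1 + ord m n 2)) -
      (m + 1 - (ord m n (-1) + ord m n 0 + ord m n 1 + ord m n 2)))

theorem finrank_cechH1 (m : ℕ) :
    FiniteDimensional ℂ (CechH1 (ℂ × ℂ) m chartDomain) ∧
      Module.finrank ℂ (CechH1 (ℂ × ℂ) m chartDomain) = ∑ n ∈ weightBox m, cechDim m n := by
  let A : ℤ × ℤ → Submodule ℂ (Fin 2 → ℂ[X]) := fun n =>
    Submodule.pi univ fun i => vanishing m (i : ℕ) (ord m n (i : ℕ))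
  have hBA : ∀ n, coboundaries m n ≤ A n := by
    rintro n _ ⟨v, hv, rfl⟩ i -
    have h := (hv i.succ trivial).1
    rw [Fin.val_succ, Nat.cast_add_one, add_sub_cancel_right] at h
    exact sub_mem h (hv i.castSucc trivial).2
  have hAfin : ∀ n, FiniteDimensional ℂ (A n) := fun n =>
    (submodulePiEquiv _).symm.finiteDimensional
  have finrank_A : ∀ n, Module.finrank ℂ (A n) = (m + 1 - ord m n 0) + (m + 1 - ord m n 1) :=
    fun n => by
      rw [(submodulePiEquiv _).finrank_eq, Module.finrank_pi_fintype, Fin.sum_univ_two,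
        finrank_vanishing, finrank_vanishing]
      rfl
  have hS : ∀ n ∉ weightBox m, A n ≤ coboundaries m n := fun n hn => by
    refine (Submodule.eq_of_le_of_finrank_eq (hBA n) ?_).ge
    have hn := lt_or_lt_of_notMem_weightBox hn
    have hB : Module.finrank ℂ (coboundaries m n) + _ = _ := finrank_map_coboundary m (ord m n)
    rw [finrank_A]
    simp only [ord] at hB ⊢
    omega
  obtain ⟨hfin, hfinrank⟩ := finrank_quotient_eq_sum
    ((LinearMap.range (cechD0 (ℂ × ℂ) m chartDomain)).submoduleOf
      (LinearMap.ker (cechD1 (ℂ × ℂ) m chartDomain))) A (coboundaries m) hBA (adjacentLaurent m)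
    (weightBox m) (fun z n i _ => adjacentLaurent_mem z n i)
    (fun z => ⟨adjacentLaurent_mem_coboundaries, mem_range_cechD0_of_adjacentLaurent_mem⟩) hS
    fun a ha haS => exists_adjacentLaurent_eq (fun n i => ha n i trivial)
      (finite_support_of_forall_notMem haS)
  refine ⟨hfin, hfinrank.trans (Finset.sum_congr rfl fun n _ => ?_)⟩
  rw [finrank_A, cechDim, ← finrank_map_coboundary, Nat.add_sub_cancel]

end A2Resolution

/-! ### Riemann sums of Lipschitz functions -/

namespace RiemannSum

open NNReal

lemma sum_Icc_eq_sum_range {M : Type*} [AddCommMonoid M] (a : ℤ) (N : ℕ) (g : ℤ → M) :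
    ∑ k ∈ Finset.Icc a (a + N), g k = ∑ i ∈ Finset.range (N + 1), g (a + i) := by
  rw [Int.Icc_eq_finset_map, Finset.sum_map, show (a + N + 1 - a).toNat = N + 1 by omega]
  rfl

lemma card_Icc_mul_le {a b : ℤ} (hab : a ≤ b) {m : ℕ} (hm : 0 < m) :
    ((Finset.Icc (a * m) (b * m)).card : ℝ) ≤ (b - a + 1) * m := by
  have hle : a * m ≤ b * m + 1 := by nlinarith
  have hcard : ((Finset.Icc (a * m) (b * m)).card : ℤ) ≤ (b - a + 1) * m := by
    rw [Int.card_Icc_of_le _ _ hle]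
    linarith [Int.natCast_pos.mpr hm]
  exact_mod_cast hcard

lemma abs_sum_le_card_mul {ι : Type*} (s : Finset ι) {f : ι → ℝ} {C : ℝ}
    (hf : ∀ i ∈ s, |f i| ≤ C) : |∑ i ∈ s, f i| ≤ s.card * C :=
  (Finset.abs_sum_le_sum_abs _ _).trans
    ((Finset.sum_le_card_nsmul _ _ _ hf).trans_eq (nsmul_eq_mul _ _))

section OneVariable

variable {f : ℝ → ℝ} {K : ℝ≥0}

lemma abs_mul_sub_integral_le (hf : LipschitzWith K f) {h : ℝ} (hh : 0 ≤ h) (x : ℝ) :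
    |h * f x - ∫ t in x..x + h, f t| ≤ K * h ^ 2 := by
  have hsub : h * f x - ∫ t in x..x + h, f t = ∫ t in x..x + h, (f x - f t) := by
    rw [intervalIntegral.integral_sub intervalIntegrable_const
      (hf.continuous.intervalIntegrable _ _), intervalIntegral.integral_const,
      add_sub_cancel_left, smul_eq_mul]
  have hbound : ∀ t ∈ uIoc x (x + h), ‖f x - f t‖ ≤ K * h := fun t ht => by
    rw [uIoc_of_le (le_add_of_nonneg_right hh)] at ht
    refine (hf.norm_sub_le x t).trans (mul_le_mul_of_nonneg_left ?_ K.2)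
    rw [Real.norm_eq_abs, abs_sub_comm, abs_of_pos (sub_pos.mpr ht.1)]
    exact sub_le_iff_le_add'.mpr ht.2
  rw [hsub]
  refine (intervalIntegral.norm_integral_le_of_norm_le_const hbound).trans_eq ?_
  rw [add_sub_cancel_left, abs_of_nonneg hh, mul_assoc, sq]

lemma abs_sum_range_sub_integral_le (hf : LipschitzWith K f) {h : ℝ} (hh : 0 ≤ h) (a : ℝ) (N : ℕ) :
    |h * ∑ i ∈ Finset.range N, f (a + i * h) - ∫ t in a..a + N * h, f t| ≤ N * (K * h ^ 2) := by
  let x : ℕ → ℝ := fun i => a + i * h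
  have hx : ∀ i, x (i + 1) = x i + h := fun i => by simp only [x, Nat.cast_add_one]; ring
  have hsplit : ∫ t in a..a + N * h, f t = ∑ i ∈ Finset.range N, ∫ t in x i..x i + h, f t := by
    simp_rw [← hx]
    rw [intervalIntegral.sum_integral_adjacent_intervals fun i _ =>
      hf.continuous.intervalIntegrable _ _]
    simp only [x, Nat.cast_zero, zero_mul, add_zero]
  rw [hsplit, Finset.mul_sum, ← Finset.sum_sub_distrib]
  refine (abs_sum_le_card_mul _ fun i _ => abs_mul_sub_integral_le hf hh (x i)).trans_eq ?_
  rw [Finset.card_range]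

lemma abs_sum_Icc_sub_integral_le (hf : LipschitzWith K f) {M : ℝ} (hM : ∀ x, |f x| ≤ M)
    {a b : ℤ} (hab : a ≤ b) {m : ℕ} (hm : 0 < m) :
    |(∑ k ∈ Finset.Icc (a * m) (b * m), f (k / m)) / m - ∫ t in (a : ℝ)..b, f t| ≤
      ((b - a) * K + M) / m := by
  have hm' : (m : ℝ) ≠ 0 := Nat.cast_ne_zero.mpr hm.ne'
  obtain ⟨N, hN⟩ := Int.le.dest (mul_le_mul_of_nonneg_right hab (Int.natCast_nonneg m))
  have hend : (a : ℝ) + N * (m : ℝ)⁻¹ = b := by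
    have hN' : (a * m + N : ℝ) = b * m := by exact_mod_cast hN
    rw [← div_eq_mul_inv, eq_comm, ← sub_eq_iff_eq_add', eq_div_iff hm']
    linarith
  have hpoint : ∀ i : ℕ, (((a * m + i : ℤ) : ℝ) / m) = a + i * (m : ℝ)⁻¹ := fun i => by
    push_cast
    field_simp
  have hsum := abs_sum_range_sub_integral_le hf (inv_nonneg.mpr (Nat.cast_nonneg m)) a N
  rw [hend] at hsum
  rw [← hN, sum_Icc_eq_sum_range, Finset.sum_range_succ]
  simp_rw [hpoint, hend]
  calc |(∑ i ∈ Finset.range N, f (a + i * (m : ℝ)⁻¹) + f b) / m - ∫ t in (a : ℝ)..b, f t|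
      = |((m : ℝ)⁻¹ * ∑ i ∈ Finset.range N, f (a + i * (m : ℝ)⁻¹) - ∫ t in (a : ℝ)..b, f t) +
          f b / m| := by congr 1; ring
    _ ≤ N * (K * (m : ℝ)⁻¹ ^ 2) + M / m := by
        refine (abs_add_le _ _).trans (add_le_add hsum ?_)
        rw [abs_div, Nat.abs_cast]
        exact div_le_div_of_nonneg_right (hM _) (Nat.cast_nonneg m)
    _ = ((b - a) * K + M) / m := by
        rw [← hend]
        ring

end OneVariable

section TwoVariables

variable {F : ℝ → ℝ → ℝ} {K K' : ℝ≥0}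

lemma lipschitzWith_integral (hF : ∀ y, Continuous fun x => F x y)
    (hF' : ∀ x, LipschitzWith K (F x)) (a b : ℝ) :
    LipschitzWith (K * ‖b - a‖₊) fun y => ∫ x in a..b, F x y :=
  .of_dist_le_mul fun y y' => by
    rw [dist_eq_norm, dist_eq_norm, ← intervalIntegral.integral_sub
      ((hF y).intervalIntegrable _ _) ((hF y').intervalIntegrable _ _)]
    refine (intervalIntegral.norm_integral_le_of_norm_le_const
      fun x _ => (hF' x).norm_sub_le y y').trans_eq ?_
    rw [NNReal.coe_mul, coe_nnnorm, Real.norm_eq_abs (b - a)]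
    ring

lemma exists_abs_sum_sum_sub_integral_le (hF : ∀ y, LipschitzWith K fun x => F x y)
    (hF' : ∀ x, LipschitzWith K' (F x)) {M : ℝ} (hM : ∀ x y, |F x y| ≤ M) {a b a' b' : ℤ}
    (hab : a ≤ b) (hab' : a' ≤ b') :
    ∃ C, ∀ m : ℕ, 0 < m →
      |(∑ l ∈ Finset.Icc (a' * m) (b' * m), ∑ k ∈ Finset.Icc (a * m) (b * m),
        F (k / m) (l / m)) / (m : ℝ) ^ 2 - ∫ y in (a' : ℝ)..b', ∫ x in (a : ℝ)..b, F x y| ≤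
      C / m := by
  let G : ℝ → ℝ := fun y => ∫ x in (a : ℝ)..b, F x y
  have hG := lipschitzWith_integral (fun y => (hF y).continuous) hF' a b
  have hGM : ∀ y, |G y| ≤ M * |(b : ℝ) - a| := fun y =>
    (Real.norm_eq_abs _).symm.trans_le
      (intervalIntegral.norm_integral_le_of_norm_le_const fun x _ => hM x y)
  refine ⟨(b' - a' + 1) * ((b - a) * K + M) +
    (((b' : ℝ) - a') * (K' * ‖(b : ℝ) - a‖₊ : ℝ≥0) + M * |(b : ℝ) - a|), fun m hm => ?_⟩
  have hm' : (0 : ℝ) < m := Nat.cast_pos.mpr hm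
  let S : ℤ → ℝ := fun l => ∑ k ∈ Finset.Icc (a * m) (b * m), F (k / m) (l / m)
  have inner : |(∑ l ∈ Finset.Icc (a' * m) (b' * m), (S l / m - G (l / m))) / m| ≤
      (b' - a' + 1) * ((b - a) * K + M) / m := by
    rw [abs_div, Nat.abs_cast]
    refine div_le_div_of_nonneg_right ((abs_sum_le_card_mul _ fun l _ =>
      abs_sum_Icc_sub_integral_le (hF _) (fun x => hM x _) hab hm).trans ?_) hm'.le
    have hbound : (0 : ℝ) ≤ ((b - a) * K + M) / m :=
      (abs_nonneg _).trans (abs_sum_Icc_sub_integral_le (hF 0) (fun x => hM x 0) hab hm)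
    exact (mul_le_mul_of_nonneg_right (card_Icc_mul_le hab' hm) hbound).trans_eq (by field_simp)
  have outer := abs_sum_Icc_sub_integral_le hG hGM hab' hm
  rw [add_div]
  refine le_trans (le_of_eq ?_) ((abs_add_le _ _).trans (add_le_add inner outer))
  rw [Finset.sum_sub_distrib, ← Finset.sum_div]
  congr 1
  field_simp
  ring

lemma tendsto_sum_sum (hF : ∀ y, LipschitzWith K fun x => F x y)
    (hF' : ∀ x, LipschitzWith K' (F x)) {M : ℝ} (hM : ∀ x y, |F x y| ≤ M) {a b a' b' : ℤ}
    (hab : a ≤ b) (hab' : a' ≤ b') :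
    Tendsto (fun m : ℕ => (∑ l ∈ Finset.Icc (a' * m) (b' * m), ∑ k ∈ Finset.Icc (a * m) (b * m),
      F (k / m) (l / m)) / (m : ℝ) ^ 2) atTop
      (𝓝 (∫ y in (a' : ℝ)..b', ∫ x in (a : ℝ)..b, F x y)) := by
  obtain ⟨C, hC⟩ := exists_abs_sum_sum_sub_integral_le hF hF' hM hab hab'
  refine tendsto_iff_norm_sub_tendsto_zero.mpr (squeeze_zero' (.of_forall fun _ => norm_nonneg _)
    ?_ (tendsto_const_div_atTop_nhds_zero_nat C))
  filter_upwards [eventually_gt_atTop 0] with m hm using hC m hm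

end TwoVariables

end RiemannSum

/-! ### The volumes -/

namespace A2Resolution

open SymmetricDifferential NNReal MeasureTheory

/-- The dimension of the space of forms with prescribed vanishing along the divisors in `S`. -/
def count (S : Finset ℤ) (m : ℕ) (n : ℤ × ℤ) : ℕ := m + 1 - ∑ r ∈ S, ord m n r

/-- The limit of `count S m n / m` for `m → ∞`, in the scaled coordinates `u = 1 - n.1 / m` and
`d = n.2 / m`. -/
def wedge (S : Finset ℤ) (u d : ℝ) : ℝ := max 0 (1 - ∑ r ∈ S, max 0 (u - r * d))

lemma abs_wedge_le_one (S : Finset ℤ) (u d : ℝ) : |wedge S u d| ≤ 1 := by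
  rw [wedge, abs_of_nonneg (le_max_left _ _)]
  exact max_le zero_le_one (sub_le_self _ (Finset.sum_nonneg fun _ _ => le_max_left _ _))

lemma lipschitzWith_sum {ι X E : Type*} [PseudoEMetricSpace X] [SeminormedAddCommGroup E]
    (s : Finset ι) {f : ι → X → E} {K : ι → ℝ≥0} (hf : ∀ i, LipschitzWith (K i) (f i)) :
    LipschitzWith (∑ i ∈ s, K i) fun x => ∑ i ∈ s, f i x := by
  induction s using Finset.cons_induction with
  | empty => exact .const _
  | cons i s hi ih =>
    simp only [Finset.sum_cons]
    exact (hf i).add ih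

lemma lipschitzWith_wedge_left (S : Finset ℤ) (d : ℝ) :
    LipschitzWith (0 + ∑ _r ∈ S, (1 + 0)) fun u => wedge S u d :=
  ((LipschitzWith.const 1).sub (lipschitzWith_sum S fun _ =>
    (LipschitzWith.id.sub (.const _)).const_max 0)).const_max 0

lemma lipschitzWith_wedge_right (S : Finset ℤ) (u : ℝ) :
    LipschitzWith (0 + ∑ r ∈ S, (0 + ‖(r : ℝ)‖₊)) (wedge S u) :=
  ((LipschitzWith.const 1).sub (lipschitzWith_sum S fun r =>
    ((LipschitzWith.const u).sub (lipschitzWith_smul (r : ℝ))).const_max 0)).const_max 0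

lemma cast_tsub_eq_max (a b : ℕ) : ((a - b : ℕ) : ℝ) = max 0 ((a : ℝ) - b) := by
  rcases le_total b a with h | h
  · rw [Nat.cast_sub h, max_eq_right (sub_nonneg.mpr (Nat.cast_le.mpr h))]
  · rw [Nat.sub_eq_zero_of_le h, max_eq_left (sub_nonpos.mpr (Nat.cast_le.mpr h)), Nat.cast_zero]

lemma cast_ord (m : ℕ) (n : ℤ × ℤ) (r : ℤ) :
    (ord m n r : ℝ) = max 0 ((m : ℝ) - (n.1 + r * n.2)) := by
  have h : ((ord m n r : ℕ) : ℤ) = max 0 ((m : ℤ) - (n.1 + r * n.2)) := by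
    rw [ord, Int.toNat_eq_max, max_comm]
  exact_mod_cast congrArg (Int.cast : ℤ → ℝ) h

lemma mul_wedge_eq (S : Finset ℤ) {m : ℕ} (hm : 0 < m) (n : ℤ × ℤ) :
    (m : ℝ) * wedge S (1 - n.1 / m) (n.2 / m) = max 0 ((m : ℝ) - ∑ r ∈ S, (ord m n r : ℝ)) := by
  have hm' : (0 : ℝ) < m := Nat.cast_pos.mpr hm
  rw [wedge, mul_max_of_nonneg _ _ hm'.le, mul_zero, mul_sub, mul_one, Finset.mul_sum]
  congr 2
  refine Finset.sum_congr rfl fun r _ => ?_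
  rw [cast_ord, mul_max_of_nonneg _ _ hm'.le, mul_zero]
  congr 1
  field_simp
  ring

lemma abs_count_sub_le (S : Finset ℤ) {m : ℕ} (hm : 0 < m) (n : ℤ × ℤ) :
    |(count S m n : ℝ) - m * wedge S (1 - n.1 / m) (n.2 / m)| ≤ 1 := by
  rw [mul_wedge_eq S hm, count, cast_tsub_eq_max, max_comm 0, max_comm 0]
  refine (abs_max_sub_max_le_abs _ _ _).trans_eq ?_
  push_cast
  rw [sub_sub_sub_cancel_right, add_sub_cancel_left, abs_one]

/-- The volume of the slice of the weights in the direction `d`, that is, the limit of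
`(∑ k, count S m (k, l)) / m ^ 2` for `l / m → d`. -/
def area (S : Finset ℤ) (d : ℝ) : ℝ := ∫ u in (-2 : ℝ)..3, wedge S u d

lemma tendsto_sum_wedge (S : Finset ℤ) :
    Tendsto (fun m : ℕ => (∑ n ∈ weightBox m, wedge S (1 - n.1 / m) (n.2 / m)) / (m : ℝ) ^ 2)
      atTop (𝓝 (∫ d in (-1 : ℝ)..1, area S d)) := by
  have hint : ∀ d : ℝ, ∫ x in (-2 : ℝ)..3, wedge S (1 - x) d = area S d := fun d => by
    rw [intervalIntegral.integral_comp_sub_left (fun u => wedge S u d), area]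
    norm_num
  have h := RiemannSum.tendsto_sum_sum (F := fun x d => wedge S (1 - x) d) (a := -2) (b := 3)
    (a' := -1) (b' := 1)
    (fun d => (lipschitzWith_wedge_left S d).comp (IsometryEquiv.subLeft 1).isometry.lipschitz)
    (fun x => lipschitzWith_wedge_right S (1 - x)) (fun x d => abs_wedge_le_one S (1 - x) d)
    (by decide) (by decide)
  push_cast at h
  simp_rw [hint] at h
  exact h.congr fun m => by rw [weightBox, Finset.sum_product_right]

lemma card_weightBox_le {m : ℕ} (hm : 0 < m) : ((weightBox m).card : ℝ) ≤ 18 * (m : ℝ) ^ 2 := by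
  rw [weightBox, Finset.card_product, Nat.cast_mul]
  refine (mul_le_mul (RiemannSum.card_Icc_mul_le (by decide) hm)
    (RiemannSum.card_Icc_mul_le (by decide) hm) (Nat.cast_nonneg _) (by positivity)).trans_eq ?_
  push_cast
  ring

lemma tendsto_sum_count_sub_wedge (S : Finset ℤ) :
    Tendsto (fun m : ℕ => (∑ n ∈ weightBox m,
      ((count S m n : ℝ) - m * wedge S (1 - n.1 / m) (n.2 / m))) / (m : ℝ) ^ 3) atTop (𝓝 0) := by
  refine squeeze_zero_norm' ?_ (tendsto_const_div_atTop_nhds_zero_nat 18)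
  filter_upwards [eventually_gt_atTop 0] with m hm
  have hm' : (0 : ℝ) < m := Nat.cast_pos.mpr hm
  rw [norm_div, norm_pow, Real.norm_natCast, div_le_div_iff₀ (pow_pos hm' 3) hm']
  calc _ ≤ ((weightBox m).card * 1 : ℝ) * m := mul_le_mul_of_nonneg_right
        (RiemannSum.abs_sum_le_card_mul _ fun n _ => abs_count_sub_le S hm n) hm'.le
    _ ≤ 18 * (m : ℝ) ^ 2 * m := by
        rw [mul_one]
        exact mul_le_mul_of_nonneg_right (card_weightBox_le hm) hm'.le
    _ = 18 * (m : ℝ) ^ 3 := by ring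

lemma tendsto_sum_count (S : Finset ℤ) :
    Tendsto (fun m : ℕ => (∑ n ∈ weightBox m, (count S m n : ℝ)) / (m : ℝ) ^ 3) atTop
      (𝓝 (∫ d in (-1 : ℝ)..1, area S d)) := by
  have h := (tendsto_sum_count_sub_wedge S).add (tendsto_sum_wedge S)
  rw [zero_add] at h
  refine h.congr' ?_
  filter_upwards [eventually_ne_atTop 0] with m hm
  rw [Finset.sum_sub_distrib, ← Finset.mul_sum]
  field_simp
  ring

/-! ### The explicit integrals -/

lemma integral_max_zero {a b c : ℝ} (hc : c ∈ Icc a b) :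
    ∫ u in a..b, max 0 (u - c) = (b - c) ^ 2 / 2 := by
  have hint : ∀ x y, IntervalIntegrable (fun u => max 0 (u - c)) volume x y :=
    fun x y => Continuous.intervalIntegrable (by fun_prop) _ _
  have hleft : ∫ u in a..c, max 0 (u - c) = ∫ _ in a..c, (0 : ℝ) :=
    intervalIntegral.integral_congr fun u hu => max_eq_left
      (sub_nonpos.mpr (uIcc_of_le hc.1 ▸ hu).2)
  have hright : ∫ u in c..b, max 0 (u - c) = ∫ u in c..b, (u - c) :=
    intervalIntegral.integral_congr fun u hu => max_eq_right
      (sub_nonneg.mpr (uIcc_of_le hc.2 ▸ hu).1)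
  rw [← intervalIntegral.integral_add_adjacent_intervals (hint a c) (hint c b), hleft, hright,
    intervalIntegral.integral_zero, intervalIntegral.integral_comp_sub_right (fun u => u),
    integral_id]
  ring

section ActiveSet

variable {S T : Finset ℤ} {u d A : ℝ}

lemma wedge_eq_zero (hTS : T ⊆ S) (hA : 1 ≤ ∑ r ∈ T, (A - r * d)) (hu : A ≤ u) :
    wedge S u d = 0 := by
  refine max_eq_left (sub_nonpos.mpr ?_)
  calc 1 ≤ ∑ r ∈ T, (A - r * d) := hA
    _ ≤ ∑ r ∈ T, max 0 (u - r * d) :=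
        Finset.sum_le_sum fun r _ => (sub_le_sub_right hu _).trans (le_max_right _ _)
    _ ≤ ∑ r ∈ S, max 0 (u - r * d) :=
        Finset.sum_le_sum_of_subset_of_nonneg hTS fun _ _ _ => le_max_left _ _

lemma wedge_eq_one_sub_sum (hTS : T ⊆ S) (active : ∀ r ∈ T, (r : ℝ) * d ≤ A)
    (inactive : ∀ r ∈ S, r ∉ T → A ≤ r * d) (hA : ∑ r ∈ T, (A - r * d) ≤ 1) (hu : u ≤ A) :
    wedge S u d = 1 - ∑ r ∈ T, max 0 (u - r * d) := by
  rw [wedge, ← Finset.sum_subset hTS fun r hr hrT =>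
    max_eq_left (sub_nonpos.mpr (hu.trans (inactive r hr hrT)))]
  refine max_eq_right (sub_nonneg.mpr (le_trans (Finset.sum_le_sum fun r hr => ?_) hA))
  exact max_le (sub_nonneg.mpr (active r hr)) (sub_le_sub_right hu _)

/-- The divisors in `T` impose conditions for `u ≤ A`, the remaining ones do not, and no form
satisfies the conditions for `A ≤ u`. -/
lemma area_eq_of_active (hd : |d| ≤ 1) (hT : T ⊆ Finset.Icc (-2) 2) (hTS : T ⊆ S)
    (active : ∀ r ∈ T, (r : ℝ) * d ≤ A) (inactive : ∀ r ∈ S, r ∉ T → A ≤ r * d)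
    (hA : ∑ r ∈ T, (A - r * d) = 1) :
    area S d = A + 2 - (∑ r ∈ T, (A - r * d) ^ 2) / 2 := by
  have habs : ∀ r ∈ T, -2 ≤ (r : ℝ) * d ∧ (r : ℝ) * d ≤ 2 := fun r hr => by
    have hr2 : |(r : ℝ)| ≤ 2 := by exact_mod_cast abs_le.mpr (Finset.mem_Icc.mp (hT hr))
    refine abs_le.mp ((abs_mul _ _).trans_le ?_)
    linarith [mul_le_mul hr2 hd (abs_nonneg d) zero_le_two]
  obtain ⟨s, hs⟩ : T.Nonempty := Finset.nonempty_of_sum_ne_zero (hA ▸ one_ne_zero)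
  have hA2 : -2 ≤ A := (habs s hs).1.trans (active s hs)
  have hA3 : A ≤ 3 := by
    have h := Finset.single_le_sum (fun r hr => sub_nonneg.mpr (active r hr)) hs
    linarith [(habs s hs).2]
  have hint : ∀ x y, IntervalIntegrable (fun u => wedge S u d) volume x y := fun x y =>
    (lipschitzWith_wedge_left S d).continuous.intervalIntegrable x y
  have hleft : ∫ u in (-2 : ℝ)..A, wedge S u d =
      ∫ u in (-2 : ℝ)..A, (1 - ∑ r ∈ T, max 0 (u - r * d)) :=
    intervalIntegral.integral_congr fun u hu =>
      wedge_eq_one_sub_sum hTS active inactive hA.le (uIcc_of_le hA2 ▸ hu).2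
  have hright : ∫ u in A..3, wedge S u d = ∫ _ in A..3, (0 : ℝ) :=
    intervalIntegral.integral_congr fun u hu => wedge_eq_zero hTS hA.ge (uIcc_of_le hA3 ▸ hu).1
  rw [area, ← intervalIntegral.integral_add_adjacent_intervals (hint _ A) (hint A _), hleft,
    hright, intervalIntegral.integral_zero, intervalIntegral.integral_sub intervalIntegrable_const
      (Continuous.intervalIntegrable (by fun_prop) _ _), intervalIntegral.integral_const,
    intervalIntegral.integral_finsetSum
      fun r _ => Continuous.intervalIntegrable (by fun_prop) _ _,
    Finset.sum_congr rfl fun r hr => integral_max_zero ⟨(habs r hr).1, active r hr⟩,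
    ← Finset.sum_div, smul_eq_mul]
  ring

end ActiveSet

lemma integral_quadratic {f : ℝ → ℝ} {a b : ℝ} (α β γ : ℝ) (hab : a ≤ b)
    (hf : ∀ x ∈ Icc a b, f x = α + β * x + γ * x ^ 2) :
    IntervalIntegrable f volume a b ∧ ∫ x in a..b, f x =
      α * (b - a) + β * (b ^ 2 - a ^ 2) / 2 + γ * (b ^ 3 - a ^ 3) / 3 := by
  have heq : EqOn f (fun x => α + β * x + γ * x ^ 2) (uIcc a b) := uIcc_of_le hab ▸ hf
  refine ⟨(intervalIntegrable_congr fun x hx => heq (uIoc_subset_uIcc hx)).mpr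
    (Continuous.intervalIntegrable (by fun_prop) _ _), ?_⟩
  rw [intervalIntegral.integral_congr heq,
    intervalIntegral.integral_add (Continuous.intervalIntegrable (by fun_prop) _ _)
      (Continuous.intervalIntegrable (by fun_prop) _ _),
    intervalIntegral.integral_add (Continuous.intervalIntegrable (by fun_prop) _ _)
      (Continuous.intervalIntegrable (by fun_prop) _ _)]
  rw [intervalIntegral.integral_const, intervalIntegral.integral_const_mul β fun x => x,
    intervalIntegral.integral_const_mul γ fun x => x ^ 2, integral_id, integral_pow, smul_eq_mul]
  norm_num
  ring

lemma area_singleton {r : ℤ} (hr : r ∈ Finset.Icc (-2) 2) {d : ℝ} (hd : |d| ≤ 1) :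
    area {r} d = 5 / 2 + r * d := by
  rw [area_eq_of_active hd (Finset.singleton_subset_iff.mpr hr) (Finset.Subset.refl _)
    (A := 1 + r * d)]
  · rw [Finset.sum_singleton]
    ring
  · simp only [Finset.mem_singleton, forall_eq, le_add_iff_nonneg_left, zero_le_one]
  · exact fun _ h h' => absurd h h'
  · rw [Finset.sum_singleton]
    ring

lemma area_pair {r s : ℤ} (hrs : r ≠ s) (hr : r ∈ Finset.Icc (-2) 2) (hs : s ∈ Finset.Icc (-2) 2)
    {d : ℝ} (hd : |d| ≤ 1) (hrsd : |(s - r) * d| ≤ 1) :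
    area {r, s} d = 9 / 4 + (r + s) / 2 * d + -(s - r) ^ 2 / 4 * d ^ 2 := by
  obtain ⟨hlower, hupper⟩ := abs_le.mp hrsd
  rw [area_eq_of_active hd (Finset.insert_subset hr (Finset.singleton_subset_iff.mpr hs))
    (Finset.Subset.refl _) (A := (1 + (r + s) * d) / 2)]
  · rw [Finset.sum_pair hrs]
    ring
  · simp only [Finset.mem_insert, Finset.mem_singleton, forall_eq_or_imp, forall_eq]
    constructor <;> linarith
  · exact fun _ h h' => absurd h h'
  · rw [Finset.sum_pair hrs]
    ring

lemma integral_area_singleton {r : ℤ} (hr : r ∈ Finset.Icc (-2) 2) :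
    ∫ d in (-1 : ℝ)..1, area {r} d = 5 := by
  rw [(integral_quadratic (5 / 2) r 0 (by norm_num) fun d hd => ?_).2]
  · norm_num
  · rw [area_singleton hr (abs_le.mpr hd)]
    ring

lemma integral_area_pair {r s : ℤ} (hrs : s = r + 1) (hr : r ∈ Finset.Icc (-2) 2)
    (hs : s ∈ Finset.Icc (-2) 2) : ∫ d in (-1 : ℝ)..1, area {r, s} d = 13 / 3 := by
  have hsub : (s - r : ℝ) = 1 := by rw [hrs, Int.cast_add, Int.cast_one, add_sub_cancel_left]
  rw [(integral_quadratic (9 / 4) ((r + s) / 2) (-(s - r) ^ 2 / 4) (by norm_num) fun d hd => ?_).2]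
  · rw [hsub]
    norm_num
  · exact area_pair (by omega) hr hs (abs_le.mpr hd) (by rwa [hsub, one_mul, abs_le])

lemma area_pair_outer_of_le {d : ℝ} (hl : -1 ≤ d) (hu : d ≤ -1 / 3) :
    area {-1, 2} d = 5 / 2 + 2 * d + 0 * d ^ 2 := by
  rw [area_eq_of_active (T := {2}) (A := 1 + 2 * d) (abs_le.mpr ⟨hl, by linarith⟩) (by decide)
    (by decide) (by norm_num) (by norm_num; linarith) (by norm_num)]
  norm_num
  ring

lemma area_pair_outer_of_ge {d : ℝ} (hl : 1 / 3 ≤ d) (hu : d ≤ 1) :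
    area {-1, 2} d = 5 / 2 + -1 * d + 0 * d ^ 2 := by
  rw [area_eq_of_active (T := {-1}) (A := 1 - d) (abs_le.mpr ⟨by linarith, hu⟩) (by decide)
    (by decide) (by norm_num) (by norm_num; linarith) (by norm_num)]
  norm_num
  ring

lemma integral_area_pair_outer : ∫ d in (-1 : ℝ)..1, area {-1, 2} d = 31 / 9 := by
  have hmiddle : ∀ d ∈ Icc (-1 / 3 : ℝ) (1 / 3),
      area {-1, 2} d = 9 / 4 + 1 / 2 * d + -9 / 4 * d ^ 2 := fun d ⟨hl, hu⟩ => by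
    rw [area_pair (by decide) (by decide) (by decide) (abs_le.mpr ⟨by linarith, by linarith⟩)
      (abs_le.mpr ⟨by push_cast; linarith, by push_cast; linarith⟩)]
    norm_num
  obtain ⟨hint₁, hval₁⟩ := integral_quadratic _ _ _ (by norm_num) fun d hd =>
    area_pair_outer_of_le hd.1 hd.2
  obtain ⟨hint₂, hval₂⟩ := integral_quadratic _ _ _ (by norm_num) hmiddle
  obtain ⟨hint₃, hval₃⟩ := integral_quadratic _ _ _ (by norm_num) fun d hd =>
    area_pair_outer_of_ge hd.1 hd.2
  rw [← intervalIntegral.integral_add_adjacent_intervals (hint₁.trans hint₂) hint₃,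
    ← intervalIntegral.integral_add_adjacent_intervals hint₁ hint₂, hval₁, hval₂, hval₃]
  norm_num

section Divisors

variable {d : ℝ}

lemma area_divisors_of_le_neg_third (hl : -1 ≤ d) (hu : d ≤ -1 / 3) :
    area {-1, 0, 1, 2} d = 9 / 4 + 3 / 2 * d + -1 / 4 * d ^ 2 := by
  rw [area_eq_of_active (T := {1, 2}) (A := (1 + 3 * d) / 2) (abs_le.mpr ⟨hl, by linarith⟩)
    (by decide) (by decide)]
  · norm_num; ring
  · norm_num; grind
  · norm_num; grind
  · norm_num; ring

lemma area_divisors_of_mem_neg_third_neg_sixth (hl : -1 / 3 ≤ d) (hu : d ≤ -1 / 6) :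
    area {-1, 0, 1, 2} d = 13 / 6 + 1 * d + -1 * d ^ 2 := by
  rw [area_eq_of_active (T := {0, 1, 2}) (A := 1 / 3 + d) (abs_le.mpr ⟨by linarith, by linarith⟩)
    (by decide) (by decide)]
  · norm_num; ring
  · norm_num; grind
  · norm_num; grind
  · norm_num; ring

lemma area_divisors_of_mem_neg_sixth_sixth (hl : -1 / 6 ≤ d) (hu : d ≤ 1 / 6) :
    area {-1, 0, 1, 2} d = 17 / 8 + 1 / 2 * d + -5 / 2 * d ^ 2 := by
  rw [area_eq_of_active (T := {-1, 0, 1, 2}) (A := (1 + 2 * d) / 4)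
    (abs_le.mpr ⟨by linarith, by linarith⟩) (by decide) (by decide)]
  · norm_num; ring
  · norm_num; grind
  · norm_num
  · norm_num; ring

lemma area_divisors_of_mem_sixth_third (hl : 1 / 6 ≤ d) (hu : d ≤ 1 / 3) :
    area {-1, 0, 1, 2} d = 13 / 6 + 0 * d + -1 * d ^ 2 := by
  rw [area_eq_of_active (T := {-1, 0, 1}) (A := 1 / 3) (abs_le.mpr ⟨by linarith, by linarith⟩)
    (by decide) (by decide)]
  · norm_num; ring
  · norm_num; grind
  · norm_num; grind
  · norm_num

lemma area_divisors_of_third_le (hl : 1 / 3 ≤ d) (hu : d ≤ 1) :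
    area {-1, 0, 1, 2} d = 9 / 4 + -1 / 2 * d + -1 / 4 * d ^ 2 := by
  rw [area_eq_of_active (T := {-1, 0}) (A := (1 - d) / 2) (abs_le.mpr ⟨by linarith, hu⟩)
    (by decide) (by decide)]
  · norm_num; ring
  · norm_num; grind
  · norm_num; grind
  · norm_num; ring

lemma integral_area_divisors : ∫ d in (-1 : ℝ)..1, area {-1, 0, 1, 2} d = 715 / 216 := by
  obtain ⟨hint₁, hval₁⟩ := integral_quadratic _ _ _ (by norm_num) fun d hd =>
    area_divisors_of_le_neg_third hd.1 hd.2
  obtain ⟨hint₂, hval₂⟩ := integral_quadratic _ _ _ (by norm_num) fun d hd =>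
    area_divisors_of_mem_neg_third_neg_sixth hd.1 hd.2
  obtain ⟨hint₃, hval₃⟩ := integral_quadratic _ _ _ (by norm_num) fun d hd =>
    area_divisors_of_mem_neg_sixth_sixth hd.1 hd.2
  obtain ⟨hint₄, hval₄⟩ := integral_quadratic _ _ _ (by norm_num) fun d hd =>
    area_divisors_of_mem_sixth_third hd.1 hd.2
  obtain ⟨hint₅, hval₅⟩ := integral_quadratic _ _ _ (by norm_num) fun d hd =>
    area_divisors_of_third_le hd.1 hd.2
  rw [← intervalIntegral.integral_add_adjacent_intervals
      (((hint₁.trans hint₂).trans hint₃).trans hint₄) hint₅,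
    ← intervalIntegral.integral_add_adjacent_intervals ((hint₁.trans hint₂).trans hint₃) hint₄,
    ← intervalIntegral.integral_add_adjacent_intervals (hint₁.trans hint₂) hint₃,
    ← intervalIntegral.integral_add_adjacent_intervals hint₁ hint₂,
    hval₁, hval₂, hval₃, hval₄, hval₅]
  norm_num

end Divisors

/-! ### The asymptotics of the dimensions -/

lemma count_singleton (r : ℤ) (m : ℕ) (n : ℤ × ℤ) : count {r} m n = m + 1 - ord m n r := by
  rw [count, Finset.sum_singleton]

lemma count_pair {r s : ℤ} (hrs : r ≠ s) (m : ℕ) (n : ℤ × ℤ) :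
    count {r, s} m n = m + 1 - (ord m n r + ord m n s) := by
  rw [count, Finset.sum_pair hrs]

lemma count_divisors (m : ℕ) (n : ℤ × ℤ) : count {-1, 0, 1, 2} m n =
    m + 1 - (ord m n (-1) + ord m n 0 + ord m n 1 + ord m n 2) := by
  rw [count, Finset.sum_insert (by decide), Finset.sum_insert (by decide),
    Finset.sum_pair (by decide), add_assoc, add_assoc]

lemma cast_extDim (m : ℕ) (n : ℤ × ℤ) :
    (extDim m n : ℝ) = count {-1, 2} m n - count {-1, 0, 1, 2} m n := by
  have hadd : extDim m n + count {-1, 0, 1, 2} m n = count {-1, 2} m n := by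
    rw [extDim, count_pair (by decide), count_divisors]
    omega
  exact eq_sub_of_add_eq (by exact_mod_cast hadd)

lemma cast_cechDim (m : ℕ) (n : ℤ × ℤ) :
    (cechDim m n : ℝ) = count {0} m n + count {1} m n -
      (count {-1, 0} m n + count {0, 1} m n + count {1, 2} m n - count {-1, 0, 1, 2} m n) := by
  have hadd : cechDim m n + (count {-1, 0} m n + count {0, 1} m n + count {1, 2} m n) =
      count {0} m n + count {1} m n + count {-1, 0, 1, 2} m n := by
    simp only [cechDim, count_singleton, count_divisors, count_pair, ne_eq, Int.reduceNeg,
      Int.reduceEq, not_false_eq_true]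
    omega
  have hcast : (cechDim m n : ℝ) + (count {-1, 0} m n + count {0, 1} m n + count {1, 2} m n) =
      count {0} m n + count {1} m n + count {-1, 0, 1, 2} m n := by exact_mod_cast hadd
  linarith

theorem tendsto_sum_extDim :
    Tendsto (fun m : ℕ => ((∑ n ∈ weightBox m, extDim m n : ℕ) : ℝ) / (m : ℝ) ^ 3) atTop
      (𝓝 (29 / 216)) := by
  have h := (tendsto_sum_count {-1, 2}).sub (tendsto_sum_count {-1, 0, 1, 2})
  rw [integral_area_pair_outer, integral_area_divisors] at h
  convert h using 2 with m
  · simp only [Nat.cast_sum, cast_extDim, Finset.sum_sub_distrib]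
    ring
  · norm_num

theorem tendsto_sum_cechDim :
    Tendsto (fun m : ℕ => ((∑ n ∈ weightBox m, cechDim m n : ℕ) : ℝ) / (m : ℝ) ^ 3) atTop
      (𝓝 (67 / 216)) := by
  have h := ((tendsto_sum_count {0}).add (tendsto_sum_count {1})).sub
    ((((tendsto_sum_count {-1, 0}).add (tendsto_sum_count {0, 1})).add
      (tendsto_sum_count {1, 2})).sub (tendsto_sum_count {-1, 0, 1, 2}))
  rw [integral_area_singleton (by decide), integral_area_singleton (by decide),
    integral_area_pair (by decide) (by decide) (by decide),
    integral_area_pair (by decide) (by decide) (by decide),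
    integral_area_pair (by decide) (by decide) (by decide), integral_area_divisors] at h
  convert h using 2 with m
  · simp only [Nat.cast_sum, cast_cechDim, Finset.sum_sub_distrib, Finset.sum_add_distrib]
    ring
  · norm_num

end A2Resolution

end

theorem proposition1 :
    (∀ W : TopologicalSpace.Opens A2Resolution, A2Resolution.exceptional ⊆ W →
      (∀ m : ℕ, FiniteDimensional ℂ
        (SymmetricDifferential.ExtensionQuotient (ℂ × ℂ) m W A2Resolution.regular)) ∧
      Filter.Tendsto
        (fun m : ℕ => (Module.finrank ℂ
          (SymmetricDifferential.ExtensionQuotient (ℂ × ℂ) m W A2Resolution.regular) : ℝ)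
            / (m : ℝ) ^ 3)
        Filter.atTop (nhds (29 / 216))) ∧
    (∀ m : ℕ, FiniteDimensional ℂ
      (SymmetricDifferential.CechH1 (ℂ × ℂ) m A2Resolution.chartDomain)) ∧
    Filter.Tendsto
      (fun m : ℕ => (Module.finrank ℂ
        (SymmetricDifferential.CechH1 (ℂ × ℂ) m A2Resolution.chartDomain) : ℝ)
          / (m : ℝ) ^ 3)
      Filter.atTop (nhds (67 / 216)) := by
  refine ⟨fun W hW => ⟨fun m => (A2Resolution.finrank_extensionQuotient hW m).1, ?_⟩,
    fun m => (A2Resolution.finrank_cechH1 m).1, ?_⟩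
  · simp only [(A2Resolution.finrank_extensionQuotient hW _).2]
    exact A2Resolution.tendsto_sum_extDim
  · simp only [(A2Resolution.finrank_cechH1 _).2]
    exact A2Resolution.tendsto_sum_cechDim
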